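/- Let $G=(V,E)$ be a finite undirected multigraph that is $5$-edge-connected, i.e. any two distinct vertices are joined by $5$ pairwise edge-disjoint paths, and let $d\in V$ be a destination. A set of deterministic routing functions assigns to every vertex $v$ a function that maps the set of active (non-failed) edges incident at $v$ and the incoming edge of a packet (or the information that the packet originates at $v$) to an outgoing edge. It is called $c$-resilient if, for every set of at most $c$ failed edges, a packet originated at any vertex $v$ that is still connected to $d$ reaches $d$. Then there are five pairwise arc-disjoint spanning arborescences $T_1,\dots,T_5$ of the directed copy of $G$ (in which every edge is replaced by its two orientations), all directed towards the root $d$, and a choice of an index $s(v)\in\{1,2,3,4\}$ for every vertex $v$, such that the following hold. 1. Every circular routing along $T_1,\dots,T_4$ is $3$-resilient. In a circular routing, each vertex sends the packets that it originates along one of these four arborescences, chosen arbitrarily, and whenever a packet hits a failed edge while routed along $T_i$, it is switched to the next arborescence $T_{i+1}$ (to $T_1$ if $i=4$). 2. Consider the deterministic routing functions that route every packet first along $T_5$ and, when the packet hits a failed edge along $T_5$ at a vertex $v$, switch it to the circular routing along $T_1,\dots,T_4$, starting with $T_{s(v)}$. These routing functions are $4$-resilient. Moreover, if $f\le 4$ edges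 fail, every packet reaches $d$ after at most $2f$ switches between arborescences. In particular, every $5$-edge-connected graph admits, for every destination, a set of $4$-resilient deterministic routing functions with at most $2f$ tree switches, where $f$ is the number of failed edges. -/

import Mathlib

open scoped Graph

namespace StaticRouting

variable {α β ι : Type*}

/-! ### Arcs, paths, edge-connectivity -/

/-- An arc: an edge `edge` together with a direction, from `tail` to `head`. (The edge is part of
the data because parallel edges are allowed.) -/
structure Arc (α β : Type*) where
  edge : β
  tail : α
  head : α

/-- The arcs of the directed copy of `G`: every edge gives its two orientations. -/
def arcs (G : Graph α β) : Set (Arc α β) :=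
  {a | G.IsLink a.edge a.tail a.head}

/-- `IsDiwalk A x p y`: the list `p` of arcs in `A` is a directed walk from `x` to `y`. -/
inductive IsDiwalk (A : Set (Arc α β)) : α → List (Arc α β) → α → Prop
  | nil (x : α) : IsDiwalk A x [] x
  | cons {a : Arc α β} {p : List (Arc α β)} {y : α} :
      a ∈ A → IsDiwalk A a.head p y → IsDiwalk A a.tail (a :: p) y

/-- `p` is a path of the undirected multigraph `G` from `x` to `y` (no repeated vertices). -/
def IsPath (G : Graph α β) (x : α) (p : List (Arc α β)) (y : α) : Prop :=
  IsDiwalk (arcs G) x p y ∧ (x :: p.map Arc.head).Nodup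

/-- Any two distinct vertices are joined by `k` pairwise edge-disjoint paths. -/
def IsEdgeConnected (G : Graph α β) (k : ℕ) : Prop :=
  ∀ x ∈ V(G), ∀ y ∈ V(G), x ≠ y → ∃ p : Fin k → List (Arc α β),
    (∀ i, IsPath G x (p i) y) ∧
      ∀ i j, i ≠ j → ∀ a ∈ p i, ∀ b ∈ p j, a.edge ≠ b.edge

/-- `T` is (the arc set of) a spanning arborescence of the directed copy of `G` rooted at `r`,
with all arcs directed towards the root. -/
structure IsSpanningArborescence (G : Graph α β) (r : α) (T : Set (Arc α β)) : Prop where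
  root_mem : r ∈ V(G)
  subset_arcs : T ⊆ arcs G
  no_out_iff : ∀ v ∈ V(G), (∀ a ∈ T, a.tail ≠ v) ↔ v = r
  unique_path : ∀ v ∈ V(G), v ≠ r → ∃! p, IsDiwalk T v p r

/-! ### Deterministic static routing functions -/

/-- A set of deterministic routing functions, one for each vertex: the outgoing edge is a function
of the set of active (non-failed) edges incident at the vertex and of the incoming edge, which is
`none` for a packet that originates at the vertex. The value `none` means that the packet is
dropped. -/
abbrev RoutingFunctions (α β : Type*) := α → Set β → Option β → Option β

/-- The active edges incident at `v` when the edges in `F` have failed. -/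
def activeAt (G : Graph α β) (F : Set β) (v : α) : Set β :=
  {e | G.Inc e v ∧ e ∉ F}

/-- One hop of a packet. The packet, currently at `v ≠ d` after arriving over `inc`, is sent over
the edge selected by the routing function at `v`, provided that this edge is incident at `v` and
active. -/
inductive Step (G : Graph α β) (d : α) (R : RoutingFunctions α β) (F : Set β) :
    α × Option β → α × Option β → Prop
  | hop {v w : α} {inc : Option β} {e : β} :
      v ≠ d → R v (activeAt G F v) inc = some e → e ∈ activeAt G F v → G.IsLink e v w →
      Step G d R F (v, inc) (w, some e)

/-- The packet originated at `v` reaches `d` when the edges in `F` have failed. -/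
def Delivers (G : Graph α β) (d : α) (R : RoutingFunctions α β) (F : Set β) (v : α) : Prop :=
  ∃ inc, Relation.ReflTransGen (Step G d R F) (v, none) (d, inc)

/-- `R` is `c`-resilient for the destination `d`: whenever at most `c` edges fail, the packet
originated at any vertex that is still connected to `d` reaches `d`. -/
def IsResilient (G : Graph α β) (d : α) (R : RoutingFunctions α β) (c : ℕ) : Prop :=
  ∀ F ⊆ E(G), F.encard ≤ c → ∀ v ∈ V(G),
    (∃ p, IsPath (G.deleteEdges F) v p d) → Delivers G d R F v

/-! ### Arborescence-based routing -/

/-- An arborescence-based routing scheme: a family of trees, the tree along which each vertex sends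
the packets that it originates, and the tree to which a vertex `v` switches a packet whose outgoing
arc at `v` in the current tree has failed. -/
structure TreeScheme (α β ι : Type*) where
  tree : ι → Set (Arc α β)
  first : α → ι
  reroute : α → ι → ι

namespace TreeScheme

/-- `S.Arrives v inc i`: a packet that is at `v` with incoming edge `inc` is being routed along the
tree `i`. It is the first tree of `v` if the packet originates at `v`, and otherwise the tree that
contains the arc into `v` over which the packet arrived. -/
def Arrives (S : TreeScheme α β ι) (v : α) : Option β → ι → Prop
  | none, i => i = S.first v
  | some e, i => ∃ u, (⟨e, u, v⟩ : Arc α β) ∈ S.tree i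

/-- `S.Selects v act i n e`: a packet being routed along tree `i` leaves `v` over the edge `e`
after exactly `n` switches of tree at `v`, if `act` is the set of active edges at `v`. -/
inductive Selects (S : TreeScheme α β ι) (v : α) (act : Set β) : ι → ℕ → β → Prop
  | forward {i : ι} {a : Arc α β} :
      a ∈ S.tree i → a.tail = v → a.edge ∈ act → Selects S v act i 0 a.edge
  | switch {i : ι} {a : Arc α β} {n : ℕ} {e : β} :
      a ∈ S.tree i → a.tail = v → a.edge ∉ act → Selects S v act (S.reroute v i) n e →
      Selects S v act i (n + 1) e

open Classical in
/-- The deterministic routing functions of the scheme `S`. -/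
noncomputable def routing (S : TreeScheme α β ι) : RoutingFunctions α β :=
  fun v act inc =>
    if h : ∃ e i n, S.Arrives v inc i ∧ S.Selects v act i n e then some h.choose else none

/-- `S.Trajectory G d F s n v inc`: the packet originated at `s` and routed by `S.routing` under the
failures `F` is at some moment at the vertex `v`, having arrived over `inc`, and the total number
of switches between trees until then is `n`. -/
inductive Trajectory (S : TreeScheme α β ι) (G : Graph α β) (d : α) (F : Set β) (s : α) :
    ℕ → α → Option β → Prop
  | start : Trajectory S G d F s 0 s none
  | hop {m n : ℕ} {v w : α} {inc : Option β} {e : β} {i : ι} :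
      Trajectory S G d F s m v inc → Step G d S.routing F (v, inc) (w, some e) →
      S.Arrives v inc i → S.Selects v (activeAt G F v) i n e →
      Trajectory S G d F s (m + n) w (some e)

/-- The packet originated at `s` reaches `d` after exactly `n` switches between trees. -/
def DeliversWith (S : TreeScheme α β ι) (G : Graph α β) (d : α) (F : Set β) (s : α) (n : ℕ) :
    Prop :=
  ∃ inc, S.Trajectory G d F s n d inc

/-- Circular-arborescence routing along `T 0, …, T (k - 1)`: a vertex `v` sends its own packets
along `T (start v)`, and a packet that hits a failed edge along `T i` is switched to the next tree
`T (i + 1)`, indices modulo `k`. -/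
def circular {k : ℕ} [NeZero k] (T : Fin k → Set (Arc α β)) (start : α → Fin k) :
    TreeScheme α β (Fin k) where
  tree := T
  first := start
  reroute := fun _ i => i + 1

/-- Every packet is first routed along the last tree `T k`. When it hits a failed edge along that
tree, at a vertex `v`, it is switched to circular-arborescence routing along `T 0, …, T (k - 1)`,
starting with `T (entry v)`. -/
def lastThenCircular {k : ℕ} [NeZero k] (T : Fin (k + 1) → Set (Arc α β)) (entry : α → Fin k) :
    TreeScheme α β (Fin (k + 1)) where
  tree := T
  first := fun _ => Fin.last k
  reroute := fun v i =>
    Fin.lastCases (motive := fun _ => Fin (k + 1)) (entry v).castSucc (fun j => (j + 1).castSucc) i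

end TreeScheme

end StaticRouting

namespace StaticRouting

set_option linter.unusedSectionVars false

/-! ### Cuts and complete splitting at a vertex of degree four. -/

section

variable {α β : Type*}

/-! Arc-disjointness alone is not enough for the resilience claims: one failed edge may destroy two
arcs. The trees are therefore built so that, with indices starting at 0, trees 0, 2 and trees 1, 3
are moreover edge-disjoint (`mate`). In circular order, hits two trees apart then concern different
edges. Consecutive hits always do, because the reverse of a failed arc leads back to the vertex
where the packet already is. With three failed edges, hit 3 must repeat hit 0 and hit 6 must repeat
hit 3, although hits 0 and 6 belong to mates (`false_of_seven_hits`). For the fifth tree, the entry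
at `v` is the circular tree containing the reverse of the arc of `v`, if there is one. This delays a
second encounter with the first failed edge by a full round, and the next seven hits are shown to
avoid it (`lastThenCircular_reaches`).

The trees come from an induction (`hasPacking`) whose hypothesis is the cut condition: at least five
edges leave every nonempty set avoiding the root. Redundant edges are deleted, so every remaining
edge crosses a tight set, one left by exactly five edges. Since five is odd, tight sets do not cross
(`not_crossing`). Inside a minimal tight set with at least two vertices, an edge crosses only tight
sets consisting of one of its ends. Three reductions follow. If just one end has degree five, the
edge is deleted and the other four edges at that end are split off in pairs (`hasPacking_of_split`).
If both ends have degree five and the edge is simple, this is done at both ends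
(`hasPacking_of_split_pair`). If no inner edge is simple, a degree count shows that the set spans a
pentagon with doubled edges, which is contracted (`hasPacking_of_parallel`,
`hasPacking_of_pentagon`). When every tight set is a single vertex, the first reduction applies at a
neighbour of the root.

A suitable splitting exists by an uncrossing argument on three bad sets (`HalfEdges.exists_split`).
Undoing it extends four of the five trees to the split vertex (`TreePacking.pinch`, based on
`exists_exits`), and the deleted edge serves the tree left over. If two trees are left over at the
two ends of one edge, a third tree may have to be redirected (`TreePacking.join`). Integer heights
that decrease along the arcs certify acyclicity throughout. -/

/-- The number of edges with exactly one end in the vertex set `p`. -/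
def cut (E : Finset β) (ends : β → Bool → α) (p : α → Bool) : ℕ :=
  ∑ e ∈ E, if p (ends e true) = p (ends e false) then 0 else 1

/-- The four darts `D k` are the edges at `z`, each directed towards `z`. -/
structure HalfEdges (E : Finset β) (ends : β → Bool → α) (z : α) (D : Fin 4 → β × Bool) :
    Prop where
  edge_mem : ∀ k, (D k).1 ∈ E
  inj : Function.Injective fun k => (D k).1
  head : ∀ k, ends (D k).1 (!(D k).2) = z
  tail_ne : ∀ k, ends (D k).1 (D k).2 ≠ z
  complete : ∀ e ∈ E, ∀ b, ends e b = z → ∃ k, e = (D k).1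

theorem HalfEdges.perm {E : Finset β} {ends : β → Bool → α} {z : α} {D : Fin 4 → β × Bool}
    (hD : HalfEdges E ends z D) (σ : Equiv.Perm (Fin 4)) : HalfEdges E ends z (D ∘ σ) where
  edge_mem k := hD.edge_mem _
  inj := hD.inj.comp σ.injective
  head k := hD.head _
  tail_ne k := hD.tail_ne _
  complete e he b hb := by
    obtain ⟨k, hk⟩ := hD.complete e he b hb
    exact ⟨σ.symm k, by simpa using hk⟩

theorem cut_congr {E : Finset β} {ends ends' : β → Bool → α} {p q : α → Bool}
    (h : ∀ e ∈ E, ∀ b, p (ends e b) = q (ends' e b)) : cut E ends p = cut E ends' q :=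
  Finset.sum_congr rfl fun e he => by rw [h e he, h e he]

theorem cut_compl (E : Finset β) (ends : β → Bool → α) (p : α → Bool) :
    cut E ends (fun v => !p v) = cut E ends p :=
  Finset.sum_congr rfl fun e _ => by simp

variable [DecidableEq β]

/-- The ends of the edges after splitting off the pairs `D 0, D 1` and `D 2, D 3`. The edges of
`D 0` and `D 2` are reused. -/
def splitEnds (ends : β → Bool → α) (D : Fin 4 → β × Bool) : β → Bool → α := fun e b =>
  if e = (D 0).1 ∧ b = !(D 0).2 then ends (D 1).1 (D 1).2
  else if e = (D 2).1 ∧ b = !(D 2).2 then ends (D 3).1 (D 3).2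
  else ends e b

/-- The edges left after splitting off the pairs `D 0, D 1` and `D 2, D 3`. -/
def splitEdges (E : Finset β) (D : Fin 4 → β × Bool) : Finset β :=
  (E.erase (D 1).1).erase (D 3).1

/-- The edges not at the vertex with half-edges `D`. -/
def restEdges (E : Finset β) (D : Fin 4 → β × Bool) : Finset β :=
  E \ Finset.univ.image fun k => (D k).1

variable {E : Finset β} {ends : β → Bool → α} {z : α} {D : Fin 4 → β × Bool}

theorem HalfEdges.rest_ne (hD : HalfEdges E ends z D) {e : β} (he : e ∈ restEdges E D) (b : Bool) :
    ends e b ≠ z := by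
  intro h
  simp only [restEdges, Finset.mem_sdiff, Finset.mem_image, Finset.mem_univ, true_and] at he
  obtain ⟨k, hk⟩ := hD.complete e he.1 b h
  exact he.2 ⟨k, hk.symm⟩

theorem ite_dart (ends : β → Bool → α) (p : α → Bool) (a : β × Bool) :
    (if p (ends a.1 true) = p (ends a.1 false) then 0 else 1 : ℕ) =
      if p (ends a.1 a.2) = p (ends a.1 (!a.2)) then 0 else 1 := by
  rcases a with ⟨e, _ | _⟩ <;> simp [eq_comm]

theorem HalfEdges.cut_eq (hD : HalfEdges E ends z D) (p : α → Bool) :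
    cut E ends p = cut (restEdges E D) ends p +
      ∑ k, if p (ends (D k).1 (D k).2) = p z then 0 else 1 := by
  have hsub : (Finset.univ.image fun k => (D k).1) ⊆ E := by
    intro e he
    simp only [Finset.mem_image, Finset.mem_univ, true_and] at he
    obtain ⟨k, rfl⟩ := he
    exact hD.edge_mem k
  unfold cut restEdges
  rw [← Finset.sum_sdiff hsub, Finset.sum_image fun a _ b _ h => hD.inj h]
  congr 1
  refine Finset.sum_congr rfl fun k _ => ?_
  rw [ite_dart, hD.head]

/-- Each split-off pair becomes one edge, which crosses exactly when the far ends of the pair are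
separated; the edges away from `z` are untouched. -/
theorem HalfEdges.cut_split (hD : HalfEdges E ends z D) (p : α → Bool) :
    cut (splitEdges E D) (splitEnds ends D) p = cut (restEdges E D) ends p +
      ((if p (ends (D 0).1 (D 0).2) = p (ends (D 1).1 (D 1).2) then 0 else 1) +
      if p (ends (D 2).1 (D 2).2) = p (ends (D 3).1 (D 3).2) then 0 else 1) := by
  have hne : ∀ {k l : Fin 4}, k ≠ l → (D k).1 ≠ (D l).1 := fun h h' => h (hD.inj h')
  have h1 : splitEdges E D = restEdges E D ∪ {(D 0).1, (D 2).1} := by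
    ext e
    simp only [splitEdges, restEdges, Finset.mem_erase, Finset.mem_sdiff, Finset.mem_image,
      Finset.mem_univ, true_and, Finset.mem_union, Finset.mem_insert, Finset.mem_singleton,
      Fin.exists_fin_succ, Fin.exists_fin_zero]
    constructor
    · rintro ⟨h3, h1, he⟩
      by_cases h0 : e = (D 0).1
      · simp [h0]
      by_cases h2 : e = (D 2).1
      · simp [h2]
      left
      refine ⟨he, ?_⟩
      intro h
      rcases h with h | h | h | h | h
      · exact h0 h.symm
      · exact h1 h.symm
      · exact h2 h.symm
      · exact h3 h.symm
      · exact h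
    · rintro (⟨he, h⟩ | rfl | rfl)
      · refine ⟨fun h' => h ?_, fun h' => h ?_, he⟩
        · right; right; right; left; exact h'.symm
        · right; left; exact h'.symm
      · exact ⟨hne (by decide), hne (by decide), hD.edge_mem _⟩
      · exact ⟨hne (by decide), hne (by decide), hD.edge_mem _⟩
  have h2 : Disjoint (restEdges E D) {(D 0).1, (D 2).1} := by
    rw [Finset.disjoint_right]
    intro e he h
    simp only [restEdges, Finset.mem_sdiff, Finset.mem_image, Finset.mem_univ, true_and,
      not_exists] at h
    simp only [Finset.mem_insert, Finset.mem_singleton] at he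
    rcases he with rfl | rfl
    · exact h.2 0 rfl
    · exact h.2 2 rfl
  unfold cut
  rw [h1, Finset.sum_union h2, Finset.sum_pair (hne (by decide))]
  congr 1
  · refine Finset.sum_congr rfl fun e he => ?_
    have h0 : e ≠ (D 0).1 := fun h => Finset.disjoint_left.1 h2 he (by simp [h])
    have h2 : e ≠ (D 2).1 := fun h => Finset.disjoint_left.1 h2 he (by simp [h])
    simp [splitEnds, h0, h2]
  · rw [ite_dart _ p (D 0), ite_dart _ p (D 2)]
    have := hne (show (2 : Fin 4) ≠ 0 by decide)
    simp [splitEnds, this, this.symm]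

/-- The inequality behind complete splitting at a vertex of degree four, for a single edge. -/
theorem atom_inequality (s a b : Fin 3 → Bool) :
    (∑ k : Fin 4, if (decide (a = ![s, ![s 0, !s 1, !s 2], ![!s 0, s 1, !s 2],
        ![!s 0, !s 1, s 2]] k)) = decide (b = ![s, ![s 0, !s 1, !s 2], ![!s 0, s 1, !s 2],
        ![!s 0, !s 1, s 2]] k) then 0 else 1) ≤
      ∑ i : Fin 3, if a i = b i then 0 else 1 := by
  revert s a b
  -- The four vectors form one parity class, any two of them differing in exactly two coordinates.
  -- An edge whose ends differ in one coordinate thus bounds at most one of the four atoms, and no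
  -- edge bounds more than two.
  have : ∀ s0 s1 s2 a0 a1 a2 b0 b1 b2 : Bool,
    (∑ k : Fin 4, if (decide ((![a0,a1,a2] : Fin 3 → Bool) =
        ![![s0,s1,s2], ![s0, !s1, !s2], ![!s0, s1, !s2], ![!s0, !s1, s2]] k)) =
        decide ((![b0,b1,b2] : Fin 3 → Bool) =
        ![![s0,s1,s2], ![s0, !s1, !s2], ![!s0, s1, !s2],
        ![!s0, !s1, s2]] k) then 0 else 1) ≤
      ∑ i : Fin 3, if (![a0,a1,a2] : Fin 3 → Bool) i = (![b0,b1,b2] : Fin 3 → Bool) i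
        then 0 else 1 := by
    decide +kernel
  intro s a b
  have e : ∀ f : Fin 3 → Bool, f = ![f 0, f 1, f 2] := fun f => by
    ext i; fin_cases i <;> rfl
  have := this (s 0) (s 1) (s 2) (a 0) (a 1) (a 2) (b 0) (b 1) (b 2)
  rwa [← e, ← e, ← e] at this


/-- A set violating the cut condition after splitting contains exactly one of the two pairs. -/
theorem HalfEdges.pattern [DecidableEq α] (hD : HalfEdges E ends z D) {p : α → Bool}
    (h : cut (splitEdges E D) (splitEnds ends D) p < 5)
    (h1 : 5 ≤ cut E ends (Function.update p z false))
    (h2 : 5 ≤ cut E ends (Function.update p z true)) :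
    cut (restEdges E D) ends p ≤ 4 ∧ p (ends (D 1).1 (D 1).2) = p (ends (D 0).1 (D 0).2) ∧
      p (ends (D 2).1 (D 2).2) = (!p (ends (D 0).1 (D 0).2)) ∧
      p (ends (D 3).1 (D 3).2) = (!p (ends (D 0).1 (D 0).2)) := by
  rw [hD.cut_split] at h
  have hr : ∀ x, cut (restEdges E D) ends (Function.update p z x) =
      cut (restEdges E D) ends p := fun x =>
    cut_congr fun e he b => Function.update_of_ne (hD.rest_ne he b) _ _
  rw [hD.cut_eq, hr] at h1 h2
  simp only [Function.update_self, Function.update_of_ne (hD.tail_ne _), Fin.sum_univ_four]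
    at h1 h2
  generalize p (ends (D 0).1 (D 0).2) = a at *
  generalize p (ends (D 1).1 (D 1).2) = b at *
  generalize p (ends (D 2).1 (D 2).2) = c at *
  generalize p (ends (D 3).1 (D 3).2) = d at *
  revert h h1 h2
  -- The vertex `z` can be put on either side. Splitting can lose edges against the cheaper choice
  -- only when the four far ends are divided two against two and neither pair is separated.
  cases a <;> cases b <;> cases c <;> cases d <;> simp <;> omega

/-- Complete splitting at a vertex of degree four. The set `{z'}` is exempt from the cut
condition. -/
theorem HalfEdges.exists_split (hD : HalfEdges E ends z D) {V : Finset α} {d z' : α}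
    (hz : z ≠ d) (hends : ∀ e ∈ E, ∀ b, ends e b ∈ V)
    (hz' : ∀ k, ends (D k).1 (D k).2 ≠ z')
    (hcut : ∀ p : α → Bool, p d = false → (∃ v ∈ V, v ≠ z ∧ p v = true) →
      (∃ v ∈ V, ¬(p v = true ↔ v = z')) → 5 ≤ cut E ends p) :
    ∃ σ : Equiv.Perm (Fin 4), ∀ p : α → Bool, p d = false → (∃ v ∈ V, v ≠ z ∧ p v = true) →
      (∃ v ∈ V, v ≠ z ∧ ¬(p v = true ↔ v = z')) →
      5 ≤ cut (splitEdges E (D ∘ σ)) (splitEnds ends (D ∘ σ)) p := by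
  classical
  by_contra! hcon
  have hb : ∀ σ : Equiv.Perm (Fin 4), ∃ p : α → Bool, cut (restEdges E D) ends p ≤ 4 ∧
      p (ends (D (σ 1)).1 (D (σ 1)).2) = p (ends (D (σ 0)).1 (D (σ 0)).2) ∧
      p (ends (D (σ 2)).1 (D (σ 2)).2) = (!p (ends (D (σ 0)).1 (D (σ 0)).2)) ∧
      p (ends (D (σ 3)).1 (D (σ 3)).2) = (!p (ends (D (σ 0)).1 (D (σ 0)).2)) := by
    intro σ
    obtain ⟨p, hpd, ⟨v, hv, hvz, hpv⟩, ⟨w, hw, hwz, hpw⟩, hlt⟩ := hcon σ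
    have key : ∀ x, 5 ≤ cut E ends (Function.update p z x) := fun x => by
      refine hcut _ (by rw [Function.update_of_ne hz.symm, hpd])
        ⟨v, hv, hvz, by rw [Function.update_of_ne hvz, hpv]⟩
        ⟨w, hw, by rw [Function.update_of_ne hwz]; tauto⟩
    obtain ⟨h1, h2⟩ := (hD.perm σ).pattern hlt (key _) (key _)
    refine ⟨p, ?_, h2⟩
    convert h1 using 2
    ext e
    simp only [restEdges, Finset.mem_sdiff, Finset.mem_image, Finset.mem_univ, true_and,
      Function.comp]
    rw [σ.surjective.exists]
  -- The identity and two transpositions give the three ways to pair four half-edges; each one is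
  -- assumed to have a violating set.
  obtain ⟨p0, c0, h01, h02, h03⟩ := hb 1
  obtain ⟨p1, c1, h11, h12, h13⟩ := hb (Equiv.swap 1 2)
  obtain ⟨p2, c2, h21, h22, h23⟩ := hb (Equiv.swap 1 3)
  have s1 : (Equiv.swap 1 2 : Equiv.Perm (Fin 4)) 0 = 0 := by decide
  have s2 : (Equiv.swap 1 2 : Equiv.Perm (Fin 4)) 1 = 2 := by decide
  have s3 : (Equiv.swap 1 2 : Equiv.Perm (Fin 4)) 2 = 1 := by decide
  have s4 : (Equiv.swap 1 2 : Equiv.Perm (Fin 4)) 3 = 3 := by decide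
  have s5 : (Equiv.swap 1 3 : Equiv.Perm (Fin 4)) 0 = 0 := by decide
  have s6 : (Equiv.swap 1 3 : Equiv.Perm (Fin 4)) 1 = 3 := by decide
  have s7 : (Equiv.swap 1 3 : Equiv.Perm (Fin 4)) 2 = 2 := by decide
  have s8 : (Equiv.swap 1 3 : Equiv.Perm (Fin 4)) 3 = 1 := by decide
  rw [s1, s2] at h11
  rw [s1, s3] at h12
  rw [s1, s4] at h13
  rw [s5, s6] at h21
  rw [s5, s7] at h22
  rw [s5, s8] at h23
  simp only [Equiv.Perm.one_apply] at h01 h02 h03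
  set u : Fin 4 → α := fun k => ends (D k).1 (D k).2 with hu
  let s : Fin 3 → Bool := ![p0 (u 0), p1 (u 0), p2 (u 0)]
  let Y : α → Fin 3 → Bool := fun v => ![p0 v, p1 v, p2 v]
  -- The three bad sets halve the four far ends in three different ways, so these ends have four
  -- different membership vectors and lie in four different atoms.
  let c : Fin 4 → Fin 3 → Bool :=
    ![s, ![s 0, !s 1, !s 2], ![!s 0, s 1, !s 2], ![!s 0, !s 1, s 2]]
  have hYu : ∀ k, Y (u k) = c k := by
    intro k
    fin_cases k
    · rfl
    · simp [Y, c, s, u, h01, h12, h23]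
    · simp [Y, c, s, u, h02, h11, h22]
    · simp [Y, c, s, u, h03, h13, h21]
  have hcinj : ∀ k l, c k = c l → k = l := by
    have : ∀ a b c' : Bool, ∀ k l : Fin 4, (![![a, b, c'], ![a, !b, !c'], ![!a, b, !c'],
        ![!a, !b, c']] : Fin 4 → Fin 3 → Bool) k = (![![a, b, c'], ![a, !b, !c'], ![!a, b, !c'],
        ![!a, !b, c']] : Fin 4 → Fin 3 → Bool) l → k = l := by decide +kernel
    exact this _ _ _
  let P : Fin 4 → α → Bool := fun k v => decide (Y v = c k)
  -- With `z` removed, exactly one of the four edges at `z` crosses each atom.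
  let Q : Fin 4 → α → Bool := fun k v => decide (v ≠ z ∧ Y v = c k)
  have hPQ : ∀ k, cut (restEdges E D) ends (Q k) = cut (restEdges E D) ends (P k) := fun k =>
    cut_congr fun e he b => by simp [P, Q, hD.rest_ne he b]
  have huV : ∀ k, u k ∈ V := fun k => hends _ (hD.edge_mem k) _
  have hQ : ∀ k, 5 ≤ cut E ends (Q k) := by
    intro k
    by_cases hd : Q k d = true
    -- The cut condition only concerns sets avoiding `d`, so an atom containing `d` is replaced by
    -- its complement.
    · rw [← cut_compl]
      obtain ⟨l, hl⟩ : ∃ l : Fin 4, l ≠ k := exists_ne k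
      have hql : Q k (u l) = false := by
        simp only [Q, hYu, decide_eq_false_iff_not, not_and]
        exact fun _ h => hl (hcinj _ _ h)
      exact hcut _ (by simp [hd]) ⟨u l, huV l, hD.tail_ne l, by simp [hql]⟩
        ⟨u l, huV l, by simpa [hql] using hz' l⟩
    · have hqk : Q k (u k) = true := by
        simp only [Q, hYu, decide_eq_true_eq, and_true]
        exact hD.tail_ne k
      exact hcut _ (by simpa using hd) ⟨u k, huV k, hD.tail_ne k, hqk⟩
        ⟨u k, huV k, by simpa [hqk] using hz' k⟩
  have hP : ∀ k, 4 ≤ cut (restEdges E D) ends (P k) := by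
    intro k
    have h := hQ k
    rw [hD.cut_eq, hPQ] at h
    have : (∑ l, if Q k (ends (D l).1 (D l).2) = Q k z then 0 else 1) = 1 := by
      rw [Finset.sum_eq_single k]
      · have : Q k (u k) = true := by
          simp only [Q, hYu, decide_eq_true_eq, and_true]
          exact hD.tail_ne k
        have h2 : Q k z = false := by simp [Q]
        simp [u] at this
        simp [this, h2]
      · intro l _ hl
        have : Q k (u l) = false := by
          simp only [Q, hYu, decide_eq_false_iff_not, not_and]
          exact fun _ h => hl (hcinj _ _ h)
        have h2 : Q k z = false := by simp [Q]
        simp only [u] at this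
        rw [this, h2, if_pos rfl]
      · simp
    omega
  have hsum : ∑ k, cut (restEdges E D) ends (P k) ≤
      cut (restEdges E D) ends p0 + cut (restEdges E D) ends p1 +
        cut (restEdges E D) ends p2 := by
    unfold cut
    rw [Finset.sum_comm, ← Finset.sum_add_distrib, ← Finset.sum_add_distrib]
    refine Finset.sum_le_sum fun e _ => ?_
    refine (atom_inequality s (Y (ends e true)) (Y (ends e false))).trans_eq ?_
    rw [Fin.sum_univ_three]
    rfl
  -- The four atoms need at least sixteen crossings in total; the three bad sets supply at most
  -- twelve.
  rw [Fin.sum_univ_four] at hsum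
  have := hP 0
  have := hP 1
  have := hP 2
  have := hP 3
  omega

end

/-! ### Assigning exits to the trees at a pinched vertex. -/

section

/-- The tree that has to be edge-disjoint from a given tree. The last tree is unconstrained. -/
def mate : Fin 5 → Fin 5 := ![2, 3, 0, 1, 4]

theorem mate_mate (i : Fin 5) : mate (mate i) = i := by revert i; decide

/-- The half-edge paired with a given one. -/
def opp : Fin 4 → Fin 4 := ![1, 0, 3, 2]

theorem opp_opp (k : Fin 4) : opp (opp k) = k := by revert k; decide

theorem opp_injective : Function.Injective opp := fun a b h => by
  rw [← opp_opp a, h, opp_opp]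

/-- Source and target both have five elements, so a partial injection extends to a bijection. -/
theorem exists_injective_extension (S : Finset (Fin 5)) (f : Fin 5 → Option (Fin 4))
    (hf : Set.InjOn f S) :
    ∃ g : Fin 5 → Option (Fin 4), Function.Injective g ∧ ∀ i ∈ S, g i = f i := by
  obtain ⟨g, hg⟩ := Finset.exists_equiv_extend_of_card_eq
    (t := (Finset.univ : Finset (Option (Fin 4)))) (by simp) (Finset.subset_univ (S.image f)) hf
  exact ⟨fun i => g i, fun a b h => g.injective (Subtype.ext h), hg⟩

/-- The assignment of the exits of a pinched vertex: `In i` is the set of half-edges over which the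
tree `i` enters, and `c i` is the one whose opposite the tree `i` has to use as exit. -/
theorem exists_exits (In : Fin 5 → Finset (Fin 4)) (c : Fin 5 → Fin 4)
    (hdis : ∀ i j k, k ∈ In i → k ∈ In j → i = j) (hc : ∀ i, (In i).Nonempty → c i ∈ In i)
    (hopp : ∀ i k, k ∈ In i → opp k ∉ In i ∧ opp k ∉ In (mate i)) :
    ∃ out : Fin 5 → Option (Fin 4), Function.Injective out ∧
      (∀ i, (In i).Nonempty → out i = some (opp (c i))) ∧
      (∀ i k, mate i ≠ i → out i = some k → k ∉ In (mate i)) ∧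
      ∀ j, out j = none → (In (mate j)).card ≤ 1 := by
  classical
  have hother : ∀ i, 1 < (In i).card → ∃ l ∈ In i, l ≠ c i := fun i hi =>
    Finset.exists_mem_ne hi _
  choose! o ho1 ho2 using hother
  -- An entering tree has its exit prescribed. A tree that does not enter, but whose mate enters at
  -- least twice, leaves opposite to an entry of the mate other than `c (mate i)`, since the mate
  -- itself takes the opposite of that one.
  let x : Fin 5 → Fin 4 := fun i => if (In i).Nonempty then c i else o (mate i)
  let S : Finset (Fin 5) :=
    Finset.univ.filter fun i => (In i).Nonempty ∨ 1 < (In (mate i)).card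
  let f : Fin 5 → Option (Fin 4) := fun i => some (opp (x i))
  have hx1 : ∀ i, (In i).Nonempty → x i = c i := fun i hi => if_pos hi
  have hx2 : ∀ i, ¬(In i).Nonempty → x i = o (mate i) := fun i hi => if_neg hi
  have hS : ∀ i ∈ S, ¬(In i).Nonempty → 1 < (In (mate i)).card := fun i hi hn =>
    ((Finset.mem_filter.1 hi).2).resolve_left hn
  have hmixed : ∀ i j, (In i).Nonempty → ¬(In j).Nonempty → j ∈ S → x i ≠ x j := by
    intro i j hi hj hjS h
    rw [hx1 i hi, hx2 j hj] at h
    have h3 := ho1 _ (hS j hjS hj)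
    have h4 : i = mate j := hdis _ _ _ (hc i hi) (h ▸ h3)
    exact ho2 _ (hS j hjS hj) (by rw [← h, h4])
  have hxinj : Set.InjOn x S := by
    intro i hi j hj h
    by_cases h1 : (In i).Nonempty <;> by_cases h2 : (In j).Nonempty
    · rw [hx1 i h1, hx1 j h2] at h
      exact hdis _ _ _ (hc i h1) (h ▸ hc j h2)
    · exact absurd h (hmixed i j h1 h2 hj)
    · exact absurd h.symm (hmixed j i h2 h1 hi)
    · rw [hx2 i h1, hx2 j h2] at h
      have := hdis _ _ _ (ho1 _ (hS i hi h1)) (h ▸ ho1 _ (hS j hj h2))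
      rw [← mate_mate i, this, mate_mate]
  have hfinj : Set.InjOn f S := fun i hi j hj h =>
    hxinj hi hj (opp_injective (Option.some_injective _ h))
  have hfS : ∀ i ∈ S, ∀ k, mate i ≠ i → f i = some k → k ∉ In (mate i) := by
    intro i hi k _ hk
    obtain rfl : opp (x i) = k := Option.some_injective _ hk
    by_cases h1 : (In i).Nonempty
    · rw [hx1 i h1]
      exact (hopp _ _ (hc i h1)).2
    · rw [hx2 i h1]
      exact (hopp _ _ (ho1 _ (hS i hi h1))).1
  have hfin : ∀ (S' : Finset (Fin 5)) (f' : Fin 5 → Option (Fin 4)), S ⊆ S' → Set.InjOn f' S' →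
      (∀ i ∈ S, f' i = f i) → (∀ i ∈ S', i ∉ S → ∀ k, f' i = some k → k ∉ In (mate i)) →
      (∀ i, i ∉ S' → ¬(In (mate i)).Nonempty) → ∃ out : Fin 5 → Option (Fin 4),
      Function.Injective out ∧ (∀ i, (In i).Nonempty → out i = some (opp (c i))) ∧
      (∀ i k, mate i ≠ i → out i = some k → k ∉ In (mate i)) ∧
      ∀ j, out j = none → (In (mate j)).card ≤ 1 := by
    intro S' f' hSS hinj hag hnew hrest
    obtain ⟨g, hg, hgf⟩ := exists_injective_extension S' f' hinj
    have hgS : ∀ i ∈ S, g i = f i := fun i hi => (hgf i (hSS hi)).trans (hag i hi)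
    refine ⟨g, hg, fun i hi => ?_, fun i k hm hk => ?_, fun j hj => ?_⟩
    · rw [hgS i (by simp [S, hi])]
      simp only [f, hx1 i hi]
    · by_cases hiS : i ∈ S
      · exact hfS i hiS k hm (by rw [← hgS i hiS, hk])
      by_cases hiS' : i ∈ S'
      · exact hnew i hiS' hiS k (by rw [← hgf i hiS', hk])
      · exact fun h => hrest i hiS' ⟨k, h⟩
    · have : j ∉ S := fun h => by rw [hgS j h] at hj; simp [f] at hj
      by_contra hlt
      exact this (by simp only [S, Finset.mem_filter, Finset.mem_univ, true_and]; right; omega)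
  have hun : ∀ i, i ∉ S → ¬(In i).Nonempty := fun i hi h => hi (by simp [S, h])
  have hmate : ∀ i, i ∉ S → (In (mate i)).Nonempty → mate i ≠ i ∧ mate i ∈ S := fun i hi h =>
    ⟨fun he => hun i hi (he ▸ h), by simp [S, h]⟩
  -- Critical trees are the unforced ones whose mate enters, necessarily once. A single critical
  -- tree receives `none`. Of two, one receives `none` and the other a half-edge `r` that no forced
  -- tree uses; the entry sets of their mates are disjoint, so `r` is harmless for at least one of
  -- the two.
  by_cases hB : ∃ a, a ∉ S ∧ (In (mate a)).Nonempty
  swap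
  · push Not at hB
    exact hfin S f subset_rfl hfinj (fun _ _ => rfl) (fun i h h' => absurd h h')
      fun i hi => Finset.not_nonempty_iff_eq_empty.2 (hB i hi)
  obtain ⟨a, haS, ha⟩ := hB
  by_cases hB : ∃ b, b ∉ S ∧ b ≠ a ∧ (In (mate b)).Nonempty
  swap
  · push Not at hB
    refine hfin (insert a S) (Function.update f a none) (Finset.subset_insert _ _) ?_ ?_ ?_ ?_
    · rw [Finset.coe_insert, Set.injOn_insert (by simpa using haS)]
      constructor
      · intro i hi j hj h
        have hia : i ≠ a := fun h => haS (h ▸ hi)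
        have hja : j ≠ a := fun h => haS (h ▸ hj)
        rw [Function.update_of_ne hia, Function.update_of_ne hja] at h
        exact hfinj hi hj h
      · rintro ⟨i, hi, h⟩
        have hia : i ≠ a := fun h => haS (h ▸ hi)
        rw [Function.update_of_ne hia, Function.update_self] at h
        simp [f] at h
    · intro i hi
      exact Function.update_of_ne (by rintro rfl; exact haS hi) _ _
    · intro i hi hiS k hk
      obtain rfl : i = a := (Finset.mem_insert.1 hi).resolve_right hiS
      simp at hk
    · intro i hi
      rw [Finset.mem_insert, not_or] at hi
      exact Finset.not_nonempty_iff_eq_empty.2 (hB i hi.2 hi.1)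
  obtain ⟨b, hbS, hba, hb⟩ := hB
  have main : ∀ a b, a ∉ S → (In (mate a)).Nonempty → b ∉ S → b ≠ a → (In (mate b)).Nonempty →
      ∀ r, (∀ i ∈ S, f i ≠ some r) → r ∉ In (mate a) → ∃ out : Fin 5 → Option (Fin 4),
      Function.Injective out ∧ (∀ i, (In i).Nonempty → out i = some (opp (c i))) ∧
      (∀ i k, mate i ≠ i → out i = some k → k ∉ In (mate i)) ∧
      ∀ j, out j = none → (In (mate j)).card ≤ 1 := by
    intro a b haS ha hbS hba hb r hr hra
    refine hfin (insert b (insert a S)) (Function.update (Function.update f a (some r)) b none)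
      ((Finset.subset_insert _ _).trans (Finset.subset_insert _ _)) ?_ ?_ ?_ ?_
    · have hSf : ∀ i ∈ S, Function.update (Function.update f a (some r)) b none i = f i := by
        intro i hi
        rw [Function.update_of_ne (by rintro rfl; exact hbS hi),
          Function.update_of_ne (by rintro rfl; exact haS hi)]
      have hA : Function.update (Function.update f a (some r)) b none a = some r := by
        rw [Function.update_of_ne hba.symm, Function.update_self]
      rw [Finset.coe_insert, Finset.coe_insert, Set.injOn_insert, Set.injOn_insert (by simpa)]
      · refine ⟨⟨fun i hi j hj h => ?_, ?_⟩, ?_⟩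
        · rw [hSf i hi, hSf j hj] at h
          exact hfinj hi hj h
        · rintro ⟨i, hi, h⟩
          rw [hSf i hi, hA] at h
          exact hr i hi h
        · rintro ⟨i, hi, h⟩
          rw [Function.update_self] at h
          rcases hi with rfl | hi
          · rw [hA] at h; simp at h
          · rw [hSf i hi] at h; simp [f] at h
      · simp only [Set.mem_insert_iff, not_or]
        exact ⟨hba, by simpa using hbS⟩
    · intro i hi
      rw [Function.update_of_ne (by rintro rfl; exact hbS hi),
        Function.update_of_ne (by rintro rfl; exact haS hi)]
    · intro i hi hiS k hk
      by_cases hib : i = b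
      · subst hib; simp at hk
      · obtain rfl : i = a := ((Finset.mem_insert.1 (Finset.mem_of_mem_insert_of_ne hi hib))
          |>.resolve_right hiS)
        rw [Function.update_of_ne hib, Function.update_self] at hk
        obtain rfl := Option.some_injective _ hk
        exact hra
    · intro e he hne
      simp only [Finset.mem_insert, not_or] at he
      -- A third critical tree would give three disjoint pairs of mates among five trees.
      have key : ∀ a b c : Fin 5, b ≠ a → c ≠ b → c ≠ a → mate a ≠ a → mate b ≠ b → mate c ≠ c →
        mate a ≠ b → mate a ≠ c → mate b ≠ c → False := by decide
      have h1 := hmate a haS ha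
      have h2 := hmate b hbS hb
      have h3 := hmate e he.2.2 hne
      exact key a b e hba he.1 he.2.1 h1.1 h2.1 h3.1 (fun h => hbS (h ▸ h1.2))
        (fun h => he.2.2 (h ▸ h1.2)) (fun h => he.2.2 (h ▸ h2.2))
  obtain ⟨r, hr⟩ : ∃ r : Fin 4, ∀ i ∈ S, f i ≠ some r := by
    by_contra! hcon
    choose y hy1 hy2 using hcon
    have hyinj : Function.Injective y := fun k l h => by
      have h1 := hy2 k
      rw [h, hy2 l] at h1
      exact (Option.some_injective _ h1).symm
    have h1 : (Finset.univ.image y).card = 4 := by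
      rw [Finset.card_image_of_injective _ hyinj]; simp
    have h2 : Finset.univ.image y ⊆ (Finset.univ.erase a).erase b := by
      intro i hi
      obtain ⟨k, _, rfl⟩ := Finset.mem_image.1 hi
      refine Finset.mem_erase.2 ⟨fun h => hbS (h ▸ hy1 k), Finset.mem_erase.2
        ⟨fun h => haS (h ▸ hy1 k), Finset.mem_univ _⟩⟩
    have h3 := Finset.card_le_card h2
    rw [Finset.card_erase_of_mem (by simp [hba]), Finset.card_erase_of_mem (by simp)] at h3
    simp at h3
    omega
  by_cases hra : r ∈ In (mate a)
  · refine main b a hbS hb haS hba.symm ha r hr fun hrb => hba ?_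
    have := hdis _ _ _ hra hrb
    rw [← mate_mate b, ← this, mate_mate]
  · exact main a b haS ha hbS hba hb r hr hra

end

/-! ### Tree packings and undoing a splitting. -/

section

variable {α β : Type*}

/-- Five partial in-trees rooted at `d`: `t i v` is the dart over which the tree `i` leaves the
vertex `v`, for the vertices `v ∈ cov i`, and `h i` decreases along the darts. The trees are
pairwise arc-disjoint, and mates are edge-disjoint. -/
structure TreePacking (d : α) (E : Finset β) (ends : β → Bool → α) (cov : Fin 5 → Set α)
    (t : Fin 5 → α → β × Bool) (h : Fin 5 → α → ℕ) : Prop where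
  mem : ∀ i v, v ∈ cov i → v ≠ d → (t i v).1 ∈ E
  tail : ∀ i v, v ∈ cov i → v ≠ d → ends (t i v).1 (t i v).2 = v
  head : ∀ i v, v ∈ cov i → v ≠ d → ends (t i v).1 (!(t i v).2) ∈ cov i
  lt : ∀ i v, v ∈ cov i → v ≠ d → h i (ends (t i v).1 (!(t i v).2)) < h i v
  ne : ∀ i j v, i ≠ j → v ∈ cov i → v ∈ cov j → v ≠ d → t i v ≠ t j v
  edge_ne : ∀ i v w, mate i ≠ i → v ∈ cov i → w ∈ cov (mate i) → v ≠ d → w ≠ d →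
    (t i v).1 ≠ (t (mate i) w).1

variable [DecidableEq β]

/-- The dart of the split graph over which the half-edge `D k` is entered. -/
def pinchDart (D : Fin 4 → β × Bool) : Fin 4 → β × Bool :=
  ![D 0, ((D 0).1, !(D 0).2), D 2, ((D 2).1, !(D 2).2)]

/-- The first dart of the path that replaces a dart of the split graph. -/
def pinchMap (D : Fin 4 → β × Bool) (a : β × Bool) : β × Bool :=
  if a = ((D 0).1, !(D 0).2) then D 1 else if a = ((D 2).1, !(D 2).2) then D 3 else a

variable {E : Finset β} {ends : β → Bool → α} {z : α} {D : Fin 4 → β × Bool}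

theorem HalfEdges.edge_ne (hD : HalfEdges E ends z D) {k l : Fin 4} (h : k ≠ l) :
    (D k).1 ≠ (D l).1 := fun h' => h (hD.inj h')

theorem HalfEdges.pinchMap_pinchDart (hD : HalfEdges E ends z D) (k : Fin 4) :
    pinchMap D (pinchDart D k) = D k := by
  have h1 := hD.edge_ne (show (2 : Fin 4) ≠ 0 by decide)
  fin_cases k <;> simp [pinchMap, pinchDart, Prod.ext_iff, h1, h1.symm]

theorem HalfEdges.splitEnds_pinchDart (hD : HalfEdges E ends z D) (k : Fin 4) :
    splitEnds ends D (pinchDart D k).1 (pinchDart D k).2 = ends (D k).1 (D k).2 ∧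
    splitEnds ends D (pinchDart D k).1 (!(pinchDart D k).2) =
      ends (D (opp k)).1 (D (opp k)).2 := by
  have h1 := hD.edge_ne (show (2 : Fin 4) ≠ 0 by decide)
  fin_cases k <;> simp [splitEnds, pinchDart, opp, h1, h1.symm]

theorem pinchDart_edge_opp (D : Fin 4 → β × Bool) (k : Fin 4) :
    (pinchDart D (opp k)).1 = (pinchDart D k).1 := by
  fin_cases k <;> rfl

theorem pinch_cases {a : β × Bool}
    (ha : a.1 ∈ splitEdges E D) : (∃ k, a = pinchDart D k) ∨
      (∀ k, a.1 ≠ (D k).1) ∧ pinchMap D a = a ∧ ∀ b, splitEnds ends D a.1 b = ends a.1 b := by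
  simp only [splitEdges, Finset.mem_erase] at ha
  by_cases h0 : a.1 = (D 0).1
  · left
    by_cases hb : a.2 = (D 0).2
    · exact ⟨0, Prod.ext h0 hb⟩
    · exact ⟨1, Prod.ext h0 (by simpa [pinchDart] using Bool.eq_not_of_ne hb)⟩
  by_cases h2 : a.1 = (D 2).1
  · left
    by_cases hb : a.2 = (D 2).2
    · exact ⟨2, Prod.ext h2 hb⟩
    · exact ⟨3, Prod.ext h2 (by simpa [pinchDart] using Bool.eq_not_of_ne hb)⟩
  right
  refine ⟨fun k => ?_, ?_, fun b => ?_⟩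
  · fin_cases k
    · exact h0
    · exact ha.2.1
    · exact h2
    · exact ha.1
  · simp [pinchMap, Prod.ext_iff, h0, h2]
  · simp [splitEnds, h0, h2]

theorem mem_of_mem_splitEdges {e : β} (he : e ∈ splitEdges E D) : e ∈ E :=
  Finset.mem_of_mem_erase (Finset.mem_of_mem_erase he)

theorem HalfEdges.pinchMap_tail (hD : HalfEdges E ends z D) {a : β × Bool}
    (ha : a.1 ∈ splitEdges E D) :
    ends (pinchMap D a).1 (pinchMap D a).2 = splitEnds ends D a.1 a.2 := by
  rcases pinch_cases (ends := ends) ha with ⟨k, rfl⟩ | ⟨-, h2, h3⟩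
  · rw [hD.pinchMap_pinchDart, (hD.splitEnds_pinchDart k).1]
  · rw [h2, h3]

theorem HalfEdges.pinchMap_injOn (hD : HalfEdges E ends z D) {a b : β × Bool}
    (ha : a.1 ∈ splitEdges E D) (hb : b.1 ∈ splitEdges E D) (h : pinchMap D a = pinchMap D b) :
    a = b := by
  rcases pinch_cases (ends := ends) ha with ⟨k, rfl⟩ | ⟨h1, h2, h3⟩ <;>
    rcases pinch_cases (ends := ends) hb with ⟨l, rfl⟩ | ⟨g1, g2, g3⟩
  · rw [hD.pinchMap_pinchDart, hD.pinchMap_pinchDart] at h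
    rw [hD.inj (congrArg Prod.fst h)]
  · rw [hD.pinchMap_pinchDart, g2] at h
    exact absurd (congrArg Prod.fst h).symm (g1 k)
  · rw [hD.pinchMap_pinchDart, h2] at h
    exact absurd (congrArg Prod.fst h) (h1 l)
  · rwa [h2, g2] at h

theorem HalfEdges.pinchMap_edge_injOn (hD : HalfEdges E ends z D) {a b : β × Bool}
    (ha : a.1 ∈ splitEdges E D) (hb : b.1 ∈ splitEdges E D)
    (h : (pinchMap D a).1 = (pinchMap D b).1) : a.1 = b.1 := by
  rcases pinch_cases (ends := ends) ha with ⟨k, rfl⟩ | ⟨h1, h2, h3⟩ <;>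
    rcases pinch_cases (ends := ends) hb with ⟨l, rfl⟩ | ⟨g1, g2, g3⟩
  · rw [hD.pinchMap_pinchDart, hD.pinchMap_pinchDart] at h
    rw [hD.inj h]
  · rw [hD.pinchMap_pinchDart, g2] at h
    exact absurd h.symm (g1 k)
  · rw [hD.pinchMap_pinchDart, h2] at h
    exact absurd h (h1 l)
  · rwa [h2, g2] at h

/-- Undoing a complete splitting at a vertex `z` of degree four: all trees but one can be extended
to `z`. -/
theorem TreePacking.pinch {d : α} {cov : Fin 5 → Set α} {t : Fin 5 → α → β × Bool}
    {h : Fin 5 → α → ℕ} (hD : HalfEdges E ends z D)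
    (hT : TreePacking d (splitEdges E D) (splitEnds ends D) cov t h) (hzd : z ≠ d)
    (hz : ∀ i, z ∉ cov i) (hu : ∀ i k, ends (D k).1 (D k).2 ∈ cov i) :
    ∃ j t' h', TreePacking d E ends (fun i => {v | v ∈ cov i ∨ v = z ∧ i ≠ j}) t' h' ∧
      (∃ e, ∀ v ∈ cov (mate j), v ≠ d →
        ends (t' (mate j) v).1 (!(t' (mate j) v).2) = z → (t' (mate j) v).1 = e) ∧
      ∀ i, ∀ v ∈ cov i, v ≠ d → ends (t' i v).1 (!(t' i v).2) ≠ z →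
        t' i v = t i v ∧ ends (t' i v).1 (!(t' i v).2) =
          splitEnds ends D (t i v).1 (!(t i v).2) := by
  classical
  set u : Fin 4 → α := fun k => ends (D k).1 (D k).2 with hudef
  have hne : ∀ i v, v ∈ cov i → v ≠ z := fun i v hv h => hz i (h ▸ hv)
  let In : Fin 5 → Finset (Fin 4) := fun i =>
    Finset.univ.filter fun k => u k ≠ d ∧ t i (u k) = pinchDart D k
  have hIn : ∀ {i k}, k ∈ In i ↔ u k ≠ d ∧ t i (u k) = pinchDart D k := by simp [In]
  have hInv : ∀ {i v k}, v ∈ cov i → v ≠ d → t i v = pinchDart D k → v = u k ∧ k ∈ In i := by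
    intro i v k hv hvd hk
    have h1 := hT.tail i v hv hvd
    rw [hk, (hD.splitEnds_pinchDart k).1] at h1
    subst h1
    exact ⟨rfl, hIn.2 ⟨hvd, hk⟩⟩
  have hhead : ∀ {i k}, k ∈ In i → h i (u (opp k)) < h i (u k) := by
    intro i k hk
    have h1 := hT.lt i (u k) (hu i k) (hIn.1 hk).1
    rwa [(hIn.1 hk).2, (hD.splitEnds_pinchDart k).2] at h1
  -- When a tree passes the split vertex several times, only the exit of least height is kept; it
  -- lies below all entries.
  have hmin : ∀ i, (In i).Nonempty →
      ∃ k ∈ In i, ∀ l ∈ In i, h i (u (opp k)) ≤ h i (u (opp l)) := fun i hi =>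
    Finset.exists_min_image (In i) (fun k => h i (u (opp k))) hi
  choose! c hc1 hc2 using hmin
  have hpinj : ∀ k l, pinchDart D k = pinchDart D l → k = l := fun k l hkl => by
    have := congrArg (pinchMap D) hkl
    rw [hD.pinchMap_pinchDart, hD.pinchMap_pinchDart] at this
    exact hD.inj (congrArg Prod.fst this)
  obtain ⟨out, ho1, ho2, ho3, ho4⟩ := exists_exits In c
    (fun i j k hi hj => by
      by_contra hij
      exact hT.ne i j (u k) hij (hu i k) (hu j k) (hIn.1 hi).1
        ((hIn.1 hi).2.trans (hIn.1 hj).2.symm))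
    hc1
    -- The half-edges `k` and `opp k` stand for the two directions of one split edge. A tree using
    -- both would contain a cycle, and mates using them would share an edge.
    (fun i k hk => by
      constructor
      · intro hk'
        have h1 := hhead hk
        have h2 := hhead hk'
        rw [opp_opp] at h2
        omega
      · intro hk'
        by_cases hm : mate i = i
        · rw [hm] at hk'
          have h1 := hhead hk
          have h2 := hhead hk'
          rw [opp_opp] at h2
          omega
        · refine hT.edge_ne i (u k) (u (opp k)) hm (hu _ _) (hu _ _) (hIn.1 hk).1 (hIn.1 hk').1 ?_
          rw [(hIn.1 hk).2, (hIn.1 hk').2, pinchDart_edge_opp])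
  obtain ⟨j, hj⟩ : ∃ j, out j = none :=
    ((Fintype.bijective_iff_injective_and_card out).2 ⟨ho1, by simp⟩).2 none
  have hout : ∀ i, i ≠ j → ∃ k, out i = some k := fun i hij =>
    Option.ne_none_iff_exists'.1 fun hn => hij (ho1 (hn.trans hj.symm))
  choose! x hx using hout
  let t' : Fin 5 → α → β × Bool := fun i v =>
    if v = z then ((D (x i)).1, !(D (x i)).2) else pinchMap D (t i v)
  -- Doubling creates an odd height for `z` directly above its exit and still below every entry.
  let h' : Fin 5 → α → ℕ := fun i v => if v = z then 2 * h i (u (x i)) + 1 else 2 * h i v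
  have ht'z : ∀ i, t' i z = ((D (x i)).1, !(D (x i)).2) := fun i => if_pos rfl
  have ht' : ∀ i v, v ≠ z → t' i v = pinchMap D (t i v) := fun i v hv => if_neg hv
  have hh'z : ∀ i, h' i z = 2 * h i (u (x i)) + 1 := fun i => if_pos rfl
  have hh' : ∀ i v, v ≠ z → h' i v = 2 * h i v := fun i v hv => if_neg hv
  have hcase : ∀ i v, v ∈ cov i → v ≠ d → (∃ k, v = u k ∧ k ∈ In i ∧ t' i v = D k) ∨
      (t' i v = t i v ∧ (∀ k, (t i v).1 ≠ (D k).1) ∧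
        ∀ b, splitEnds ends D (t i v).1 b = ends (t i v).1 b) := by
    intro i v hv hvd
    rcases pinch_cases (ends := ends) (hT.mem i v hv hvd) with ⟨k, hk⟩ | ⟨h1, h2, h3⟩
    · left
      obtain ⟨h1, h2⟩ := hInv hv hvd hk
      exact ⟨k, h1, h2, by rw [ht' i v (hne i v hv), hk, hD.pinchMap_pinchDart]⟩
    · right
      exact ⟨by rw [ht' i v (hne i v hv), h2], h1, h3⟩
  have htail : ∀ i v, v ∈ cov i → v ≠ d → ends (t' i v).1 (t' i v).2 = v := fun i v hv hvd => by
    rw [ht' i v (hne i v hv), hD.pinchMap_tail (hT.mem i v hv hvd), hT.tail i v hv hvd]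
  have hInj : ∀ {i k}, k ∈ In i → i ≠ j := by
    rintro i k hk rfl
    have := ho2 i ⟨k, hk⟩
    rw [hj] at this
    simp at this
  refine ⟨j, t', h', ⟨?_, ?_, ?_, ?_, ?_, ?_⟩, ?_, ?_⟩
  · rintro i v (hv | ⟨rfl, hij⟩) hvd
    · rcases hcase i v hv hvd with ⟨k, -, -, h3⟩ | ⟨h1, -, -⟩
      · rw [h3]; exact hD.edge_mem k
      · rw [h1]; exact mem_of_mem_splitEdges (hT.mem i v hv hvd)
    · rw [ht'z]; exact hD.edge_mem _
  · rintro i v (hv | ⟨rfl, hij⟩) hvd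
    · exact htail i v hv hvd
    · rw [ht'z]; exact hD.head _
  · rintro i v (hv | ⟨rfl, hij⟩) hvd
    · rcases hcase i v hv hvd with ⟨k, -, h2, h3⟩ | ⟨h1, -, h3⟩
      · right
        rw [h3]
        exact ⟨hD.head k, hInj h2⟩
      · left
        rw [h1, ← h3]
        exact hT.head i v hv hvd
    · left
      rw [ht'z]
      simpa using hu i (x i)
  · rintro i v (hv | ⟨rfl, hij⟩) hvd
    · rw [hh' i v (hne i v hv)]
      rcases hcase i v hv hvd with ⟨k, h1, h2, h3⟩ | ⟨h1, -, h3⟩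
      · rw [h3, hD.head, hh'z]
        have h4 := hx i (hInj h2)
        rw [ho2 i ⟨k, h2⟩] at h4
        rw [← Option.some_injective _ h4]
        have h5 := hc2 i ⟨k, h2⟩ k h2
        have h6 := hhead h2
        rw [h1]
        omega
      · have h4 := hT.head i v hv hvd
        rw [h1, ← h3, hh' i _ (hne i _ h4)]
        have := hT.lt i v hv hvd
        omega
    · rw [ht'z, hh'z]
      simp only [Bool.not_not]
      rw [hh' i _ (hne i _ (hu i (x i)))]
      simp only [u]
      omega
  · rintro i k v hik (hv | ⟨rfl, hij⟩) (hw | ⟨hw, hkj⟩) hvd heq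
    · rw [ht' i v (hne i v hv), ht' k v (hne i v hv)] at heq
      exact hT.ne i k v hik hv hw hvd
        (hD.pinchMap_injOn (hT.mem i v hv hvd) (hT.mem k v hw hvd) heq)
    · exact hne i v hv hw
    · exact hz k hw
    · rw [ht'z, ht'z] at heq
      have h1 := hD.inj (Prod.ext_iff.1 heq).1
      apply hik
      apply ho1
      rw [hx i hij, hx k hkj]
      exact congrArg some h1
  · have key : ∀ i v, mate i ≠ i → v ∈ cov i → v ≠ d → mate i ≠ j →
        (t' i v).1 ≠ (D (x (mate i))).1 := by
      intro i v him hv hvd hij heq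
      rcases hcase i v hv hvd with ⟨k, h1, h2, h3⟩ | ⟨h1, h2, -⟩
      · rw [h3] at heq
        have h4 := ho3 (mate i) (x (mate i)) (by rwa [mate_mate, ne_comm]) (hx _ hij)
        rw [mate_mate, ← hD.inj heq] at h4
        exact h4 h2
      · rw [h1] at heq
        exact h2 _ heq
    rintro i v w him (hv | ⟨rfl, hij⟩) (hw | ⟨hw, hkj⟩) hvd hwd heq
    · rw [ht' i v (hne i v hv), ht' _ w (hne _ w hw)] at heq
      exact hT.edge_ne i v w him hv hw hvd hwd
        (hD.pinchMap_edge_injOn (hT.mem i v hv hvd) (hT.mem _ w hw hwd) heq)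
    · subst hw
      rw [ht'z] at heq
      exact key i v him hv hvd hkj heq
    · rw [ht'z] at heq
      refine key (mate i) w (by rwa [mate_mate, ne_comm]) hw hwd ?_ ?_
      · rwa [mate_mate]
      · rw [mate_mate]; exact heq.symm
    · subst hw
      rw [ht'z, ht'z] at heq
      have h1 := hD.inj heq
      refine him (ho1 ?_)
      rw [hx i hij, hx _ hkj]
      exact congrArg some h1.symm
  · have hcard := ho4 j hj
    obtain ⟨k0, hk0⟩ : ∃ k0, ∀ k ∈ In (mate j), k = k0 := by
      rcases (In (mate j)).eq_empty_or_nonempty with he | ⟨k0, hk0⟩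
      · exact ⟨0, by simp [he]⟩
      · exact ⟨k0, fun k hk => Finset.card_le_one.1 hcard k hk k0 hk0⟩
    refine ⟨(D k0).1, fun v hv hvd hvz => ?_⟩
    rcases hcase _ v hv hvd with ⟨k, -, h2, h3⟩ | ⟨h1, -, h3⟩
    · rw [h3, hk0 k h2]
    · rw [h1, ← h3] at hvz
      exact absurd (hvz ▸ hT.head _ v hv hvd) (hz _)
  · intro i v hv hvd hvz
    rcases hcase i v hv hvd with ⟨k, -, -, h3⟩ | ⟨h1, -, h3⟩
    · rw [h3] at hvz
      exact absurd (hD.head k) hvz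
    · exact ⟨h1, by rw [h1, h3]⟩

end

/-! ### Changing a single dart of a packing. -/

section

variable {α β : Type*}

theorem TreePacking.congr_cov {d : α} {E : Finset β} {ends : β → Bool → α}
    {cov cov' : Fin 5 → Set α} {t : Fin 5 → α → β × Bool} {h : Fin 5 → α → ℕ}
    (hT : TreePacking d E ends cov t h) (hc : ∀ i v, v ∈ cov' i ↔ v ∈ cov i) :
    TreePacking d E ends cov' t h := by
  obtain rfl : cov' = cov := funext fun i => Set.ext (hc i)
  exact hT

variable [DecidableEq α]

/-- Change the dart over which the tree `i` leaves `v`. -/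
def setDart (t : Fin 5 → α → β × Bool) (i : Fin 5) (v : α) (a : β × Bool) :
    Fin 5 → α → β × Bool :=
  fun j w => if j = i ∧ w = v then a else t j w

theorem setDart_self (t : Fin 5 → α → β × Bool) (i : Fin 5) (v : α) (a : β × Bool) :
    setDart t i v a i v = a := by simp [setDart]

theorem setDart_of_ne (t : Fin 5 → α → β × Bool) {i : Fin 5} {v : α} (a : β × Bool) {j : Fin 5}
    {w : α} (h : ¬(j = i ∧ w = v)) : setDart t i v a j w = t j w := if_neg h

variable {d : α} {E E' : Finset β} {ends : β → Bool → α} {cov : Fin 5 → Set α}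
  {t : Fin 5 → α → β × Bool} {h : Fin 5 → α → ℕ}

/-- Redirecting the tree `i` at the vertex `v`, or extending it to `v`. -/
theorem TreePacking.exists_setDart (hT : TreePacking d E ends cov t h) (hE : E ⊆ E')
    {i : Fin 5} {v : α}
    {a : β × Bool} (haE : a.1 ∈ E') (hav : ends a.1 a.2 = v)
    (hah : ends a.1 (!a.2) ∈ cov i) (hlt : v ∈ cov i → h i (ends a.1 (!a.2)) < h i v)
    (hne : ∀ j, j ≠ i → v ∈ cov j → v ≠ d → a ≠ t j v)
    (hedge : mate i ≠ i → ∀ w ∈ cov (mate i), w ≠ d → a.1 ≠ (t (mate i) w).1) :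
    ∃ h', TreePacking d E' ends (fun j => {w | w ∈ cov j ∨ j = i ∧ w = v})
      (setDart t i v a) h' ∧ ∀ j w, w ∈ cov j → h' j w = h j w := by
  classical
  -- Only a newly covered vertex needs a new height. No old dart of its tree points to it, as heads
  -- of old darts are already covered.
  let h' : Fin 5 → α → ℕ := fun j w =>
    if j = i ∧ w = v ∧ v ∉ cov i then h i (ends a.1 (!a.2)) + 1 else h j w
  have hh : ∀ j w, w ∈ cov j → h' j w = h j w := by
    intro j w hw
    refine if_neg ?_
    rintro ⟨rfl, rfl, h3⟩
    exact h3 hw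
  have hold : ∀ {j w}, w ∈ cov j ∨ j = i ∧ w = v → ¬(j = i ∧ w = v) → w ∈ cov j :=
    fun h1 h2 => h1.resolve_right h2
  refine ⟨h', ⟨?_, ?_, ?_, ?_, ?_, ?_⟩, hh⟩
  · intro j w hw hwd
    by_cases hjw : j = i ∧ w = v
    · obtain ⟨rfl, rfl⟩ := hjw
      rwa [setDart_self]
    · rw [setDart_of_ne _ _ hjw]
      exact hE (hT.mem j w (hold hw hjw) hwd)
  · intro j w hw hwd
    by_cases hjw : j = i ∧ w = v
    · obtain ⟨rfl, rfl⟩ := hjw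
      rwa [setDart_self]
    · rw [setDart_of_ne _ _ hjw]
      exact hT.tail j w (hold hw hjw) hwd
  · intro j w hw hwd
    left
    by_cases hjw : j = i ∧ w = v
    · obtain ⟨rfl, rfl⟩ := hjw
      rwa [setDart_self]
    · rw [setDart_of_ne _ _ hjw]
      exact hT.head j w (hold hw hjw) hwd
  · intro j w hw hwd
    by_cases hjw : j = i ∧ w = v
    · obtain ⟨rfl, rfl⟩ := hjw
      rw [setDart_self, hh _ _ hah]
      by_cases hc : w ∈ cov j
      · rw [hh _ _ hc]; exact hlt hc
      · have : h' j w = h j (ends a.1 (!a.2)) + 1 := if_pos ⟨rfl, rfl, hc⟩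
        omega
    · have hw' := hold hw hjw
      rw [setDart_of_ne _ _ hjw, hh _ _ (hT.head j w hw' hwd), hh _ _ hw']
      exact hT.lt j w hw' hwd
  · intro j k w hjk hj hk hwd
    by_cases hjw : j = i ∧ w = v <;> by_cases hkw : k = i ∧ w = v
    · exact absurd (hjw.1.trans hkw.1.symm) hjk
    · have hk' := hold hk hkw
      rw [setDart_of_ne _ _ hkw]
      obtain ⟨rfl, rfl⟩ := hjw
      rw [setDart_self]
      exact hne k hjk.symm hk' hwd
    · have hj' := hold hj hjw
      rw [setDart_of_ne _ _ hjw]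
      obtain ⟨rfl, rfl⟩ := hkw
      rw [setDart_self]
      exact (hne j hjk hj' hwd).symm
    · rw [setDart_of_ne _ _ hjw, setDart_of_ne _ _ hkw]
      exact hT.ne j k w hjk (hold hj hjw) (hold hk hkw) hwd
  · intro j w x hj hw hx hwd hxd
    by_cases hjw : j = i ∧ w = v <;> by_cases hkw : mate j = i ∧ x = v
    · exact absurd (hkw.1.trans hjw.1.symm) hj
    · have hx' := hold hx hkw
      rw [setDart_of_ne _ _ hkw]
      obtain ⟨rfl, rfl⟩ := hjw
      rw [setDart_self]
      exact hedge hj x hx' hxd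
    · have hw' := hold hw hjw
      rw [setDart_of_ne _ _ hjw]
      obtain ⟨rfl, rfl⟩ := hkw
      rw [setDart_self]
      refine (hedge (by rwa [mate_mate, ne_comm]) w ?_ hwd).symm ∘ fun h => ?_
      · rwa [mate_mate]
      · rw [mate_mate]; exact h
    · rw [setDart_of_ne _ _ hjw, setDart_of_ne _ _ hkw]
      exact hT.edge_ne j w x hj (hold hw hjw) (hold hx hkw) hwd hxd

end

/-! ### Completing two deficient trees with one new edge. -/

section

variable {α β : Type*}

/-- Breaks ties at `z`: afterwards a tree may be redirected from `z` to another vertex of the same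
former height. -/
theorem TreePacking.raise [DecidableEq α] {d : α} {E : Finset β} {ends : β → Bool → α}
    {cov : Fin 5 → Set α} {t : Fin 5 → α → β × Bool} {h : Fin 5 → α → ℕ}
    (hT : TreePacking d E ends cov t h) (z : α) :
    TreePacking d E ends cov t fun i v => 2 * h i v + if v = z then 1 else 0 :=
  { hT with
    lt := fun i v hv hvd => by
      have := hT.lt i v hv hvd
      split_ifs <;> omega }

theorem Bool.not_eq_of_ne {a b : Bool} (h : a ≠ b) : a = !b := by
  cases a <;> cases b <;> simp_all

section Join

variable [DecidableEq α] [DecidableEq β] {d z z' : α} {E : Finset β} {ends : β → Bool → α}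
  {V : Set α} {cov : Fin 5 → Set α} {t : Fin 5 → α → β × Bool} {h : Fin 5 → α → ℕ} {j j' : Fin 5}
  {e : β} {b : Bool}

/-- If the tree `j` misses `z` and the tree `j'` misses `z'`, both can be completed with the help
of a new edge `z z'` when the tree `i` can be redirected along it. -/
theorem TreePacking.join_reroute (hT : TreePacking d E ends cov t h)
    (hcov : ∀ i v, v ∈ cov i ↔ v ∈ V ∧ ¬(v = z ∧ i = j) ∧ ¬(v = z' ∧ i = j'))
    (hzz : z ≠ z') (hzV : z ∈ V) (hzV' : z' ∈ V) (hzd : z ≠ d) (hzd' : z' ≠ d)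
    (he : e ∉ E) (hez : ends e b = z) (hez' : ends e (!b) = z')
    (hadj : ∀ e' ∈ E, ∀ b', ends e' b' = z → ends e' (!b') ≠ z') {i : Fin 5}
    (hij : i ≠ j) (hij' : i ≠ j') (him : i ≠ mate j) (him' : i ≠ mate j') {e₀ : β}
    (hi : (t i z).1 ≠ e₀)
    (he₀ : ∀ v ∈ cov (mate j), v ≠ d → ends (t (mate j) v).1 (!(t (mate j) v).2) = z →
      (t (mate j) v).1 = e₀)
    (hle : h i z' ≤ h i z) :
    ∃ t' h', TreePacking d (insert e E) ends (fun _ => V) t' h' := by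
  have hzi : z ∈ cov i := (hcov i z).2 ⟨hzV, by simp [hij], by simp [hzz]⟩
  have hzi' : z' ∈ cov i := (hcov i z').2 ⟨hzV', by simp [hzz.symm], by simp [hij']⟩
  have hmemE : ∀ {k v}, v ∈ cov k → v ≠ d → e ≠ (t k v).1 := fun hv hvd h' =>
    he (h' ▸ hT.mem _ _ hv hvd)
  obtain ⟨h₁, hT₁, -⟩ := (hT.raise z).exists_setDart (E' := insert e E) (Finset.subset_insert _ _)
    (i := i) (v := z) (a := (e, b)) (by simp) hez (by simpa [hez'] using hzi')
    (fun _ => by simp only [hez']; simp [hzz.symm]; omega)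
    (fun k hk hv hvd h' => hmemE hv hvd (congrArg Prod.fst h'))
    (fun _ w hw hwd => hmemE hw hwd)
  replace hT₁ := hT₁.congr_cov (cov' := cov) fun k v => by
    simp only [Set.mem_ofPred_eq]
    exact ⟨Or.inl, fun hv => hv.elim id fun ⟨h1, h2⟩ => h1 ▸ h2 ▸ hzi⟩
  -- The dart that the tree `i` gives up at `z` is handed to the tree `j`.
  set r := t i z with hr
  have hrE : r.1 ∈ E := hT.mem i z hzi hzd
  have hrz : ends r.1 r.2 = z := hT.tail i z hzi hzd
  have hrh : ends r.1 (!r.2) ∈ cov j := by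
    refine (hcov _ _).2 ⟨((hcov i _).1 (hT.head i z hzi hzd)).1, ?_, ?_⟩
    · rintro ⟨h1, -⟩
      have := hT.lt i z hzi hzd
      rw [← hr, h1] at this
      omega
    · rintro ⟨h1, -⟩
      exact hadj _ hrE _ hrz h1
  have ht₁ : ∀ {k w}, ¬(k = i ∧ w = z) → setDart t i z (e, b) k w = t k w :=
    fun hkw => setDart_of_ne _ _ hkw
  obtain ⟨h₂, hT₂, -⟩ := hT₁.exists_setDart (E' := insert e E) subset_rfl (i := j) (v := z) (a := r)
    (Finset.mem_insert_of_mem hrE) hrz hrh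
    (fun hv => absurd ((hcov _ _).1 hv).2.1 (by simp))
    (fun k hk hv hvd => by
      by_cases hki : k = i
      · rw [hki, setDart_self]
        rintro h'
        exact he (by rw [h'] at hrE; exact hrE)
      · rw [ht₁ (by simp [hki])]
        exact hT.ne i k z (Ne.symm hki) hzi hv hvd)
    -- The mate of `j` could use the edge of `r` in the same direction, which arc-disjointness from
    -- the tree `i` excludes, or in the direction towards `z`, which would make it the edge `e₀`.
    (fun hm w hw hwd h' => by
      rw [ht₁ (by simp [him.symm])] at h'
      by_cases hb : r.2 = (t (mate j) w).2
      · have h2 : r = t (mate j) w := Prod.ext h' hb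
        have h3 : w = z := by
          rw [← hrz, h2, hT.tail _ w hw hwd]
        subst h3
        exact hT.ne i _ w him hzi hw hwd h2
      · have hb' := Bool.not_eq_of_ne hb
        refine hi (h'.trans (he₀ w hw hwd ?_))
        rw [← h', ← hb', hrz])
  have hzj' : z ∈ {w | w ∈ cov j' ∨ j' = j ∧ w = z} := by
    by_cases hjj : j' = j
    · exact Or.inr ⟨hjj, rfl⟩
    · exact Or.inl ((hcov _ _).2 ⟨hzV, by simp [hjj], by simp [hzz]⟩)
  obtain ⟨h₃, hT₃, -⟩ := hT₂.exists_setDart (E' := insert e E) subset_rfl (i := j') (v := z')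
    (a := (e, !b)) (by simp) hez' (by simpa [hez] using hzj')
    (fun hv => by
      exfalso
      rcases hv with hv | ⟨-, hv⟩
      · exact ((hcov _ _).1 hv).2.2 ⟨rfl, rfl⟩
      · exact hzz hv.symm)
    (fun k hk hv hvd h' => by
      rw [setDart_of_ne _ _ (by simp [hzz.symm]), ht₁ (by simp [hzz.symm])] at h'
      refine hmemE ?_ hvd (congrArg Prod.fst h')
      exact hv.resolve_right fun h1 => hzz h1.2.symm)
    (fun hm w hw hwd h' => by
      by_cases hjw : mate j' = j ∧ w = z
      · rw [hjw.1, hjw.2, setDart_self] at h'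
        exact he (by rw [show e = r.1 from h']; exact hrE)
      · rw [setDart_of_ne _ _ hjw, ht₁ (by simp [him'.symm])] at h'
        exact hmemE (hw.resolve_right hjw) hwd h')
  refine ⟨_, _, hT₃.congr_cov fun k v => ?_⟩
  simp only [Set.mem_ofPred_eq, hcov]
  constructor
  · intro hv
    by_cases h1 : v = z ∧ k = j
    · exact Or.inl (Or.inr h1.symm)
    by_cases h2 : v = z' ∧ k = j'
    · exact Or.inr h2.symm
    exact Or.inl (Or.inl ⟨hv, h1, h2⟩)
  · rintro ((h1 | ⟨-, rfl⟩) | ⟨-, rfl⟩)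
    · exact h1.1
    · exact hzV
    · exact hzV'

/-- If the tree `j` misses `z` and the tree `j'` misses `z'`, both can be completed with the help
of a new edge `z z'`. -/
theorem TreePacking.join (hT : TreePacking d E ends cov t h)
    (hcov : ∀ i v, v ∈ cov i ↔ v ∈ V ∧ ¬(v = z ∧ i = j) ∧ ¬(v = z' ∧ i = j'))
    (hzz : z ≠ z') (hzV : z ∈ V) (hzV' : z' ∈ V) (hzd : z ≠ d) (hzd' : z' ≠ d)
    (he : e ∉ E) (hez : ends e b = z) (hez' : ends e (!b) = z')
    (hadj : ∀ e' ∈ E, ∀ b', ends e' b' = z → ends e' (!b') ≠ z')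
    (h₀ : ∃ e₀, ∀ v ∈ cov (mate j), v ≠ d → ends (t (mate j) v).1 (!(t (mate j) v).2) = z →
      (t (mate j) v).1 = e₀)
    (h₀' : ∃ e₀, ∀ v ∈ cov (mate j'), v ≠ d → ends (t (mate j') v).1 (!(t (mate j') v).2) = z' →
      (t (mate j') v).1 = e₀) :
    ∃ t' h', TreePacking d (insert e E) ends (fun _ => V) t' h' := by
  have hmemE : ∀ {k v}, v ∈ cov k → v ≠ d → e ≠ (t k v).1 := fun hv hvd h' =>
    he (h' ▸ hT.mem _ _ hv hvd)
  -- If the two trees are neither equal nor mates, they share the new edge in opposite directions.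
  -- Otherwise that would be a cycle or a violation of edge-disjointness, and a third tree is
  -- needed.
  by_cases hj : j' = j ∨ j' = mate j
  swap
  · rw [not_or] at hj
    obtain ⟨h₁, hT₁, -⟩ := hT.exists_setDart (E' := insert e E) (Finset.subset_insert _ _)
      (i := j) (v := z) (a := (e, b)) (by simp) hez
      (by
        simp only [hez']
        exact (hcov _ _).2 ⟨hzV', by simp [hzz.symm], by simp [Ne.symm hj.1]⟩)
      (fun hv => absurd ((hcov _ _).1 hv).2.1 (by simp))
      (fun k hk hv hvd h' => hmemE hv hvd (congrArg Prod.fst h'))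
      (fun _ w hw hwd => hmemE hw hwd)
    obtain ⟨h₂, hT₂, -⟩ := hT₁.exists_setDart (E' := insert e E) subset_rfl (i := j') (v := z')
      (a := (e, !b)) (by simp) hez'
      (by
        simp only [Bool.not_not, hez]
        exact Or.inl ((hcov _ _).2 ⟨hzV, by simp [hj.1], by simp [hzz]⟩))
      (fun hv => by
        exfalso
        rcases hv with hv | ⟨-, hv⟩
        · exact ((hcov _ _).1 hv).2.2 ⟨rfl, rfl⟩
        · exact hzz hv.symm)
      (fun k hk hv hvd h' => by
        rw [setDart_of_ne _ _ (by simp [hzz.symm])] at h'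
        refine hmemE ?_ hvd (congrArg Prod.fst h')
        exact hv.resolve_right fun h1 => hzz h1.2.symm)
      (fun hm w hw hwd h' => by
        have hne : ¬(mate j' = j ∧ w = z) := fun h1 => hj.2 (by rw [← h1.1, mate_mate])
        rw [setDart_of_ne _ _ hne] at h'
        exact hmemE (hw.resolve_right hne) hwd h')
    refine ⟨_, _, hT₂.congr_cov fun k v => ?_⟩
    simp only [Set.mem_ofPred_eq, hcov]
    constructor
    · intro hv
      by_cases h1 : v = z ∧ k = j
      · exact Or.inl (Or.inr h1.symm)
      by_cases h2 : v = z' ∧ k = j'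
      · exact Or.inr h2.symm
      exact Or.inl (Or.inl ⟨hv, h1, h2⟩)
    · rintro ((h1 | ⟨-, rfl⟩) | ⟨-, rfl⟩)
      · exact h1.1
      · exact hzV
      · exact hzV'
  obtain ⟨e₀, he₀⟩ := h₀
  obtain ⟨e₁, he₁⟩ := h₀'
  have hthree : ∀ j : Fin 5, ∃ a b c : Fin 5, (a ≠ b ∧ a ≠ c ∧ b ≠ c) ∧
      (a ≠ j ∧ a ≠ mate j) ∧ (b ≠ j ∧ b ≠ mate j) ∧ c ≠ j ∧ c ≠ mate j := by
    decide +kernel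
  obtain ⟨x, y, w, ⟨hxy, hxw, hyw⟩, hx, hy, hw⟩ := hthree j
  have hall' : ∀ x, x ≠ j ∧ x ≠ mate j → x ≠ j ∧ x ≠ j' ∧ x ≠ mate j ∧ x ≠ mate j' := by
    intro x hx
    rcases hj with rfl | rfl
    · exact ⟨hx.1, hx.1, hx.2, hx.2⟩
    · exact ⟨hx.1, hx.2, hx.2, by rw [mate_mate]; exact hx.1⟩
  have hall : ∀ v, v = x ∨ v = y ∨ v = w → v ≠ j ∧ v ≠ j' ∧ v ≠ mate j ∧ v ≠ mate j' := by
    rintro v (rfl | rfl | rfl) <;> exact hall' _ ‹_›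
  have hinj : ∀ v, v ∈ V → v = z ∨ v = z' → ∀ k l : Fin 5, k ≠ l → (k ≠ j ∧ k ≠ j') →
      (l ≠ j ∧ l ≠ j') → (t k v).1 ≠ (t l v).1 := by
    intro v hv hvz k l hkl hk hl heq
    have hvd : v ≠ d := by rcases hvz with rfl | rfl <;> assumption
    have hvk : v ∈ cov k := (hcov _ _).2 ⟨hv, by simp [hk.1], by simp [hk.2]⟩
    have hvl : v ∈ cov l := (hcov _ _).2 ⟨hv, by simp [hl.1], by simp [hl.2]⟩
    refine hT.ne k l v hkl hvk hvl hvd (Prod.ext heq ?_)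
    by_contra hb
    have h1 := hT.tail k v hvk hvd
    have h2 := hT.tail l v hvl hvd
    have h3 := hT.lt k v hvk hvd
    rw [heq, Bool.not_eq_of_ne hb, Bool.not_not, h2] at h3
    omega
  -- The three candidates leave `z` over different edges, and likewise `z'`. Each of `e₀` and `e₁`
  -- excludes at most one of them.
  obtain ⟨i, hi, hi0, hi1⟩ : ∃ i, (i = x ∨ i = y ∨ i = w) ∧ (t i z).1 ≠ e₀ ∧ (t i z').1 ≠ e₁ := by
    by_contra! hcon
    have hx := hall x (by simp)
    have hy := hall y (by simp)
    have hw := hall w (by simp)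
    have a1 := hinj z hzV (Or.inl rfl) x y hxy ⟨hx.1, hx.2.1⟩ ⟨hy.1, hy.2.1⟩
    have a2 := hinj z hzV (Or.inl rfl) x w hxw ⟨hx.1, hx.2.1⟩ ⟨hw.1, hw.2.1⟩
    have a3 := hinj z hzV (Or.inl rfl) y w hyw ⟨hy.1, hy.2.1⟩ ⟨hw.1, hw.2.1⟩
    have b1 := hinj z' hzV' (Or.inr rfl) x y hxy ⟨hx.1, hx.2.1⟩ ⟨hy.1, hy.2.1⟩
    have b2 := hinj z' hzV' (Or.inr rfl) x w hxw ⟨hx.1, hx.2.1⟩ ⟨hw.1, hw.2.1⟩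
    have b3 := hinj z' hzV' (Or.inr rfl) y w hyw ⟨hy.1, hy.2.1⟩ ⟨hw.1, hw.2.1⟩
    have c1 := hcon x (by simp)
    have c2 := hcon y (by simp)
    have c3 := hcon w (by simp)
    by_cases px : (t x z).1 = e₀
    · exact b3 ((c2 fun h => a1 (px.trans h.symm)).trans (c3 fun h => a2 (px.trans h.symm)).symm)
    by_cases py : (t y z).1 = e₀
    · exact b2 ((c1 px).trans (c3 fun h => a3 (py.trans h.symm)).symm)
    · exact b1 ((c1 px).trans (c2 py).symm)
  obtain ⟨hij, hij', him, him'⟩ := hall i hi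
  -- The redirected tree must not climb along the new edge; by symmetry either end may play the role
  -- of `z`.
  rcases le_total (h i z') (h i z) with hle | hle
  · exact hT.join_reroute hcov hzz hzV hzV' hzd hzd' he hez hez' hadj hij hij' him him' hi0 he₀ hle
  · refine hT.join_reroute (j := j') (j' := j) (b := !b) (z := z') (z' := z) ?_ hzz.symm hzV' hzV
      hzd' hzd he hez' (by simpa using hez) ?_ hij' hij him' him hi1 he₁ hle
    · intro k v
      rw [hcov, and_comm (a := ¬(v = z ∧ k = j))]
    · intro e' he' b' h1 h2
      exact hadj e' he' _ h2 (by simpa using h1)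

end Join

end

/-! ### Reductions at vertices of degree five. -/

section

variable {α β : Type*}

/-- Every nonempty set of vertices avoiding `d` is left by at least five edges. -/
def CutCondition (d : α) (V : Finset α) (E : Finset β) (ends : β → Bool → α) : Prop :=
  ∀ p : α → Bool, p d = false → (∃ v ∈ V, p v = true) → 5 ≤ cut E ends p

/-- There is a packing of five spanning in-trees. -/
def HasPacking (d : α) (V : Finset α) (E : Finset β) (ends : β → Bool → α) : Prop :=
  ∃ t h, TreePacking d E ends (fun _ => (V : Set α)) t h

theorem cut_erase [DecidableEq β] {E : Finset β} {e : β} (he : e ∈ E) (ends : β → Bool → α)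
    (p : α → Bool) : cut E ends p =
      cut (E.erase e) ends p + if p (ends e true) = p (ends e false) then 0 else 1 :=
  (Finset.sum_erase_add E _ he).symm

theorem other_end_ne {ends : β → Bool → α} {e : β} {b : Bool} {z : α}
    (h : ends e true ≠ ends e false) (hez : ends e b = z) : ends e (!b) ≠ z := by
  subst hez
  cases b
  · exact h
  · exact h.symm

variable [DecidableEq α] [DecidableEq β]

theorem cut_singleton {E : Finset β} {ends : β → Bool → α}
    (hloop : ∀ e ∈ E, ends e true ≠ ends e false) (z : α) :
    cut E ends (fun v => decide (v = z)) =
      (E.filter fun e => ∃ b, ends e b = z).card := by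
  rw [Finset.card_filter]
  refine Finset.sum_congr rfl fun e he => ?_
  have := hloop e he
  by_cases h1 : ends e true = z <;> by_cases h2 : ends e false = z <;>
    simp_all

theorem exists_halfEdges {E : Finset β} {ends : β → Bool → α}
    (hloop : ∀ e ∈ E, ends e true ≠ ends e false) {z : α}
    (hz : cut E ends (fun v => decide (v = z)) = 4) : ∃ D, HalfEdges E ends z D := by
  rw [cut_singleton hloop] at hz
  let φ := Finset.equivFinOfCardEq hz
  have hmem : ∀ k, (φ.symm k : β) ∈ E ∧ ∃ b, ends (φ.symm k : β) b = z := fun k =>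
    Finset.mem_filter.1 (φ.symm k).2
  choose b hb using fun k => (hmem k).2
  refine ⟨fun k => (φ.symm k, !b k), fun k => (hmem k).1, fun k l h => ?_, fun k => by simp [hb],
    fun k h => ?_, fun e he b' hb' => ?_⟩
  · exact φ.symm.injective (Subtype.ext h)
  · have h1 := hloop _ (hmem k).1
    have h2 := hb k
    generalize b k = x at *
    cases x <;> simp_all
  · have : e ∈ E.filter fun e => ∃ b, ends e b = z := Finset.mem_filter.2 ⟨he, b', hb'⟩
    exact ⟨φ ⟨e, this⟩, by simp⟩

section

variable {E : Finset β} {ends : β → Bool → α} {z z' : α} {D : Fin 4 → β × Bool}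

theorem HalfEdges.splitEnds_ne (hD : HalfEdges E ends z D) {e : β} (he : e ∈ splitEdges E D)
    (b : Bool) : splitEnds ends D e b ≠ z := by
  rcases pinch_cases (ends := ends) (a := (e, b)) he with ⟨k, hk⟩ | ⟨h1, -, h3⟩
  · have := (hD.splitEnds_pinchDart k).1
    rw [← hk] at this
    rw [this]
    exact hD.tail_ne k
  · rw [h3]
    intro h
    obtain ⟨k, hk⟩ := hD.complete e (mem_of_mem_splitEdges he) b h
    exact h1 k hk

theorem HalfEdges.splitEnds_mem (hD : HalfEdges E ends z D) {V : Finset α}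
    (hends : ∀ e ∈ E, ∀ b, ends e b ∈ V) {e : β} (he : e ∈ splitEdges E D) (b : Bool) :
    splitEnds ends D e b ∈ V.erase z := by
  refine Finset.mem_erase.2 ⟨hD.splitEnds_ne he b, ?_⟩
  rcases pinch_cases (ends := ends) (a := (e, b)) he with ⟨k, hk⟩ | ⟨h1, -, h3⟩
  · have := (hD.splitEnds_pinchDart k).1
    rw [← hk] at this
    rw [this]
    exact hends _ (hD.edge_mem k) _
  · rw [h3]
    exact hends e (mem_of_mem_splitEdges he) b

/-- The half-edges at a vertex that is not adjacent to the split vertex. -/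
theorem HalfEdges.split {D' : Fin 4 → β × Bool} (hD : HalfEdges E ends z D)
    (hD' : HalfEdges E ends z' D') (hzz : z ≠ z')
    (hadj : ∀ e ∈ E, ∀ b, ends e b = z → ends e (!b) ≠ z') :
    HalfEdges (splitEdges E D) (splitEnds ends D) z' D' := by
  have hne : ∀ k l, (D' k).1 ≠ (D l).1 := by
    intro k l h
    have h1 := hD'.head k
    have h2 := hD.head l
    have h3 := hadj _ (hD.edge_mem l) _ h2
    rw [h] at h1
    by_cases hb : (D l).2 = (D' k).2
    · rw [hb] at h2
      exact hzz (h2.symm.trans h1)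
    · rw [Bool.not_eq_of_ne (Ne.symm hb), Bool.not_not] at h1
      rw [Bool.not_not] at h3
      exact h3 h1
  have hs : ∀ k b, splitEnds ends D (D' k).1 b = ends (D' k).1 b := fun k b => by
    simp [splitEnds, hne]
  refine ⟨fun k => ?_, hD'.inj, fun k => ?_, fun k => ?_, fun e he b hb => ?_⟩
  · simp [splitEdges, hne, hD'.edge_mem]
  · rw [hs, hD'.head]
  · rw [hs]; exact hD'.tail_ne k
  · rcases pinch_cases (ends := ends) (a := (e, b)) he with ⟨k, hk⟩ | ⟨-, -, h3⟩
    · have := (hD.splitEnds_pinchDart k).1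
      rw [← hk] at this
      rw [this] at hb
      have := hadj _ (hD.edge_mem k) _ (hD.head k)
      rw [Bool.not_not] at this
      exact absurd hb this
    · rw [h3] at hb
      exact hD'.complete e (mem_of_mem_splitEdges he) b hb

end

section

variable {V : Finset α} {E : Finset β} {ends : β → Bool → α} {d z z' : α} {e : β} {b : Bool}

theorem erase_not_crossing {p : α → Bool} (he : e ∈ E)
    (h6 : p (ends e true) ≠ p (ends e false) → 6 ≤ cut E ends p) (h5 : 5 ≤ cut E ends p) :
    5 ≤ cut (E.erase e) ends p := by
  rw [cut_erase he] at h5 h6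
  split_ifs at h5 h6 with h
  · exact h5
  · have := h6 h
    omega

theorem cut_erase_singleton (hloop : ∀ e ∈ E, ends e true ≠ ends e false) (he : e ∈ E)
    (hez : ends e b = z) (hdeg : cut E ends (fun v => decide (v = z)) = 5) :
    cut (E.erase e) ends (fun v => decide (v = z)) = 4 := by
  rw [cut_erase he] at hdeg
  rw [if_neg] at hdeg
  · omega
  · have := other_end_ne (hloop e he) hez
    cases b <;> simp_all

/-- Reduction at a vertex `z` of degree five: delete an edge `e` at `z` and split off the remaining
four edges. -/
theorem hasPacking_of_split (hends : ∀ e ∈ E, ∀ b, ends e b ∈ V) (hcut : CutCondition d V E ends)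
    (hloop : ∀ e ∈ E, ends e true ≠ ends e false) (hzV : z ∈ V) (hzd : z ≠ d)
    (hdeg : cut E ends (fun v => decide (v = z)) = 5) (he : e ∈ E) (hez : ends e b = z)
    (htight : ∀ p : α → Bool, p d = false → (∃ v ∈ V, v ≠ z ∧ p v = true) →
      p (ends e true) ≠ p (ends e false) → 6 ≤ cut E ends p)
    (ih : ∀ (E' : Finset β) (ends' : β → Bool → α), (∀ e ∈ E', ∀ b, ends' e b ∈ V.erase z) →
      CutCondition d (V.erase z) E' ends' → HasPacking d (V.erase z) E' ends') :
    HasPacking d V E ends := by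
  have hsub : ∀ e' ∈ E.erase e, e' ∈ E := fun e' h => Finset.mem_of_mem_erase h
  obtain ⟨D₀, hD₀⟩ := exists_halfEdges (fun e' h => hloop e' (hsub e' h))
    (cut_erase_singleton hloop he hez hdeg)
  -- No further vertex needs an exemption here; the choice of `z` itself makes it vacuous.
  obtain ⟨σ, hσ⟩ := hD₀.exists_split (d := d) (z' := z) hzd
    (fun e' h => hends e' (hsub e' h)) hD₀.tail_ne fun p hpd ⟨v, hv, hvz, hpv⟩ _ =>
      erase_not_crossing he (htight p hpd ⟨v, hv, hvz, hpv⟩) (hcut p hpd ⟨v, hv, hpv⟩)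
  have hD := hD₀.perm σ
  set D := D₀ ∘ σ
  obtain ⟨t, h, hT⟩ := ih _ _
    (fun e' h b => hD.splitEnds_mem (fun e' h => hends e' (hsub e' h)) h b)
    fun p hpd ⟨v, hv, hpv⟩ =>
      hσ p hpd ⟨v, Finset.mem_of_mem_erase hv, Finset.ne_of_mem_erase hv, hpv⟩
        ⟨v, Finset.mem_of_mem_erase hv, Finset.ne_of_mem_erase hv, fun h =>
          Finset.ne_of_mem_erase hv (h.1 hpv)⟩
  obtain ⟨j, t', h', hT', -, -⟩ := hT.pinch hD hzd (by simp) fun i k => by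
    simp only [Finset.coe_erase, Set.mem_sdiff, Finset.mem_coe, Set.mem_singleton_iff]
    exact ⟨hends _ (hsub _ (hD.edge_mem k)) _, hD.tail_ne k⟩
  have hmemE : ∀ {k v}, (v ∈ ((V.erase z : Finset α) : Set α) ∨ v = z ∧ k ≠ j) → v ≠ d →
      e ≠ (t' k v).1 := fun hv hvd h' =>
    Finset.notMem_erase e E (by
      have := hT'.mem _ _ hv hvd
      rwa [← h'] at this)
  have hez' : ends e (!b) ≠ z := other_end_ne (hloop e he) hez
  -- The deleted edge is free and connects `z` to the one tree that still misses it.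
  obtain ⟨h'', hT'', -⟩ := hT'.exists_setDart (E' := E) (Finset.erase_subset _ _) (i := j) (v := z)
    (a := (e, b)) he hez
    (by simp [hez', hends e he (!b)])
    (fun hv => by simp at hv)
    (fun k hk hv hvd h' => hmemE hv hvd (congrArg Prod.fst h'))
    (fun _ w hw hwd => hmemE hw hwd)
  refine ⟨_, _, hT''.congr_cov fun k v => ?_⟩
  simp only [Finset.coe_erase, Set.mem_sdiff, Finset.mem_coe, Set.mem_singleton_iff,
    Set.mem_ofPred_eq]
  by_cases hvz : v = z
  · subst hvz
    simp only [hzV, true_iff]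
    by_cases hk : k = j <;> simp [hk]
  · simp [hvz]

/-- Reduction at two adjacent vertices `z`, `z'` of degree five: delete the edge `e` between them
and split off the remaining edges at both. -/
theorem hasPacking_of_split_pair (hends : ∀ e ∈ E, ∀ b, ends e b ∈ V)
    (hcut : CutCondition d V E ends) (hloop : ∀ e ∈ E, ends e true ≠ ends e false)
    (hzV : z ∈ V) (hzV' : z' ∈ V) (hzd : z ≠ d) (hzd' : z' ≠ d) (hzz : z ≠ z')
    (hdeg : cut E ends (fun v => decide (v = z)) = 5)
    (hdeg' : cut E ends (fun v => decide (v = z')) = 5) (he : e ∈ E) (hez : ends e b = z)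
    (hez' : ends e (!b) = z')
    (hadj : ∀ e' ∈ E, e' ≠ e → ∀ b', ends e' b' = z → ends e' (!b') ≠ z')
    (htight : ∀ p : α → Bool, p d = false → (∃ v ∈ V, v ≠ z ∧ p v = true) →
      (∃ v ∈ V, ¬(p v = true ↔ v = z')) →
      p (ends e true) ≠ p (ends e false) → 6 ≤ cut E ends p)
    (ih : ∀ (E' : Finset β) (ends' : β → Bool → α),
      (∀ e ∈ E', ∀ b, ends' e b ∈ (V.erase z).erase z') →
      CutCondition d ((V.erase z).erase z') E' ends' →
      HasPacking d ((V.erase z).erase z') E' ends') :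
    HasPacking d V E ends := by
  have hsub : ∀ e' ∈ E.erase e, e' ∈ E := fun e' h => Finset.mem_of_mem_erase h
  have hloop' : ∀ e' ∈ E.erase e, ends e' true ≠ ends e' false := fun e' h => hloop e' (hsub e' h)
  have hends₀ : ∀ e' ∈ E.erase e, ∀ b, ends e' b ∈ V := fun e' h => hends e' (hsub e' h)
  have hadj₀ : ∀ e' ∈ E.erase e, ∀ b', ends e' b' = z → ends e' (!b') ≠ z' := fun e' h =>
    hadj e' (hsub e' h) (Finset.ne_of_mem_erase h)
  obtain ⟨D₀, hD₀⟩ := exists_halfEdges hloop' (cut_erase_singleton hloop he hez hdeg)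
  obtain ⟨D₁, hD₁⟩ := exists_halfEdges hloop' (cut_erase_singleton hloop he hez' hdeg')
  -- Deleting `e` leaves `z'` with degree four as well, so `{z'}` has to be exempt until `z'` is
  -- split in turn.
  obtain ⟨σ, hσ⟩ := hD₀.exists_split (d := d) (z' := z') hzd hends₀
    (fun k => by simpa using hadj₀ _ (hD₀.edge_mem k) _ (hD₀.head k))
    fun p hpd ⟨v, hv, hvz, hpv⟩ hne =>
      erase_not_crossing he (htight p hpd ⟨v, hv, hvz, hpv⟩ hne) (hcut p hpd ⟨v, hv, hpv⟩)
  have hD := hD₀.perm σ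
  set D := D₀ ∘ σ
  have hends₁ : ∀ e' ∈ splitEdges (E.erase e) D, ∀ b,
      splitEnds ends D e' b ∈ V.erase z := fun e' h b => hD.splitEnds_mem hends₀ h b
  have hD₁' := hD.split hD₁ hzz hadj₀
  obtain ⟨τ, hτ⟩ := hD₁'.exists_split (d := d) (z' := z) hzd' hends₁
    (fun k => hD.splitEnds_ne (hD₁'.edge_mem k) _) fun p hpd ⟨v, hv, hvz, hpv⟩ _ =>
      hσ p hpd ⟨v, Finset.mem_of_mem_erase hv, Finset.ne_of_mem_erase hv, hpv⟩
        ⟨v, Finset.mem_of_mem_erase hv, Finset.ne_of_mem_erase hv, fun h => hvz (h.1 hpv)⟩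
  have hD' := hD₁'.perm τ
  set D' := D₁ ∘ τ
  obtain ⟨t, h, hT⟩ := ih _ _ (fun e' h b => hD'.splitEnds_mem hends₁ h b)
    fun p hpd ⟨v, hv, hpv⟩ => by
      simp only [Finset.mem_erase] at hv
      exact hτ p hpd ⟨v, by simp [hv], hv.1, hpv⟩ ⟨v, by simp [hv], hv.1, fun h => hv.2.1 (h.1 hpv)⟩
  obtain ⟨j', t', h', hT', ⟨e₁, he₁⟩, -⟩ := hT.pinch hD' hzd' (by simp) fun i k => by
    have h1 := hends₁ _ (hD'.edge_mem k) (D' k).2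
    simp only [Finset.mem_erase] at h1
    simp [h1, hD'.tail_ne k]
  obtain ⟨j, t₂, h₂, hT₂, ⟨e₀, he₀⟩, hpres⟩ := hT'.pinch hD hzd (by simp [hzz]) fun i k => by
    have h1 := hadj₀ _ (hD.edge_mem k) _ (hD.head k)
    rw [Bool.not_not] at h1
    left
    simp [h1, hD.tail_ne k, hends₀ _ (hD.edge_mem k)]
  have := hT₂.join (V := (V : Set α)) (z := z) (z' := z') (j := j) (j' := j') (e := e) (b := b)
    ?_ hzz hzV hzV' hzd hzd' (Finset.notMem_erase _ _) hez hez' hadj₀ ?_ ?_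
  · rwa [Finset.insert_erase he] at this
  · intro i v
    simp only [Finset.coe_erase, Set.mem_sdiff, Finset.mem_coe, Set.mem_singleton_iff,
      Set.mem_ofPred_eq]
    by_cases hvz : v = z
    · subst hvz
      simp [hzz, hzV]
    by_cases hvz' : v = z'
    · subst hvz'
      simp [hvz, hzV']
    · simp [hvz, hvz']
  · refine ⟨e₀, ?_⟩
    rintro v (hv | ⟨rfl, hv⟩) hvd hvz
    · exact he₀ v hv hvd hvz
    · have := hT₂.lt (mate j) v (Or.inr ⟨rfl, hv⟩) hvd
      rw [hvz] at this
      omega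
  · refine ⟨e₁, ?_⟩
    rintro v (hv | ⟨rfl, hv⟩) hvd hvz
    -- The second pinch changes only darts that then enter `z`, so the single entry edge at `z'`
    -- survives it.
    · obtain ⟨h3, h4⟩ := hpres _ v hv hvd (by rw [hvz]; exact hzz.symm)
      rw [h4] at hvz
      rw [h3]
      rcases hv with hv | ⟨rfl, hv⟩
      · exact he₁ v hv hvd hvz
      · have := hT'.lt (mate j') v (Or.inr ⟨rfl, hv⟩) hvd
        rw [hvz] at this
        omega
    · exact absurd hvz (hadj₀ _ (hT₂.mem _ v (Or.inr ⟨rfl, hv⟩) hvd) _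
        (hT₂.tail _ v (Or.inr ⟨rfl, hv⟩) hvd))

end

end

/-! ### Contraction of a doubled pentagon. -/

section

variable {α β : Type*}

/-- The edge of a doubled pentagon, out of two parallel ones, that is used in each of the four
roles: two trees run forwards and two run backwards between consecutive vertices. -/
def roleEdge (x : Bool) : Fin 4 → Bool := ![true, false, x, !x]

/-- The position of the root of the tree with a given role, relative to the position of the edge. -/
def roleRoot : Fin 4 → Fin 5 := ![1, 2, 0, 4]

theorem roleRoot_injective : Function.Injective roleRoot := by decide

theorem Fin.five_not_cycle : ∀ k l : Fin 5, l + 1 = k → l = k + 1 → False := by decide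

/-- Two forward and two backward trees can share two parallel edges in two ways. They cannot both
put mates together, because a tree has only one mate. -/
theorem exists_roleEdge (g : Fin 4 → Fin 5) (hg : Function.Injective g) :
    ∃ x, ∀ a b, a ≠ b → roleEdge x a = roleEdge x b → mate (g a) ≠ g b := by
  have key : ∀ g0 g1 g2 g3 : Fin 5, g0 ≠ g1 → g0 ≠ g2 → g0 ≠ g3 → g1 ≠ g2 → g1 ≠ g3 → g2 ≠ g3 →
      (mate g0 ≠ g2 ∧ mate g2 ≠ g0 ∧ mate g1 ≠ g3 ∧ mate g3 ≠ g1) ∨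
      (mate g0 ≠ g3 ∧ mate g3 ≠ g0 ∧ mate g1 ≠ g2 ∧ mate g2 ≠ g1) := by
    decide +kernel
  rcases key (g 0) (g 1) (g 2) (g 3) (hg.ne (by decide)) (hg.ne (by decide)) (hg.ne (by decide))
    (hg.ne (by decide)) (hg.ne (by decide)) (hg.ne (by decide)) with h | h
  · refine ⟨true, fun a b hab hs => ?_⟩
    fin_cases a <;> fin_cases b <;> simp_all [roleEdge]
  · refine ⟨false, fun a b hab hs => ?_⟩
    fin_cases a <;> fin_cases b <;> simp_all [roleEdge]

variable [DecidableEq α] [DecidableEq β] {V : Finset α} {E : Finset β} {ends : β → Bool → α}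
  {d : α} {c : Fin 5 → α}

/-- Reduction of a pentagon with doubled edges, all of whose vertices have degree five: contract
it. -/
theorem hasPacking_of_pentagon (hends : ∀ e ∈ E, ∀ b, ends e b ∈ V)
    (hcut : CutCondition d V E ends) (hc : Function.Injective c) (hcV : ∀ k, c k ∈ V)
    (hcd : ∀ k, c k ≠ d) {q : Fin 5 → Bool → β} {o : Fin 5 → Bool → Bool}
    (hqE : ∀ k s, q k s ∈ E) (hq : ∀ k, q k true ≠ q k false)
    (hq1 : ∀ k s, ends (q k s) (o k s) = c k) (hq2 : ∀ k s, ends (q k s) (!(o k s)) = c (k + 1))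
    (hpend : ∀ e ∈ E, ∀ e' ∈ E, ∀ b b' k, ends e b = c k → ends e' b' = c k →
      (∀ l, ends e (!b) ≠ c l) → (∀ l, ends e' (!b') ≠ c l) → e = e')
    (ih : ∀ (E' : Finset β) (ends' : β → Bool → α),
      (∀ e ∈ E', ∀ b, ends' e b ∈ V.filter fun v => ∀ k, k ≠ 0 → v ≠ c k) →
      CutCondition d (V.filter fun v => ∀ k, k ≠ 0 → v ≠ c k) E' ends' →
      HasPacking d (V.filter fun v => ∀ k, k ≠ 0 → v ≠ c k) E' ends') :
    HasPacking d V E ends := by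
  set V' := V.filter fun v => ∀ k, k ≠ 0 → v ≠ c k
  let κ : α → α := fun v => if ∃ k, v = c k then c 0 else v
  have hκc : ∀ k, κ (c k) = c 0 := fun k => if_pos ⟨k, rfl⟩
  have hκ : ∀ v, (∀ k, v ≠ c k) → κ v = v := fun v hv => if_neg (by simpa using hv)
  have hκV : ∀ v ∈ V, κ v ∈ V' := by
    intro v hv
    by_cases h : ∃ k, v = c k
    · obtain ⟨k, rfl⟩ := h
      rw [hκc]
      exact Finset.mem_filter.2 ⟨hcV 0, fun k hk h => hk (hc h).symm⟩
    · push Not at h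
      rw [hκ v h]
      exact Finset.mem_filter.2 ⟨hv, fun k _ => h k⟩
  have hκfix : ∀ v ∈ V', κ v = v := by
    intro v hv
    by_cases h : v = c 0
    · rw [h, hκc]
    · exact hκ v fun k hk => (em (k = 0)).elim (fun h0 => h (h0 ▸ hk))
        fun h0 => (Finset.mem_filter.1 hv).2 k h0 hk
  let E' := E.filter fun e => ¬∀ b, ∃ k, ends e b = c k
  have hE'E : ∀ {e}, e ∈ E' → e ∈ E := fun h => (Finset.mem_filter.1 h).1
  have hqE' : ∀ k s, q k s ∉ E' := by
    intro k s h
    refine (Finset.mem_filter.1 h).2 fun b => ?_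
    by_cases hb : b = o k s
    · exact ⟨k, by rw [hb, hq1]⟩
    · exact ⟨k + 1, by rw [Bool.not_eq_of_ne hb, hq2]⟩
  obtain ⟨t, h, hT⟩ := ih E' (fun e b => κ (ends e b))
    (fun e he b => hκV _ (hends e (hE'E he) b)) (by
      intro p hpd ⟨v, hv, hpv⟩
      have h1 := hcut (p ∘ κ) (by simpa [hκ d fun k => (hcd k).symm])
        ⟨v, (Finset.mem_filter.1 hv).1, by simpa [hκfix v hv]⟩
      refine h1.trans_eq ?_
      unfold cut E'
      rw [Finset.sum_filter]
      refine Finset.sum_congr rfl fun e he => ?_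
      by_cases hin : ∀ b, ∃ k, ends e b = c k
      · obtain ⟨k, hk⟩ := hin true
        obtain ⟨l, hl⟩ := hin false
        simp [hk, hl, hκc]
      · rw [if_pos hin]
        rfl)
  have hc0V : c 0 ∈ (V' : Set α) := by
    have := hκV _ (hcV 0)
    rwa [hκc] at this
  have hout : ∀ {v}, v ∈ V → (∀ k, v ≠ c k) → v ∈ (V' : Set α) := fun hv hvc => by
    have := hκV _ hv
    rwa [hκ _ hvc] at this
  have hκinv : ∀ {v}, κ v = c 0 → ∃ k, v = c k := fun {v} hv => by
    by_contra hcon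
    push Not at hcon
    rw [hκ v hcon] at hv
    exact hcon 0 hv
  have hroot : ∀ i, ∃ k, ends (t i (c 0)).1 (t i (c 0)).2 = c k := fun i =>
    hκinv (hT.tail i (c 0) hc0V (hcd 0))
  choose ρ hρ using hroot
  have hf : ∀ i l, ends (t i (c 0)).1 (!(t i (c 0)).2) ≠ c l := by
    intro i l hl
    have := hT.lt i (c 0) hc0V (hcd 0)
    simp only [hl, hκc] at this
    omega
  have hfE : ∀ i, (t i (c 0)).1 ∈ E' := fun i => hT.mem i (c 0) hc0V (hcd 0)
  -- At most one edge leaves the pentagon at each of its vertices, and arc-disjoint trees cannot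
  -- share it outwards. Hence the five trees leave from five different vertices.
  have hρinj : Function.Injective ρ := by
    intro i j hij
    by_contra hne
    have h1 := hpend _ (hE'E (hfE i)) _ (hE'E (hfE j)) _ _ (ρ i) (hρ i) (hij ▸ hρ j) (hf i) (hf j)
    refine hT.ne i j (c 0) hne hc0V hc0V (hcd 0) (Prod.ext h1 ?_)
    by_contra hb
    refine hf i (ρ j) ?_
    rw [← Bool.not_eq_of_ne (Ne.symm hb), h1, hρ j]
  have hρbij := Finite.injective_iff_bijective.1 hρinj
  obtain ⟨τ, hτ1, hτ2⟩ := Function.bijective_iff_has_inverse.1 hρbij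
  have hx : ∀ k, ∃ x, ∀ a b, a ≠ b → roleEdge x a = roleEdge x b →
      mate (τ (k + roleRoot a)) ≠ τ (k + roleRoot b) := fun k =>
    exists_roleEdge (fun a => τ (k + roleRoot a)) (by
      intro a b hab
      have := hτ2.injective hab
      exact roleRoot_injective (add_left_cancel this))
  choose x hx using hx
  let inner : Fin 5 → Fin 5 → β × Bool := fun m δ =>
    ![(q m true, o m true), (q (m - 1) (x (m - 1)), !(o (m - 1) (x (m - 1)))),
      (q (m - 1) (!x (m - 1)), !(o (m - 1) (!x (m - 1)))), (q m false, o m false),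
      (q m true, o m true)] δ
  have hδ : ∀ δ : Fin 5, δ ≠ 0 → δ = 1 ∨ δ = 2 ∨ δ = 3 ∨ δ = 4 := by decide
  have hin_role : ∀ m δ, δ ≠ 0 → ∃ k a, (inner m δ).1 = q k (roleEdge (x k) a) ∧
      m - δ = k + roleRoot a := by
    intro m δ h0
    rcases hδ δ h0 with rfl | rfl | rfl | rfl
    · refine ⟨m - 1, 2, rfl, ?_⟩
      revert m; decide
    · refine ⟨m - 1, 3, rfl, ?_⟩
      revert m; decide
    · refine ⟨m, 1, rfl, ?_⟩
      revert m; decide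
    · refine ⟨m, 0, rfl, ?_⟩
      revert m; decide
  have hin_mem : ∀ m δ, (inner m δ).1 ∈ E := by
    intro m δ
    fin_cases δ <;> exact hqE _ _
  have hsub1 : ∀ m : Fin 5, m - 1 + 1 = m := by decide
  have hin_tail : ∀ m δ, ends (inner m δ).1 (inner m δ).2 = c m := by
    intro m δ
    fin_cases δ
    · exact hq1 _ _
    · exact (hq2 _ _).trans (by rw [hsub1])
    · exact (hq2 _ _).trans (by rw [hsub1])
    · exact hq1 _ _
    · exact hq1 _ _
  let dist : Fin 5 → ℕ := ![0, 1, 2, 2, 1]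
  have hin_head : ∀ m δ, δ ≠ 0 → ∃ l, ends (inner m δ).1 (!(inner m δ).2) = c l ∧
      dist (l - (m - δ)) < dist δ := by
    intro m δ h0
    rcases hδ δ h0 with rfl | rfl | rfl | rfl
    · refine ⟨m - 1, by simpa [inner] using hq1 _ _, ?_⟩
      revert m; decide
    · refine ⟨m - 1, by simpa [inner] using hq1 _ _, ?_⟩
      revert m; decide
    · refine ⟨m + 1, by simpa [inner] using hq2 _ _, ?_⟩
      revert m; decide
    · refine ⟨m + 1, by simpa [inner] using hq2 _ _, ?_⟩
      revert m; decide
  have hinj : ∀ {k l s s'}, q k s = q l s' → k = l := by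
    intro k l s s' heq
    have a1 := hq1 k s
    have a2 := hq2 k s
    have b1 := hq1 l s'
    have b2 := hq2 l s'
    rw [heq] at a1 a2
    by_cases hb : o k s = o l s'
    · rw [hb, b1] at a1
      exact (hc a1).symm
    · rw [Bool.not_eq_of_ne hb, b2] at a1
      rw [Bool.not_eq_of_ne hb, Bool.not_not, b1] at a2
      exact (Fin.five_not_cycle k l (hc a1) (hc a2)).elim
  have hsub_ne : ∀ m : Fin 5, m ≠ m - 1 := by decide
  have hin_ne : ∀ m δ δ', δ ≠ 0 → δ' ≠ 0 → δ ≠ δ' → inner m δ ≠ inner m δ' := by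
    have hsep : ∀ m s s', q m s ≠ q (m - 1) s' := fun m s s' heq => by
      exact hsub_ne m (hinj heq)
    have hxx : ∀ k y, q k y ≠ q k (!y) := by
      intro k y
      cases y
      · exact (hq k).symm
      · exact hq k
    intro m δ δ' h0 h0' hne heq
    have heq := congrArg Prod.fst heq
    rcases hδ δ h0 with rfl | rfl | rfl | rfl <;> rcases hδ δ' h0' with rfl | rfl | rfl | rfl
    · exact hne rfl
    · exact hxx _ _ heq
    · exact hsep _ _ _ heq.symm
    · exact hsep _ _ _ heq.symm
    · exact hxx _ _ heq.symm
    · exact hne rfl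
    · exact hsep _ _ _ heq.symm
    · exact hsep _ _ _ heq.symm
    · exact hsep _ _ _ heq
    · exact hsep _ _ _ heq
    · exact hne rfl
    · exact hq _ heq.symm
    · exact hsep _ _ _ heq
    · exact hsep _ _ _ heq
    · exact hq _ heq
    · exact hne rfl
  have hdec : ∀ v, ∃ m, (∃ k, v = c k) → v = c m := fun v => by
    by_cases hv : ∃ k, v = c k
    · exact ⟨hv.choose, fun _ => hv.choose_spec⟩
    · exact ⟨0, fun h => absurd h hv⟩
  choose ι hι using hdec
  have hιc : ∀ k, ι (c k) = k := fun k => (hc (hι (c k) ⟨k, rfl⟩)).symm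
  let t' : Fin 5 → α → β × Bool := fun i v => if ∃ k, v = c k then
    (if ι v = ρ i then t i (c 0) else inner (ι v) (ι v - ρ i)) else t i v
  -- Distances inside the pentagon are at most two, so any factor above two would do instead of ten.
  let h' : Fin 5 → α → ℕ := fun i v => if ∃ k, v = c k then
    10 * h i (c 0) + dist (ι v - ρ i) else 10 * h i v
  have ht'r : ∀ i, t' i (c (ρ i)) = t i (c 0) := fun i => by simp [t', hιc]
  have ht'c : ∀ i m, m ≠ ρ i → t' i (c m) = inner m (m - ρ i) := fun i m hm => by
    simp [t', hιc, hm]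
  have ht'o : ∀ i v, (∀ k, v ≠ c k) → t' i v = t i v := fun i v hv => if_neg (by simpa using hv)
  have hh'c : ∀ i m, h' i (c m) = 10 * h i (c 0) + dist (m - ρ i) := fun i m => by
    simp [h', hιc]
  have hh'o : ∀ i v, (∀ k, v ≠ c k) → h' i v = 10 * h i v := fun i v hv =>
    if_neg (by simpa using hv)
  have hdist : ∀ δ, dist δ ≤ 2 := by decide
  have hh'le : ∀ i v, h' i v ≤ 10 * h i (κ v) + 2 := by
    intro i v
    by_cases hv : ∃ k, v = c k
    · obtain ⟨k, rfl⟩ := hv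
      rw [hh'c, hκc]
      have := hdist (k - ρ i)
      omega
    · push Not at hv
      rw [hh'o i v hv, hκ v hv]
      omega
  have hδ0 : ∀ {m r : Fin 5}, m ≠ r → m - r ≠ 0 := fun h h' => h (sub_eq_zero.1 h')
  have hsubsub : ∀ m r : Fin 5, m - (m - r) = r := fun m r => by abel
  have hcases : ∀ v ∈ V, v ≠ d → (∀ k, v ≠ c k) ∧ v ∈ (V' : Set α) ∨ ∃ m, v = c m := by
    intro v hv _
    by_cases h : ∃ k, v = c k
    · exact Or.inr h
    · push Not at h
      exact Or.inl ⟨h, hout hv h⟩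
  have hold : ∀ i v, v ∈ V → v ≠ d → (∃ w ∈ (V' : Set α), w ≠ d ∧ t' i v = t i w) ∨
      ∃ k a, (t' i v).1 = q k (roleEdge (x k) a) ∧ i = τ (k + roleRoot a) := by
    intro i v hv hvd
    rcases hcases v hv hvd with ⟨h1, h2⟩ | ⟨m, rfl⟩
    · exact Or.inl ⟨v, h2, hvd, ht'o i v h1⟩
    · by_cases hm : m = ρ i
      · exact Or.inl ⟨c 0, hc0V, hcd 0, by rw [hm, ht'r]⟩
      · obtain ⟨k, a, h1, h2⟩ := hin_role m (m - ρ i) (hδ0 hm)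
        exact Or.inr ⟨k, a, by rw [ht'c i m hm, h1], by rw [← h2, hsubsub, hτ1]⟩
  refine ⟨t', h', ?_, ?_, ?_, ?_, ?_, ?_⟩
  · intro i v hv hvd
    rcases hold i v hv hvd with ⟨w, hw, hwd, heq⟩ | ⟨k, a, heq, -⟩
    · rw [heq]
      exact hE'E (hT.mem i w hw hwd)
    · rw [heq]
      exact hqE _ _
  · intro i v hv hvd
    rcases hcases v hv hvd with ⟨h1, h2⟩ | ⟨m, rfl⟩
    · rw [ht'o i v h1]
      have h3 := hT.tail i v h2 hvd
      have h4 : ∀ k, ends (t i v).1 (t i v).2 ≠ c k := fun k hk => by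
        simp only [hk, hκc] at h3
        exact h1 0 h3.symm
      simpa [hκ _ h4] using h3
    · by_cases hm : m = ρ i
      · rw [hm, ht'r, hρ]
      · rw [ht'c i m hm, hin_tail]
  · intro i v hv hvd
    rcases hold i v hv hvd with ⟨w, hw, hwd, heq⟩ | ⟨k, a, heq, -⟩
    · rw [heq]
      exact hends _ (hE'E (hT.mem i w hw hwd)) _
    · rw [heq]
      exact hends _ (hqE _ _) _
  · intro i v hv hvd
    rcases hcases v hv hvd with ⟨h1, h2⟩ | ⟨m, rfl⟩
    · rw [ht'o i v h1, hh'o i v h1]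
      have h3 : h i (κ (ends (t i v).1 (!(t i v).2))) < h i v := hT.lt i v h2 hvd
      have h4 := hh'le i (ends (t i v).1 (!(t i v).2))
      omega
    · by_cases hm : m = ρ i
      · rw [hm, ht'r, hh'c, hh'o i _ (hf i)]
        have h3 := hT.lt i (c 0) hc0V (hcd 0)
        simp only [hκ _ (hf i)] at h3
        omega
      · rw [ht'c i m hm, hh'c]
        obtain ⟨l, h1, h2⟩ := hin_head m (m - ρ i) (hδ0 hm)
        rw [h1, hh'c]
        rw [hsubsub] at h2
        omega
  · intro i j v hij hv _ hvd heq
    rcases hcases v hv hvd with ⟨h1, h2⟩ | ⟨m, rfl⟩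
    · rw [ht'o i v h1, ht'o j v h1] at heq
      exact hT.ne i j v hij h2 h2 hvd heq
    · by_cases hm : m = ρ i <;> by_cases hm' : m = ρ j
      · exact hij (hρinj (hm.symm.trans hm'))
      · rw [ht'c j m hm', hm, ht'r] at heq
        obtain ⟨k, a, h1, -⟩ := hin_role (ρ i) (ρ i - ρ j) (hδ0 (hm ▸ hm'))
        rw [← heq] at h1
        exact hqE' _ _ (h1 ▸ hfE i)
      · rw [ht'c i m hm, hm', ht'r] at heq
        obtain ⟨k, a, h1, -⟩ := hin_role (ρ j) (ρ j - ρ i) (hδ0 (hm' ▸ hm))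
        rw [heq] at h1
        exact hqE' _ _ (h1 ▸ hfE j)
      · rw [ht'c i m hm, ht'c j m hm'] at heq
        refine hin_ne m _ _ (hδ0 hm) (hδ0 hm') (fun h => hij (hρinj ?_)) heq
        exact sub_right_injective h
  · intro i v w him hv hw hvd hwd heq
    rcases hold i v hv hvd with ⟨v', hv', hvd', h1⟩ | ⟨k, a, h1, h2⟩ <;>
      rcases hold (mate i) w hw hwd with ⟨w', hw', hwd', g1⟩ | ⟨l, b, g1, g2⟩
    · rw [h1, g1] at heq
      exact hT.edge_ne i v' w' him hv' hw' hvd' hwd' heq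
    · rw [h1, g1] at heq
      exact hqE' _ _ (heq ▸ hT.mem i v' hv' hvd')
    · rw [h1, g1] at heq
      exact hqE' _ _ (heq ▸ hT.mem _ w' hw' hwd')
    · rw [h1, g1] at heq
      obtain rfl : k = l := hinj heq
      have hs : roleEdge (x k) a = roleEdge (x k) b := by
        have := hq k
        generalize roleEdge (x k) a = y at heq ⊢
        generalize roleEdge (x k) b = y' at heq ⊢
        cases y <;> cases y'
        · rfl
        · exact absurd heq.symm this
        · exact absurd heq this
        · rfl
      by_cases hab : a = b
      · subst hab
        exact him (g2.trans h2.symm)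
      · exact hx k a b hab hs (by rw [← h2, ← g2])

end

/-! ### Uncrossing of tight sets, degree counts, recognition of a pentagon. -/

section

variable {α β : Type*}

section Uncrossing

variable {E : Finset β} {ends : β → Bool → α}

theorem cut_inter_add_cut_union (p q : α → Bool) :
    cut E ends (fun v => p v && q v) + cut E ends (fun v => p v || q v) ≤
      cut E ends p + cut E ends q := by
  simp only [cut, ← Finset.sum_add_distrib]
  refine Finset.sum_le_sum fun e _ => ?_
  rcases Bool.eq_false_or_eq_true (p (ends e true)) with h1 | h1 <;>
    rcases Bool.eq_false_or_eq_true (p (ends e false)) with h2 | h2 <;>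
    rcases Bool.eq_false_or_eq_true (q (ends e true)) with h3 | h3 <;>
    rcases Bool.eq_false_or_eq_true (q (ends e false)) with h4 | h4 <;> simp [h1, h2, h3, h4]

theorem cut_sdiff_add_cut_sdiff (p q : α → Bool) :
    cut E ends (fun v => p v && !q v) + cut E ends (fun v => q v && !p v) ≤
      cut E ends p + cut E ends q := by
  simp only [cut, ← Finset.sum_add_distrib]
  refine Finset.sum_le_sum fun e _ => ?_
  rcases Bool.eq_false_or_eq_true (p (ends e true)) with h1 | h1 <;>
    rcases Bool.eq_false_or_eq_true (p (ends e false)) with h2 | h2 <;>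
    rcases Bool.eq_false_or_eq_true (q (ends e true)) with h3 | h3 <;>
    rcases Bool.eq_false_or_eq_true (q (ends e false)) with h4 | h4 <;> simp [h1, h2, h3, h4]

/-- Edges between the two parts of `p` are counted twice on the left and not at all in the cut of
`p`. What matters is the resulting parity. -/
theorem exists_cut_inter_add_cut_sdiff (p q : α → Bool) : ∃ m,
    cut E ends (fun v => p v && q v) + cut E ends (fun v => p v && !q v) =
      cut E ends p + 2 * m := by
  refine ⟨∑ e ∈ E, if p (ends e true) && p (ends e false) &&
    (q (ends e true) ^^ q (ends e false)) then 1 else 0, ?_⟩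
  simp only [cut, ← Finset.sum_add_distrib, Finset.mul_sum]
  refine Finset.sum_congr rfl fun e _ => ?_
  rcases Bool.eq_false_or_eq_true (p (ends e true)) with h1 | h1 <;>
    rcases Bool.eq_false_or_eq_true (p (ends e false)) with h2 | h2 <;>
    rcases Bool.eq_false_or_eq_true (q (ends e true)) with h3 | h3 <;>
    rcases Bool.eq_false_or_eq_true (q (ends e false)) with h4 | h4 <;> simp [h1, h2, h3, h4]

/-- Tight sets do not cross, since five is odd. -/
theorem not_crossing {V : Finset α} {d : α} (hcut : CutCondition d V E ends) {p q : α → Bool}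
    (hpd : p d = false) (hqd : q d = false) (hp : cut E ends p = 5) (hq : cut E ends q = 5)
    (h1 : ∃ v ∈ V, p v = true ∧ q v = true) (h2 : ∃ v ∈ V, p v = true ∧ q v = false)
    (h3 : ∃ v ∈ V, q v = true ∧ p v = false) : False := by
  obtain ⟨v1, hv1, h1⟩ := h1
  obtain ⟨v2, hv2, h2⟩ := h2
  obtain ⟨v3, hv3, h3⟩ := h3
  have a1 := hcut (fun v => p v && q v) (by simp [hpd]) ⟨v1, hv1, by simp [h1]⟩
  have a2 := hcut (fun v => p v || q v) (by simp [hpd, hqd]) ⟨v1, hv1, by simp [h1]⟩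
  have a3 := hcut (fun v => p v && !q v) (by simp [hpd]) ⟨v2, hv2, by simp [h2]⟩
  have a4 := hcut (fun v => q v && !p v) (by simp [hqd]) ⟨v3, hv3, by simp [h3]⟩
  have b1 := cut_inter_add_cut_union (E := E) (ends := ends) p q
  have b2 := cut_sdiff_add_cut_sdiff (E := E) (ends := ends) p q
  -- The two submodular inequalities force all four derived cuts to be five, and then ten would
  -- equal five plus an even number.
  obtain ⟨m, b3⟩ := exists_cut_inter_add_cut_sdiff (E := E) (ends := ends) p q
  omega

end Uncrossing

section Counting

variable [DecidableEq α] {E : Finset β} {ends : β → Bool → α}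

theorem cut_pair (hloop : ∀ e ∈ E, ends e true ≠ ends e false) {x y : α} (hxy : x ≠ y) :
    cut E ends (fun v => decide (v = x) || decide (v = y)) +
      2 * (E.filter fun e => ∃ b, ends e b = x ∧ ends e (!b) = y).card =
      cut E ends (fun v => decide (v = x)) + cut E ends (fun v => decide (v = y)) := by
  rw [Finset.card_filter]
  simp only [cut, Finset.mul_sum, ← Finset.sum_add_distrib]
  refine Finset.sum_congr rfl fun e he => ?_
  have h1 := hloop e he
  generalize ha : ends e true = a at *
  generalize hb : ends e false = b at *
  by_cases h2 : a = x
  · subst h2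
    by_cases h4 : b = y
    · subst h4
      simp [ha, hb, hxy, Ne.symm hxy]
    · simp [ha, hb, hxy, Ne.symm h1, h4]
  · by_cases h3 : a = y
    · subst h3
      by_cases h4 : b = x
      · subst h4
        simp [ha, hb, hxy, Ne.symm hxy]
      · simp [ha, hb, Ne.symm hxy, Ne.symm h1, h4]
    · by_cases h4 : b = x
      · subst h4
        simp [ha, hb, h2, h3, hxy]
      · by_cases h5 : b = y
        · subst h5
          simp [ha, hb, h2, h3, Ne.symm hxy]
        · simp [ha, hb, h2, h3, h4, h5]

theorem cut_remove (hloop : ∀ e ∈ E, ends e true ≠ ends e false) {p : α → Bool} {x : α}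
    (hx : p x = true) :
    cut E ends (fun v => p v && !decide (v = x)) +
      (E.filter fun e => ∃ b, ends e b = x ∧ p (ends e (!b)) = false).card =
      cut E ends p + (E.filter fun e => ∃ b, ends e b = x ∧ p (ends e (!b)) = true).card := by
  rw [Finset.card_filter, Finset.card_filter]
  simp only [cut, ← Finset.sum_add_distrib]
  refine Finset.sum_congr rfl fun e he => ?_
  have h1 := hloop e he
  generalize ha : ends e true = a at *
  generalize hb : ends e false = b at *
  by_cases h2 : a = x
  · subst h2
    rcases Bool.eq_false_or_eq_true (p b) with hpb | hpb <;> simp [ha, hb, hx, Ne.symm h1, hpb]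
  · by_cases h3 : b = x
    · subst h3
      rcases Bool.eq_false_or_eq_true (p a) with hpb | hpb <;> simp [ha, hb, hx, h1, hpb]
    · simp [ha, hb, h2, h3]

theorem cut_singleton_add (hloop : ∀ e ∈ E, ends e true ≠ ends e false) (p : α → Bool) (x : α) :
    cut E ends (fun v => decide (v = x)) =
      (E.filter fun e => ∃ b, ends e b = x ∧ p (ends e (!b)) = false).card +
      (E.filter fun e => ∃ b, ends e b = x ∧ p (ends e (!b)) = true).card := by
  rw [Finset.card_filter, Finset.card_filter]
  simp only [cut, ← Finset.sum_add_distrib]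
  refine Finset.sum_congr rfl fun e he => ?_
  have h1 := hloop e he
  generalize ha : ends e true = a at *
  generalize hb : ends e false = b at *
  by_cases h2 : a = x
  · subst h2
    rcases Bool.eq_false_or_eq_true (p b) with hpb | hpb <;> simp [ha, hb, Ne.symm h1, hpb]
  · by_cases h3 : b = x
    · subst h3
      rcases Bool.eq_false_or_eq_true (p a) with hpb | hpb <;> simp [ha, hb, h1, hpb]
    · simp [ha, hb, h2, h3]

/-- A set `S` of vertices in `p` that is closed under adjacency within `p`. -/
theorem cut_closed {p : α → Bool} {S : Finset α} (hS : ∀ v ∈ S, p v = true)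
    (hclosed : ∀ e ∈ E, ∀ b, ends e b ∈ S → p (ends e (!b)) = true → ends e (!b) ∈ S) :
    cut E ends (fun v => decide (v ∈ S)) =
      ∑ x ∈ S, (E.filter fun e => ∃ b, ends e b = x ∧ p (ends e (!b)) = false).card := by
  simp only [Finset.card_filter]
  rw [Finset.sum_comm]
  refine Finset.sum_congr rfl fun e he => ?_
  have key : ∀ b, ends e b ∈ S → ends e (!b) ∉ S →
      (∑ x ∈ S, if ∃ b, ends e b = x ∧ p (ends e (!b)) = false then 1 else 0) = 1 := by
    intro b h1 h2
    have h3 : p (ends e (!b)) = false := by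
      by_contra h
      exact h2 (hclosed e he b h1 (by simpa using h))
    rw [Finset.sum_eq_single (ends e b)]
    · exact if_pos ⟨b, rfl, h3⟩
    · intro x hx hne
      refine if_neg ?_
      rintro ⟨b', h4, h5⟩
      by_cases hb : b' = b
      · exact hne (by rw [← h4, hb])
      · rw [Bool.not_eq_of_ne hb] at h4
        exact h2 (h4 ▸ hx)
    · exact fun h => absurd h1 h
  by_cases h1 : ends e true ∈ S <;> by_cases h2 : ends e false ∈ S
  · simp only [h1, h2, if_true]
    symm
    refine Finset.sum_eq_zero fun x _ => if_neg ?_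
    rintro ⟨_ | _, -, h4⟩
    · rw [Bool.not_false, hS _ h1] at h4
      simp at h4
    · rw [Bool.not_true, hS _ h2] at h4
      simp at h4
  · rw [key true h1 h2]
    simp [h1, h2]
  · rw [key false h2 h1]
    simp [h1, h2]
  · simp only [h1, h2, if_true]
    symm
    refine Finset.sum_eq_zero fun x hx => if_neg ?_
    rintro ⟨_ | _, rfl, h4⟩
    · exact h2 hx
    · exact h1 hx

end Counting

/-- A two-regular graph on five vertices without proper components is a pentagon. -/
theorem exists_pentagon [DecidableEq α] {F : Finset α} {A : α → α → Prop} (hF : F.card = 5)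
    (hsymm : ∀ x y, A x y → A y x) (hirr : ∀ x, ¬A x x)
    (htwo : ∀ x ∈ F, ∃ y z, y ≠ z ∧ y ∈ F ∧ z ∈ F ∧ ∀ w ∈ F, A x w ↔ w = y ∨ w = z)
    (hclosed : ∀ S ⊆ F, S.Nonempty → (∀ x ∈ S, ∀ y ∈ F, A x y → y ∈ S) → 5 ≤ S.card) :
    ∃ c : Fin 5 → α, Function.Injective c ∧ (∀ v, v ∈ F ↔ ∃ k, v = c k) ∧
      ∀ k, A (c k) (c (k + 1)) := by
  have hother : ∀ x ∈ F, ∀ y ∈ F, A x y → ∃ z ∈ F, z ≠ y ∧ ∀ w ∈ F, A x w ↔ w = y ∨ w = z := by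
    intro x hx y hy hxy
    obtain ⟨a, b, hab, ha, hb, h⟩ := htwo x hx
    rcases (h y hy).1 hxy with rfl | rfl
    · exact ⟨b, hb, hab.symm, h⟩
    · exact ⟨a, ha, hab, fun w hw => (h w hw).trans or_comm⟩
  obtain ⟨x0, h0⟩ := Finset.card_pos.1 (by omega : 0 < F.card)
  obtain ⟨x1, x4, h14, h1, h4, n0⟩ := htwo x0 h0
  have a01 : A x0 x1 := (n0 x1 h1).2 (Or.inl rfl)
  have a04 : A x0 x4 := (n0 x4 h4).2 (Or.inr rfl)
  obtain ⟨x2, h2, h20, n1⟩ := hother x1 h1 x0 h0 (hsymm _ _ a01)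
  obtain ⟨x3, h3, h30, n4⟩ := hother x4 h4 x0 h0 (hsymm _ _ a04)
  have a12 : A x1 x2 := (n1 x2 h2).2 (Or.inr rfl)
  have a43 : A x4 x3 := (n4 x3 h3).2 (Or.inr rfl)
  have hne : ∀ {x y}, A x y → x ≠ y := fun h h' => hirr _ (h' ▸ h)
  -- Walking away from `x0` in both directions, a premature meeting would close up a set of three
  -- vertices here, or of four in the next step.
  have h24 : x2 ≠ x4 := by
    intro h
    have hx31 : x1 = x3 := ((n4 x1 h1).1 (hsymm _ _ (h ▸ a12))).resolve_left (hne a01).symm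
    have := hclosed {x0, x1, x4} (by simp [Finset.insert_subset_iff, h0, h1, h4]) (by simp) (by
      intro x hx y hy hxy
      simp only [Finset.mem_insert, Finset.mem_singleton] at hx ⊢
      rcases hx with rfl | rfl | rfl
      · exact Or.inr ((n0 y hy).1 hxy)
      · rw [← h]
        exact ((n1 y hy).1 hxy).imp_right Or.inr
      · rw [hx31]
        exact ((n4 y hy).1 hxy).imp_right Or.inl)
    have h5 : ({x0, x1, x4} : Finset α).card ≤ 3 := Finset.card_le_three
    omega
  have h23 : x2 ≠ x3 := by
    intro h
    obtain ⟨y, hy, hy1, n2⟩ := hother x2 h2 x1 h1 (hsymm _ _ a12)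
    have hy4 : x4 = y := ((n2 x4 h4).1 (hsymm _ _ (h ▸ a43))).resolve_left h14.symm
    have := hclosed {x0, x1, x2, x4} (by simp [Finset.insert_subset_iff, h0, h1, h2, h4])
      (by simp) (by
      intro x hx y hy hxy
      simp only [Finset.mem_insert, Finset.mem_singleton] at hx ⊢
      rcases hx with rfl | rfl | rfl | rfl
      · exact ((n0 y hy).1 hxy).elim (fun h => Or.inr (Or.inl h))
            fun h => Or.inr (Or.inr (Or.inr h))
      · exact ((n1 y hy).1 hxy).imp_right fun h => Or.inr (Or.inl h)
      · rcases (n2 y hy).1 hxy with h' | h'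
        · exact Or.inr (Or.inl h')
        · exact Or.inr (Or.inr (Or.inr (h'.trans hy4.symm)))
      · rw [← h] at n4
        exact ((n4 y hy).1 hxy).imp_right fun h => Or.inr (Or.inl h))
    have h5 : ({x0, x1, x2, x4} : Finset α).card ≤ 4 := Finset.card_le_four
    omega
  have h13 : x1 ≠ x3 := by
    intro h
    have := (n1 x4 h4).1 (h ▸ hsymm _ _ a43)
    rcases this with h' | h'
    · exact hne a04 h'.symm
    · exact h24 h'.symm
  have hcard : ({x0, x1, x2, x3, x4} : Finset α).card = 5 := by
    rw [Finset.card_insert_of_notMem, Finset.card_insert_of_notMem, Finset.card_insert_of_notMem,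
      Finset.card_insert_of_notMem, Finset.card_singleton]
    · simpa using (hne a43).symm
    · simp [h23, h24]
    · simp [hne a12, h13, h14]
    · simp [hne a01, h20.symm, h30.symm, hne a04]
  have hFeq : {x0, x1, x2, x3, x4} = F := Finset.eq_of_subset_of_card_le
    (by simp [Finset.insert_subset_iff, h0, h1, h2, h3, h4]) (by omega)
  have a23 : A x2 x3 := by
    obtain ⟨y, hy, hy1, n2⟩ := hother x2 h2 x1 h1 (hsymm _ _ a12)
    have a2y : A x2 y := (n2 y hy).2 (Or.inr rfl)
    have hy' := hy
    rw [← hFeq] at hy'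
    simp only [Finset.mem_insert, Finset.mem_singleton] at hy'
    rcases hy' with rfl | rfl | rfl | rfl | rfl
    · rcases (n0 x2 h2).1 (hsymm _ _ a2y) with h | h
      · exact absurd h (hne a12).symm
      · exact absurd h h24
    · exact absurd rfl hy1
    · exact absurd a2y (hirr _)
    · exact a2y
    · rcases (n4 x2 h2).1 (hsymm _ _ a2y) with h | h
      · exact absurd h h20
      · exact absurd h h23
  refine ⟨![x0, x1, x2, x3, x4], ?_, ?_, ?_⟩
  · have := hne a43
    have := hne a12
    have := hne a01
    have := hne a04
    intro k l
    fin_cases k <;> fin_cases l <;> simp [*, Ne.symm, eq_comm] <;> intro h <;> simp_all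
  · intro v
    rw [← hFeq]
    simp [Fin.exists_fin_succ]
  · intro k
    fin_cases k
    · exact a01
    · exact a12
    · exact a23
    · exact hsymm _ _ a43
    · exact hsymm _ _ a04

end

/-! ### The induction that produces the packing. -/

section

variable {α β : Type*} [DecidableEq α] [DecidableEq β] {V : Finset α} {E : Finset β}
  {ends : β → Bool → α} {d : α}

theorem not_inner_of_loopless (hloop : ∀ e ∈ E, ends e true ≠ ends e false) {e : β} (he : e ∈ E)
    (b : Bool) : ends e b ≠ ends e (!b) := (other_end_ne (hloop e he) rfl).symm

/-- If all vertices of a tight set have degree five and no edge inside it is simple, then the set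
spans a doubled pentagon. -/
theorem hasPacking_of_parallel (hends : ∀ e ∈ E, ∀ b, ends e b ∈ V)
    (hcut : CutCondition d V E ends) (hloop : ∀ e ∈ E, ends e true ≠ ends e false)
    {X : α → Bool} (hXd : X d = false) (hX : cut E ends X = 5)
    (hX2 : ∀ x, ∃ y ∈ V, y ≠ x ∧ X y = true)
    (hdeg : ∀ x ∈ V, X x = true → cut E ends (fun v => decide (v = x)) = 5)
    (hpar : ∀ e ∈ E, ∀ b, X (ends e b) = true → X (ends e (!b)) = true →
      ∃ e' ∈ E, e' ≠ e ∧ ∃ b', ends e' b' = ends e b ∧ ends e' (!b') = ends e (!b))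
    (ih : ∀ V' : Finset α, V'.card < V.card → d ∈ V' → ∀ (E' : Finset β) (ends' : β → Bool → α),
      (∀ e ∈ E', ∀ b, ends' e b ∈ V') → CutCondition d V' E' ends' → HasPacking d V' E' ends')
    (hd : d ∈ V) : HasPacking d V E ends := by
  set F := V.filter fun v => X v = true with hFdef
  have hF : ∀ {x}, x ∈ F ↔ x ∈ V ∧ X x = true := Finset.mem_filter
  have hxd : ∀ {x}, x ∈ F → x ≠ d := by
    rintro x hx rfl
    simp [hF, hXd] at hx
  let m : α → α → Finset β := fun x y => E.filter fun e => ∃ b, ends e b = x ∧ ends e (!b) = y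
  have hm : ∀ {x y e}, e ∈ m x y ↔ e ∈ E ∧ ∃ b, ends e b = x ∧ ends e (!b) = y :=
    Finset.mem_filter
  have hm2 : ∀ x ∈ F, ∀ y ∈ F, x ≠ y → (m x y).card ≠ 0 → (m x y).card = 2 := by
    intro x hx y hy hxy h0
    have h1 := cut_pair hloop hxy
    rw [hdeg x (hF.1 hx).1 (hF.1 hx).2, hdeg y (hF.1 hy).1 (hF.1 hy).2] at h1
    -- If `x` and `y` are joined by `m` edges, then `10 - 2m` edges leave the pair, so `m` is at
    -- most two; `hpar` supplies the second edge.
    have h2 := hcut (fun v => decide (v = x) || decide (v = y))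
      (by simp [(hxd hx).symm, (hxd hy).symm]) ⟨x, (hF.1 hx).1, by simp⟩
    obtain ⟨e, he⟩ := Finset.card_pos.1 (Nat.pos_of_ne_zero h0)
    obtain ⟨heE, b, hb1, hb2⟩ := hm.1 he
    obtain ⟨e', he', hne, b', hb1', hb2'⟩ := hpar e heE b (by rw [hb1]; exact (hF.1 hx).2)
      (by rw [hb2]; exact (hF.1 hy).2)
    have h3 : 1 < (m x y).card := Finset.one_lt_card.2
      ⟨e', hm.2 ⟨he', b', hb1'.trans hb1, hb2'.trans hb2⟩, e, he, hne⟩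
    change 1 < (E.filter fun e => ∃ b, ends e b = x ∧ ends e (!b) = y).card at h3
    change (E.filter fun e => ∃ b, ends e b = x ∧ ends e (!b) = y).card = 2
    omega
  have hlocal : ∀ x ∈ F,
      (E.filter fun e => ∃ b, ends e b = x ∧ X (ends e (!b)) = false).card = 1 ∧
      ((F.erase x).filter fun y => (m x y).card ≠ 0).card = 2 := by
    intro x hx
    have h1 := cut_singleton_add hloop X x
    rw [hdeg x (hF.1 hx).1 (hF.1 hx).2] at h1
    have h2 := cut_remove hloop (hF.1 hx).2
    obtain ⟨y, hyV, hyx, hy⟩ := hX2 x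
    have h3 := hcut (fun v => X v && !decide (v = x)) (by simp [hXd]) ⟨y, hyV, by simp [hy, hyx]⟩
    have h4 : (E.filter fun e => ∃ b, ends e b = x ∧ X (ends e (!b)) = true) =
        (F.erase x).biUnion (m x) := by
      ext e
      simp only [Finset.mem_filter, Finset.mem_biUnion, hm, Finset.mem_erase, hF]
      constructor
      · rintro ⟨he, b, rfl, hb⟩
        exact ⟨_, ⟨(not_inner_of_loopless hloop he b).symm, hends e he _, hb⟩, he, b, rfl, rfl⟩
      · rintro ⟨y, ⟨-, -, hy⟩, he, b, h1, h2⟩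
        exact ⟨he, b, h1, h2 ▸ hy⟩
    have h5 : (E.filter fun e => ∃ b, ends e b = x ∧ X (ends e (!b)) = true).card =
        ((F.erase x).filter fun y => (m x y).card ≠ 0).card * 2 := by
      rw [h4, Finset.card_biUnion, ← Finset.sum_filter_ne_zero, Finset.sum_const_nat]
      · intro y hy
        rw [Finset.mem_filter, Finset.mem_erase] at hy
        exact hm2 x hx y hy.1.2 hy.1.1.symm hy.2
      · intro y _ y' _ hyy
        change Disjoint (m x y) (m x y')
        rw [Finset.disjoint_left]
        intro e he he'
        obtain ⟨heE, b, hb1, hb2⟩ := hm.1 he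
        obtain ⟨-, b', hb1', hb2'⟩ := hm.1 he'
        by_cases hb : b = b'
        · subst hb
          exact hyy (hb2.symm.trans hb2')
        · rw [Bool.not_eq_of_ne hb] at hb1
          exact not_inner_of_loopless hloop heE b' (hb1'.trans hb1.symm)
    -- Of the five edges at `x`, let `f` leave `X` and `g` stay inside. Removing `x` from `X` shows
    -- `g ≥ f`, and `g` is even because inner edges are doubled, so `g = 4` and `f = 1`.
    rw [hX] at h2
    omega
  obtain ⟨c, hc, hcF, hcA⟩ := exists_pentagon (F := F)
    (A := fun x y => ∃ e ∈ E, ∃ b, ends e b = x ∧ ends e (!b) = y) (by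
      -- Five edges leave `X`, one per vertex, so `X` has five vertices; the same count gives a
      -- proper component too small a cut.
      have h1 := cut_closed (E := E) (ends := ends) (p := X) (S := F) (fun v hv => (hF.1 hv).2)
        (fun e he b _ h => hF.2 ⟨hends e he _, h⟩)
      rw [Finset.sum_congr rfl fun x hx => (hlocal x hx).1] at h1
      rw [Finset.card_eq_sum_ones, ← h1, ← hX]
      exact cut_congr fun e he b => by simp [hF, hends e he b])
    (fun x y ⟨e, he, b, h1, h2⟩ => ⟨e, he, !b, h2, by simpa using h1⟩)
    (fun x ⟨e, he, b, h1, h2⟩ => not_inner_of_loopless hloop he b (h1.trans h2.symm))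
    (fun x hx => by
      obtain ⟨y, z, hyz, h⟩ := Finset.card_eq_two.1 (hlocal x hx).2
      have hmem : ∀ w, (w ∈ F.erase x ∧ (m x w).card ≠ 0) ↔ w = y ∨ w = z := fun w => by
        rw [← Finset.mem_filter (p := fun w => (m x w).card ≠ 0), h]
        simp
      refine ⟨y, z, hyz, Finset.mem_of_mem_erase ((hmem y).2 (Or.inl rfl)).1,
        Finset.mem_of_mem_erase ((hmem z).2 (Or.inr rfl)).1, fun w hw => ?_⟩
      rw [← hmem]
      constructor
      · rintro ⟨e, he, b, h1, h2⟩
        exact ⟨Finset.mem_erase.2 ⟨fun h => not_inner_of_loopless hloop he b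
          (h1.trans (h2.trans h).symm), hw⟩, Finset.card_ne_zero.2 ⟨e, hm.2 ⟨he, b, h1, h2⟩⟩⟩
      · rintro ⟨-, h⟩
        obtain ⟨e, he⟩ := Finset.card_ne_zero.1 h
        obtain ⟨he, hb⟩ := hm.1 he
        exact ⟨e, he, hb⟩)
    (fun S hSF ⟨x, hx⟩ hS => by
      have h1 := cut_closed (E := E) (ends := ends) (p := X) (S := S)
        (fun v hv => (hF.1 (hSF hv)).2)
        (fun e he b hb h => hS _ hb _ (hF.2 ⟨hends e he _, h⟩) ⟨e, he, b, rfl, rfl⟩)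
      rw [Finset.sum_congr rfl fun x hx => (hlocal x (hSF hx)).1,
        ← Finset.card_eq_sum_ones] at h1
      rw [← h1]
      exact hcut _ (by simpa using fun h => hxd (hSF h) rfl) ⟨x, (hF.1 (hSF hx)).1, by simpa⟩)
  have hcF' : ∀ k, c k ∈ F := fun k => (hcF _).2 ⟨k, rfl⟩
  have hedges : ∀ k, ∃ (q : Bool → β) (o : Bool → Bool), (∀ s, q s ∈ E) ∧ q true ≠ q false ∧
      (∀ s, ends (q s) (o s) = c k) ∧ ∀ s, ends (q s) (!(o s)) = c (k + 1) := by
    intro k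
    obtain ⟨e, he, b, h1, h2⟩ := hcA k
    obtain ⟨e', he', hne, b', h1', h2'⟩ := hpar e he b (by rw [h1]; exact (hF.1 (hcF' _)).2)
      (by rw [h2]; exact (hF.1 (hcF' _)).2)
    refine ⟨fun s => if s then e' else e, fun s => if s then b' else b, ?_, hne, ?_, ?_⟩ <;>
      rintro (_ | _)
    · exact he
    · exact he'
    · exact h1
    · exact h1'.trans h1
    · exact h2
    · exact h2'.trans h2
  choose q o hqE hqne hq1 hq2 using hedges
  refine hasPacking_of_pentagon hends hcut hc (fun k => (hF.1 (hcF' k)).1) (fun k => hxd (hcF' k))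
    hqE hqne hq1 hq2 ?_ (fun E' ends' h1 h2 => ih _ ?_ ?_ E' ends' h1 h2)
  · intro e he e' he' b b' k h1 h1' h2 h2'
    have hout : ∀ e ∈ E, ∀ b, ends e b = c k → (∀ l, ends e (!b) ≠ c l) →
        e ∈ E.filter fun e => ∃ b, ends e b = c k ∧ X (ends e (!b)) = false := by
      intro e he b h1 h2
      refine Finset.mem_filter.2 ⟨he, b, h1, ?_⟩
      by_contra h
      obtain ⟨l, hl⟩ := (hcF _).1 (hF.2 ⟨hends e he (!b), by simpa using h⟩)
      exact h2 l hl
    exact Finset.card_le_one.1 (hlocal _ (hcF' k)).1.le _ (hout e he b h1 h2) _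
      (hout e' he' b' h1' h2')
  · refine Finset.card_lt_card ⟨Finset.filter_subset _ _, fun h => ?_⟩
    exact (Finset.mem_filter.1 (h (hF.1 (hcF' 1)).1)).2 1 (by decide) rfl
  · exact Finset.mem_filter.2 ⟨hd, fun k _ h => hxd (hcF' k) h.symm⟩

theorem CutCondition.exists_tight {e : β} (hcut : CutCondition d V E ends) (he : e ∈ E)
    (h : ¬CutCondition d V (E.erase e) ends) : ∃ p : α → Bool, p d = false ∧
      (∃ v ∈ V, p v = true) ∧ cut E ends p = 5 ∧ p (ends e true) ≠ p (ends e false) := by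
  simp only [CutCondition, not_forall] at h
  obtain ⟨p, hpd, hp, hlt⟩ := h
  have h5 := hcut p hpd hp
  have h6 := cut_erase he ends p
  split_ifs at h6 with hpe
  · omega
  · exact ⟨p, hpd, hp, by omega, hpe⟩

theorem crossing_eq {p : α → Bool} {e : β} (h : p (ends e true) ≠ p (ends e false)) (b : Bool) :
    p (ends e (!b)) = !p (ends e b) := by
  cases b
  · exact Bool.not_eq_of_ne h
  · exact Bool.not_eq_of_ne h.symm

/-- A graph in which every nonempty set of vertices avoiding `d` is left by at least five edges has
a packing of five spanning in-trees rooted at `d`. -/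
theorem hasPacking [Nonempty β] (V : Finset α) (hd : d ∈ V) (E : Finset β) (ends : β → Bool → α)
    (hends : ∀ e ∈ E, ∀ b, ends e b ∈ V) (hcut : CutCondition d V E ends) :
    HasPacking d V E ends := by
  -- The inner induction on the number of edges serves only the deletion of redundant edges; every
  -- other reduction loses vertices.
  induction hn : V.card using Nat.strong_induction_on generalizing V E ends with
  | _ n ihV =>
  induction hk : E.card using Nat.strong_induction_on generalizing E with
  | _ k ihE =>
  subst hn hk
  have ih : ∀ V' : Finset α, V'.card < V.card → d ∈ V' →
      ∀ (E' : Finset β) (ends' : β → Bool → α), (∀ e ∈ E', ∀ b, ends' e b ∈ V') →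
      CutCondition d V' E' ends' → HasPacking d V' E' ends' :=
    fun V' hV' hd' E' ends' h1 h2 => ihV _ hV' V' hd' E' ends' h1 h2 rfl
  by_cases hdel : ∃ e ∈ E, CutCondition d V (E.erase e) ends
  · obtain ⟨e, he, hce⟩ := hdel
    obtain ⟨t, h, hT⟩ := ihE _ (Finset.card_erase_lt_of_mem he) (E.erase e)
      (fun e' h => hends e' (Finset.mem_of_mem_erase h)) hce rfl
    exact ⟨t, h, { hT with mem := fun i v hv hvd => Finset.mem_of_mem_erase (hT.mem i v hv hvd) }⟩
  push Not at hdel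
  have htight : ∀ e ∈ E, ∃ p : α → Bool, p d = false ∧ (∃ v ∈ V, p v = true) ∧
      cut E ends p = 5 ∧ p (ends e true) ≠ p (ends e false) := fun e he =>
    hcut.exists_tight he (hdel e he)
  have hloop : ∀ e ∈ E, ends e true ≠ ends e false := fun e he h => by
    obtain ⟨p, -, -, -, hp⟩ := htight e he
    exact hp (by rw [h])
  by_cases hV : ∃ v ∈ V, v ≠ d
  swap
  · push Not at hV
    have : ∀ v ∈ (V : Set α), v ≠ d → False := fun v hv hvd => hvd (hV v hv)
    exact ⟨fun _ _ => (Classical.arbitrary β, true), fun _ _ => 0,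
      fun _ v hv hvd => (this v hv hvd).elim, fun _ v hv hvd => (this v hv hvd).elim,
      fun _ v hv hvd => (this v hv hvd).elim, fun _ v hv hvd => (this v hv hvd).elim,
      fun _ _ v _ hv _ hvd => (this v hv hvd).elim, fun _ v _ _ hv _ hvd => (this v hv hvd).elim⟩
  have hdegree : ∀ (p : α → Bool) (z : α), (∀ v ∈ V, p v = true ↔ v = z) →
      cut E ends (fun v => decide (v = z)) = cut E ends p := fun p z hp =>
    cut_congr fun e he b => by
      rw [Bool.eq_iff_iff, hp _ (hends e he b), decide_eq_true_iff]
  have ihz : ∀ z ∈ V, z ≠ d → ∀ (E' : Finset β) (ends' : β → Bool → α),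
      (∀ e ∈ E', ∀ b, ends' e b ∈ V.erase z) → CutCondition d (V.erase z) E' ends' →
      HasPacking d (V.erase z) E' ends' := fun z hz hzd =>
    ih _ (Finset.card_erase_lt_of_mem hz) (Finset.mem_erase.2 ⟨hzd.symm, hd⟩)
  -- If all tight sets are single vertices, consider an edge at `d`: a tight set that it crosses
  -- avoids `d`, hence consists of the other end, which therefore has degree five.
  by_cases hbig : ∃ X : α → Bool, X d = false ∧ cut E ends X = 5 ∧
      ∃ x ∈ V, ∃ y ∈ V, x ≠ y ∧ X x = true ∧ X y = true
  swap
  · obtain ⟨v, hv, hvd⟩ := hV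
    have h5 := hcut (fun v => !decide (v = d)) (by simp) ⟨v, hv, by simp [hvd]⟩
    obtain ⟨e, he, hne⟩ : ∃ e ∈ E, (if (!decide (ends e true = d)) = !decide (ends e false = d)
        then 0 else 1) ≠ 0 := Finset.exists_ne_zero_of_sum_ne_zero (by
      intro h0
      rw [cut, h0] at h5
      omega)
    obtain ⟨b, hb1, hb2⟩ : ∃ b, ends e b ≠ d ∧ ends e (!b) = d := by
      by_cases h1 : ends e true = d
      · refine ⟨false, fun h2 => ?_, h1⟩
        simp [h1, h2] at hne
      · refine ⟨true, h1, ?_⟩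
        by_contra h2
        rw [Bool.not_true] at h2
        simp [h1, h2] at hne
    have hsingle : ∀ p : α → Bool, p d = false → cut E ends p = 5 →
        p (ends e true) ≠ p (ends e false) → ∀ v ∈ V, p v = true ↔ v = ends e b := by
      intro p hpd hp hpe v hv
      have hpz : p (ends e b) = true := by
        have := crossing_eq hpe b
        rw [hb2, hpd] at this
        simpa using this.symm
      constructor
      · intro h
        by_contra hne
        exact hbig ⟨p, hpd, hp, v, hv, ends e b, hends e he b, hne, h, hpz⟩
      · rintro rfl
        exact hpz
    obtain ⟨p, hpd, -, hp, hpe⟩ := htight e he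
    refine hasPacking_of_split hends hcut hloop (hends e he b) hb1
      ((hdegree p _ (hsingle p hpd hp hpe)).trans hp) he rfl ?_ (ihz _ (hends e he b) hb1)
    intro p hpd ⟨v, hv, hvz, hpv⟩ hpe
    have h5 := hcut p hpd ⟨v, hv, hpv⟩
    by_contra hlt
    exact hvz ((hsingle p hpd (by omega) hpe v hv).1 hpv)
  obtain ⟨X, ⟨hXd, hX, x, hxV, y, hyV, hxy, hXx, hXy⟩, hmin⟩ :=
    (measure fun X : α → Bool => (V.filter fun v => X v = true).card).wf.has_min
      {X | X d = false ∧ cut E ends X = 5 ∧ ∃ x ∈ V, ∃ y ∈ V, x ≠ y ∧ X x = true ∧ X y = true}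
      hbig
  by_contra hno
  have hXV : ∀ v, X v = true → v ≠ d := by
    rintro v hv rfl
    rw [hXd] at hv
    simp at hv
  have hsingle : ∀ e ∈ E, ∀ b, X (ends e b) = true → X (ends e (!b)) = true → ∀ p : α → Bool,
      p d = false → cut E ends p = 5 → p (ends e b) = true → p (ends e (!b)) = false →
      ∀ v ∈ V, p v = true ↔ v = ends e b := by
    intro e he b hX1 hX2 p hpd hp hp1 hp2 v hv
    refine ⟨fun hpv => ?_, fun h => h ▸ hp1⟩
    by_contra hne
    -- A tight set reaching outside `X` would cross `X`; one inside `X` with a second vertex would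
    -- contradict minimality.
    by_cases hsub : ∃ w ∈ V, p w = true ∧ X w = false
    · exact not_crossing hcut hXd hpd hX hp ⟨_, hends e he b, hX1, hp1⟩
        ⟨_, hends e he (!b), hX2, hp2⟩ hsub
    · push Not at hsub
      refine hmin p ⟨hpd, hp, v, hv, _, hends e he b, hne, hpv, hp1⟩ ?_
      refine Finset.card_lt_card ⟨fun w hw => ?_, fun h => ?_⟩
      · rw [Finset.mem_filter] at hw ⊢
        exact ⟨hw.1, by simpa using hsub w hw.1 hw.2⟩
      · have := (Finset.mem_filter.1 (h (Finset.mem_filter.2 ⟨hends e he (!b), hX2⟩))).2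
        rw [hp2] at this
        simp at this
  have hcross : ∀ e ∈ E, ∀ b, X (ends e b) = true → X (ends e (!b)) = true → ∀ p : α → Bool,
      p d = false → cut E ends p = 5 → p (ends e true) ≠ p (ends e false) →
      (∀ v ∈ V, p v = true ↔ v = ends e b) ∨ ∀ v ∈ V, p v = true ↔ v = ends e (!b) := by
    intro e he b hX1 hX2 p hpd hp hpe
    have h1 := crossing_eq hpe b
    rcases Bool.eq_false_or_eq_true (p (ends e b)) with h | h
    · exact Or.inl (hsingle e he b hX1 hX2 p hpd hp h (by rw [h1, h]; rfl))
    · exact Or.inr (hsingle e he (!b) hX2 (by simpa using hX1) p hpd hp (by rw [h1, h]; rfl)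
        (by simpa using h))
  -- If the other end had a different degree, the only tight set crossed by `e` would be the end of
  -- degree five, and the reduction at that vertex would apply.
  have hdeg' : ∀ e ∈ E, ∀ b, X (ends e b) = true → X (ends e (!b)) = true →
      cut E ends (fun v => decide (v = ends e b)) = 5 →
      cut E ends (fun v => decide (v = ends e (!b))) = 5 := by
    intro e he b hX1 hX2 h5
    by_contra hne
    refine hno (hasPacking_of_split hends hcut hloop (hends e he b) (hXV _ hX1) h5 he rfl ?_
      (ihz _ (hends e he b) (hXV _ hX1)))
    intro p hpd ⟨v, hv, hvz, hpv⟩ hpe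
    have h5 := hcut p hpd ⟨v, hv, hpv⟩
    by_contra hlt
    rcases hcross e he b hX1 hX2 p hpd (by omega) hpe with h | h
    · exact hvz ((h v hv).1 hpv)
    · rw [hdegree p _ h] at hne
      omega
  have hdeg : ∀ e ∈ E, ∀ b, X (ends e b) = true → X (ends e (!b)) = true →
      cut E ends (fun v => decide (v = ends e b)) = 5 := by
    intro e he b hX1 hX2
    obtain ⟨p, hpd, -, hp, hpe⟩ := htight e he
    rcases hcross e he b hX1 hX2 p hpd hp hpe with h | h
    · rw [hdegree p _ h, hp]
    · have := hdeg' e he (!b) hX2 (by simpa using hX1) ((hdegree p _ h).trans hp)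
      simpa using this
  refine hno (hasPacking_of_parallel hends hcut hloop hXd hX (fun w => ?_) (fun w hw hXw => ?_) ?_
    ih hd)
  · by_cases hwx : x = w
    · exact ⟨y, hyV, hwx ▸ hxy.symm, hXy⟩
    · exact ⟨x, hxV, hwx, hXx⟩
  -- A vertex of `X` with no edge inside `X` would send at least five edges out, and removing it
  -- would push the cut below five.
  · by_contra hne
    have h1 := cut_remove hloop hXw
    have h2 := cut_singleton_add hloop X w
    have h3 : (E.filter fun e => ∃ b, ends e b = w ∧ X (ends e (!b)) = true).card = 0 := by
      rw [Finset.card_eq_zero, Finset.filter_eq_empty_iff]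
      rintro e he ⟨b, rfl, hb⟩
      exact hne (hdeg e he b hXw hb)
    obtain ⟨u, huV, huw, hXu⟩ : ∃ u ∈ V, u ≠ w ∧ X u = true := by
      by_cases hwx : x = w
      · exact ⟨y, hyV, hwx ▸ hxy.symm, hXy⟩
      · exact ⟨x, hxV, hwx, hXx⟩
    have h4 := hcut (fun v => X v && !decide (v = w)) (by simp [hXd]) ⟨u, huV, by simp [huw, hXu]⟩
    have h5 := hcut (fun v => decide (v = w)) (by simpa using (hXV w hXw).symm) ⟨w, hw, by simp⟩
    omega
  · intro e he b hX1 hX2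
    by_contra! hcon
    have hzz := not_inner_of_loopless hloop he b
    refine hno (hasPacking_of_split_pair hends hcut hloop (hends e he b) (hends e he (!b))
      (hXV _ hX1) (hXV _ hX2) hzz (hdeg e he b hX1 hX2)
      (hdeg e he (!b) hX2 (by simpa using hX1)) he rfl rfl (fun e' he' hne b' h1 h2 =>
        hcon e' he' hne b' h1 h2) ?_ ?_)
    · intro p hpd ⟨v, hv, hvz, hpv⟩ ⟨w, hw, hpw⟩ hpe
      have h5 := hcut p hpd ⟨v, hv, hpv⟩
      by_contra hlt
      rcases hcross e he b hX1 hX2 p hpd (by omega) hpe with h | h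
      · exact hvz ((h v hv).1 hpv)
      · exact hpw (h w hw)
    · refine ih _ ?_ ?_
      · exact (Finset.card_erase_le).trans_lt (Finset.card_erase_lt_of_mem (hends e he b))
      · exact Finset.mem_erase.2 ⟨(hXV _ hX2).symm, Finset.mem_erase.2 ⟨(hXV _ hX1).symm, hd⟩⟩

end

/-! ### From packings to spanning arborescences. -/

section

variable {α β : Type*} {G : Graph α β} {d : α}

/-- `T` consists of exactly one arc out of every vertex other than `d`, and the height `h`
decreases along the arcs. -/
structure IsHeightTree (G : Graph α β) (d : α) (T : Set (Arc α β)) (h : α → ℕ) : Prop where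
  subset_arcs : T ⊆ arcs G
  out_unique : ∀ a ∈ T, ∀ b ∈ T, a.tail = b.tail → a = b
  exists_out : ∀ v ∈ V(G), v ≠ d → ∃ a ∈ T, a.tail = v
  tail_ne : ∀ a ∈ T, a.tail ≠ d
  lt : ∀ a ∈ T, h a.head < h a.tail

namespace IsHeightTree

variable {T : Set (Arc α β)} {h : α → ℕ}

theorem head_mem (hT : IsHeightTree G d T h) {a : Arc α β} (ha : a ∈ T) : a.head ∈ V(G) :=
  (hT.subset_arcs ha).right_mem

theorem exists_diwalk (hT : IsHeightTree G d T h) (v : α) (hv : v ∈ V(G)) :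
    ∃ p, IsDiwalk T v p d := by
  induction hn : h v using Nat.strong_induction_on generalizing v with
  | _ n ih =>
  by_cases hvd : v = d
  · exact ⟨[], hvd ▸ .nil v⟩
  · obtain ⟨a, ha, rfl⟩ := hT.exists_out v hv hvd
    obtain ⟨p, hp⟩ := ih _ (hn ▸ hT.lt a ha) a.head (hT.head_mem ha) rfl
    exact ⟨a :: p, .cons ha hp⟩

theorem diwalk_unique (hT : IsHeightTree G d T h) {v : α} {p q : List (Arc α β)}
    (hp : IsDiwalk T v p d) (hq : IsDiwalk T v q d) : p = q := by
  generalize hd : d = y at hp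
  induction hp generalizing q with
  | nil x =>
    subst hd
    generalize hx : d = x at hq
    cases hq with
    | nil => rfl
    | cons ha _ => exact (hT.tail_ne _ ha hx.symm).elim
  | @cons a p y ha _ ih =>
    subst hd
    generalize hx : a.tail = x at hq
    cases hq with
    | nil => exact (hT.tail_ne a ha hx).elim
    | @cons b q _ hb hq =>
      obtain rfl := hT.out_unique a ha b hb hx
      rw [ih hq rfl]

theorem isSpanningArborescence (hT : IsHeightTree G d T h) (hd : d ∈ V(G)) :
    IsSpanningArborescence G d T where
  root_mem := hd
  subset_arcs := hT.subset_arcs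
  no_out_iff v hv := by
    constructor
    · intro h
      by_contra hvd
      obtain ⟨a, ha, rfl⟩ := hT.exists_out v hv hvd
      exact h a ha rfl
    · rintro rfl a ha
      exact hT.tail_ne a ha
  unique_path v hv _ := by
    obtain ⟨p, hp⟩ := hT.exists_diwalk v hv
    exact ⟨p, hp, fun q hq => hT.diwalk_unique hq hp⟩

end IsHeightTree

theorem IsDiwalk.subset {A : Set (Arc α β)} {x y : α} {p : List (Arc α β)}
    (h : IsDiwalk A x p y) : ∀ a ∈ p, a ∈ A := by
  induction h with
  | nil => simp
  | cons ha _ ih =>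
    intro b hb
    rcases List.mem_cons.1 hb with rfl | hb
    exacts [ha, ih b hb]

theorem IsDiwalk.exists_crossing {A : Set (Arc α β)} {x y : α} {p : List (Arc α β)}
    (h : IsDiwalk A x p y) (q : α → Bool) (hx : q x = true) (hy : q y = false) :
    ∃ a ∈ p, q a.tail ≠ q a.head := by
  induction h with
  | nil => simp [hx] at hy
  | @cons a p y ha _ ih =>
    by_cases h : q a.head = true
    · obtain ⟨b, hb, hq⟩ := ih h hy
      exact ⟨b, List.mem_cons_of_mem _ hb, hq⟩
    · exact ⟨a, List.mem_cons_self, fun h' => h (h' ▸ hx)⟩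

/-- The easy half of Menger's theorem: each of five edge-disjoint paths from the set to `d`
contributes its own crossing edge. -/
theorem IsEdgeConnected.cutCondition (hG : IsEdgeConnected G 5) {V : Finset α} {E : Finset β}
    (hV : ∀ v, v ∈ V ↔ v ∈ V(G)) (hE : ∀ e, e ∈ E ↔ e ∈ E(G)) {ends : β → Bool → α}
    (hends : ∀ e ∈ E(G), G.IsLink e (ends e true) (ends e false)) (hd : d ∈ V(G)) :
    CutCondition d V E ends := by
  classical
  rintro q hqd ⟨v, hv, hqv⟩
  have hvd : v ≠ d := by
    rintro rfl
    simp [hqv] at hqd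
  obtain ⟨p, hp, hdisj⟩ := hG v ((hV v).1 hv) d hd hvd
  choose a ha hqa using fun i => (hp i).1.exists_crossing q hqv hqd
  have hinj : Function.Injective fun i => (a i).edge := by
    intro i j hij
    by_contra hne
    exact hdisj i j hne _ (ha i) _ (ha j) hij
  have hcard : (Finset.univ.map ⟨_, hinj⟩).card = 5 := by simp
  rw [← hcard, cut]
  have hsum : (∑ e ∈ E, if q (ends e true) = q (ends e false) then 0 else 1) =
      (E.filter fun e => q (ends e true) ≠ q (ends e false)).card := by
    rw [Finset.card_filter]
    exact Finset.sum_congr rfl fun e _ => by simp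
  rw [hsum]
  refine Finset.card_le_card fun e he => ?_
  obtain ⟨i, -, rfl⟩ := Finset.mem_map.1 he
  have hlink : G.IsLink (a i).edge (a i).tail (a i).head := (hp i).1.subset _ (ha i)
  refine Finset.mem_filter.2 ⟨(hE _).2 hlink.edge_mem, ?_⟩
  rcases (hends _ hlink.edge_mem).eq_and_eq_or_eq_and_eq hlink with ⟨h1, h2⟩ | ⟨h1, h2⟩
  · simpa only [Function.Embedding.coeFn_mk, h1, h2] using hqa i
  · simpa only [Function.Embedding.coeFn_mk, h1, h2] using (hqa i).symm

/-- A 5-edge-connected graph has five arc-disjoint spanning in-trees rooted at `d` such that the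
trees `0, 2` and `1, 3` are edge-disjoint. -/
theorem IsEdgeConnected.exists_trees (hV : V(G).Finite) (hE : E(G).Finite)
    (hG : IsEdgeConnected G 5) (hd : d ∈ V(G)) :
    ∃ (T : Fin 5 → Set (Arc α β)) (h : Fin 5 → α → ℕ), (∀ i, IsHeightTree G d (T i) (h i)) ∧
      (∀ i j, i ≠ j → Disjoint (T i) (T j)) ∧
      ∀ i, mate i ≠ i → ∀ a ∈ T i, ∀ b ∈ T (mate i), a.edge ≠ b.edge := by
  classical
  cases isEmpty_or_nonempty β with
  | inl hβ =>
    -- Without edges, connectivity leaves no vertex besides `d`, so empty trees suffice.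
    refine ⟨fun _ => ∅, fun _ _ => 0, fun _ => ⟨by simp, by simp, fun v hv hvd => ?_, by simp,
      by simp⟩, by simp, by simp⟩
    obtain ⟨p, hp, -⟩ := hG v hv d hd hvd
    generalize p 0 = q, hp 0 = hq at *
    cases hq.1 with
    | nil => exact (hvd rfl).elim
    | @cons a => exact (hβ.false a.edge).elim
  | inr hβ =>
    have hex : ∀ e, ∃ f : Bool → α, e ∈ E(G) → G.IsLink e (f true) (f false) := by
      intro e
      by_cases he : e ∈ E(G)
      · obtain ⟨x, y, hxy⟩ := Graph.exists_isLink_of_mem_edgeSet he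
        exact ⟨fun b => if b then x else y, fun _ => hxy⟩
      · exact ⟨fun _ => d, fun h => (he h).elim⟩
    choose ends hends using hex
    have hlink : ∀ e ∈ E(G), ∀ b, G.IsLink e (ends e b) (ends e (!b)) := by
      rintro e he (_ | _)
      exacts [(hends e he).symm, hends e he]
    obtain ⟨t, h, ht⟩ := hasPacking hV.toFinset (hV.mem_toFinset.2 hd) hE.toFinset ends
      (fun e he b => hV.mem_toFinset.2 (hlink e (hE.mem_toFinset.1 he) b).left_mem)
      (hG.cutCondition (fun _ => hV.mem_toFinset) (fun _ => hE.mem_toFinset) hends hd)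
    have hmem : ∀ v, v ∈ (hV.toFinset : Set α) ↔ v ∈ V(G) := by simp
    have htE : ∀ i v, v ∈ V(G) → v ≠ d → (t i v).1 ∈ E(G) := fun i v hv hvd =>
      hE.mem_toFinset.1 (ht.mem i v ((hmem v).2 hv) hvd)
    have htail : ∀ i v, v ∈ V(G) → v ≠ d → ends (t i v).1 (t i v).2 = v := fun i v hv hvd =>
      ht.tail i v ((hmem v).2 hv) hvd
    let T : Fin 5 → Set (Arc α β) := fun i => {a | a.tail ∈ V(G) ∧ a.tail ≠ d ∧
      a = ⟨(t i a.tail).1, a.tail, ends (t i a.tail).1 (!(t i a.tail).2)⟩}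
    have hT : ∀ {i a}, a ∈ T i → a.tail ∈ V(G) ∧ a.tail ≠ d ∧
      a = ⟨(t i a.tail).1, a.tail, ends (t i a.tail).1 (!(t i a.tail).2)⟩ := fun h => h
    refine ⟨T, h, fun i => ⟨?_, ?_, ?_, ?_, ?_⟩, ?_, ?_⟩
    · rintro ⟨e, u, w⟩ ha
      obtain ⟨hv, hvd, heq⟩ := hT ha
      rw [heq]
      have := hlink _ (htE i _ hv hvd) (t i u).2
      rw [htail i _ hv hvd] at this
      exact this
    · rintro a ha b hb hab
      rw [(hT ha).2.2, (hT hb).2.2, hab]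
    · exact fun v hv hvd =>
        ⟨⟨(t i v).1, v, ends (t i v).1 (!(t i v).2)⟩, ⟨hv, hvd, rfl⟩, rfl⟩
    · exact fun a ha => (hT ha).2.1
    · rintro ⟨e, u, w⟩ ha
      obtain ⟨hv, hvd, heq⟩ := hT ha
      rw [heq]
      exact ht.lt i u ((hmem u).2 hv) hvd
    · intro i j hij
      rw [Set.disjoint_left]
      rintro ⟨e, u, w⟩ ha hb
      obtain ⟨hv, hvd, heq⟩ := hT ha
      obtain ⟨-, -, heq'⟩ := hT hb
      simp only [Arc.mk.injEq, true_and] at heq heq'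
      have h1 := htail i u hv hvd
      have h2 := htail j u hv hvd
      have hlt := ht.lt i u ((hmem u).2 hv) hvd
      refine ht.ne i j u hij ((hmem u).2 hv) ((hmem u).2 hv) hvd
        (Prod.ext (heq.1.symm.trans heq'.1) ?_)
      by_contra hne
      rw [← heq.1] at h1 hlt
      rw [← heq'.1] at h2
      rw [Bool.not_eq_of_ne hne, Bool.not_not, h2] at hlt
      exact hlt.false
    · rintro i hi ⟨e, u, w⟩ ha ⟨e', u', w'⟩ hb
      obtain ⟨hv, hvd, heq⟩ := hT ha
      obtain ⟨hv', hvd', heq'⟩ := hT hb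
      rw [heq, heq']
      exact ht.edge_ne i u u' hi ((hmem _).2 hv) ((hmem _).2 hv') hvd hvd'

end

/-! ### Following trees, routing functions, and the bound on hits. -/

section

variable {α β ι : Type*} {G : Graph α β} {d : α}

/-- The trees of the scheme are pairwise arc-disjoint spanning in-trees with heights `h`. -/
structure TreeScheme.IsPacking (S : TreeScheme α β ι) (G : Graph α β) (d : α) (h : ι → α → ℕ) :
    Prop where
  isHeightTree : ∀ i, IsHeightTree G d (S.tree i) (h i)
  disjoint : ∀ i j, i ≠ j → Disjoint (S.tree i) (S.tree j)

/-- A packet at `v` that starts to follow the tree `i` reaches `d` after `n` switches of tree. -/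
inductive TreeScheme.Reaches (S : TreeScheme α β ι) (d : α) (F : Set β) : ℕ → α → ι → Prop
  | root (i : ι) : Reaches S d F 0 d i
  | forward {n : ℕ} {a : Arc α β} {i : ι} :
      a ∈ S.tree i → a.edge ∉ F → Reaches S d F n a.head i → Reaches S d F n a.tail i
  | switch {n : ℕ} {a : Arc α β} {i : ι} :
      a ∈ S.tree i → a.edge ∈ F → Reaches S d F n a.tail (S.reroute a.tail i) →
      Reaches S d F (n + 1) a.tail i

namespace TreeScheme

variable {S : TreeScheme α β ι} {h : ι → α → ℕ} {F : Set β}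

theorem Trajectory.reflTransGen {s v : α} {n : ℕ} {inc : Option β}
    (ht : S.Trajectory G d F s n v inc) :
    Relation.ReflTransGen (Step G d S.routing F) (s, none) (v, inc) := by
  induction ht with
  | start => exact .refl
  | hop _ hstep _ _ ih => exact ih.tail hstep

theorem DeliversWith.delivers {s : α} {n : ℕ} (hs : S.DeliversWith G d F s n) :
    Delivers G d S.routing F s :=
  let ⟨inc, ht⟩ := hs
  ⟨inc, ht.reflTransGen⟩

namespace IsPacking

theorem mem_activeAt (hS : S.IsPacking G d h) {a : Arc α β} {i : ι} (ha : a ∈ S.tree i) :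
    a.edge ∈ activeAt G F a.tail ↔ a.edge ∉ F :=
  and_iff_right ((hS.isHeightTree i).subset_arcs ha).inc_left

theorem eq_of_mem (hS : S.IsPacking G d h) {a : Arc α β} {i j : ι} (hi : a ∈ S.tree i)
    (hj : a ∈ S.tree j) : i = j := by
  by_contra hne
  exact Set.disjoint_left.1 (hS.disjoint i j hne) hi hj

/-- Two arcs of different trees over the same edge are reverse to each other. -/
theorem reverse_of_edge_eq (hS : S.IsPacking G d h) {a b : Arc α β} {i j : ι} (hij : i ≠ j)
    (ha : a ∈ S.tree i) (hb : b ∈ S.tree j) (hab : a.edge = b.edge) :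
    a.tail = b.head ∧ a.head = b.tail := by
  have h1 : G.IsLink a.edge a.tail a.head := (hS.isHeightTree i).subset_arcs ha
  have h2 : G.IsLink b.edge b.tail b.head := (hS.isHeightTree j).subset_arcs hb
  rw [← hab] at h2
  rcases h1.eq_and_eq_or_eq_and_eq h2 with h | h
  · obtain ⟨e, u, w⟩ := a
    obtain ⟨e', u', w'⟩ := b
    obtain ⟨rfl, rfl⟩ := h
    obtain rfl : e = e' := hab
    exact (hij (hS.eq_of_mem ha hb)).elim
  · exact h

/-- Over the same edge, `b` would be the reverse of `a`, and its head `a.tail` would lie strictly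
below its tail. Hence two consecutive hits concern different edges. -/
theorem edge_ne_of_le (hS : S.IsPacking G d h) {a b : Arc α β} {i j : ι} (hij : i ≠ j)
    (ha : a ∈ S.tree i) (hb : b ∈ S.tree j) (hle : h j b.tail ≤ h j a.tail) :
    a.edge ≠ b.edge := by
  intro hab
  have h1 := (hS.isHeightTree j).lt b hb
  rw [← (hS.reverse_of_edge_eq hij ha hb hab).1] at h1
  omega

/-- The incoming edge and the current vertex determine the arc, and arc-disjointness determines its
tree. This is how a static routing function knows the tree being followed. -/
theorem arrives_unique (hS : S.IsPacking G d h) {v : α} {inc : Option β} {i j : ι}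
    (hi : S.Arrives v inc i) (hj : S.Arrives v inc j) : i = j := by
  cases inc with
  | none => exact Eq.trans hi (Eq.symm hj)
  | some e =>
    obtain ⟨u, hu⟩ := hi
    obtain ⟨w, hw⟩ := hj
    have h1 : G.IsLink e u v := (hS.isHeightTree i).subset_arcs hu
    have h2 : G.IsLink e w v := (hS.isHeightTree j).subset_arcs hw
    obtain rfl := h1.left_unique h2
    exact hS.eq_of_mem hu hw

theorem selects_unique (hS : S.IsPacking G d h) {v : α} {act : Set β} {i : ι} {n n' : ℕ}
    {e e' : β} (h1 : S.Selects v act i n e) (h2 : S.Selects v act i n' e') : e = e' := by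
  induction h1 generalizing n' with
  | @forward i a ha hav hact =>
    cases h2 with
    | forward hb hbv =>
      rw [(hS.isHeightTree i).out_unique _ ha _ hb (hav.trans hbv.symm)]
    | switch hb hbv hbact =>
      rw [(hS.isHeightTree i).out_unique _ ha _ hb (hav.trans hbv.symm)] at hact
      exact (hbact hact).elim
  | @switch i a n e ha hav hact _ ih =>
    cases h2 with
    | forward hb hbv hbact =>
      rw [(hS.isHeightTree i).out_unique _ ha _ hb (hav.trans hbv.symm)] at hact
      exact (hact hbact).elim
    | switch _ _ _ hs => exact ih hs

theorem routing_eq (hS : S.IsPacking G d h) {v : α} {act : Set β} {inc : Option β} {i : ι} {n : ℕ}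
    {e : β} (ha : S.Arrives v inc i) (hs : S.Selects v act i n e) :
    S.routing v act inc = some e := by
  have hex : ∃ e i n, S.Arrives v inc i ∧ S.Selects v act i n e := ⟨e, i, n, ha, hs⟩
  rw [routing, dif_pos hex]
  obtain ⟨j, m, ha', hs'⟩ := hex.choose_spec
  obtain rfl := hS.arrives_unique ha ha'
  rw [hS.selects_unique hs hs']

/-- Several switches may occur at one vertex, while the routing function sees only the tree `j` of
arrival. The induction therefore carries the `k` pending switches at `v` that lead from `j` to `i`;
a hop turns them into part of the count. -/
theorem exists_trajectory (hS : S.IsPacking G d h) {v : α} {n : ℕ} {i : ι}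
    (hr : S.Reaches d F n v i) {s : α} {m k : ℕ} {inc : Option β} {j : ι}
    (ht : S.Trajectory G d F s m v inc) (ha : S.Arrives v inc j)
    (hsel : ∀ n e, S.Selects v (activeAt G F v) i n e →
      S.Selects v (activeAt G F v) j (k + n) e) (hk : v = d → k = 0) :
    S.DeliversWith G d F s (m + k + n) := by
  induction hr generalizing m k inc j with
  | root =>
    obtain rfl := hk rfl
    exact ⟨inc, ht⟩
  | @forward n a i hai haF _ ih =>
    have hact := (hS.mem_activeAt hai).2 haF
    have hs := hsel 0 a.edge (.forward hai rfl hact)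
    have ha' : S.Arrives a.head (some a.edge) i := ⟨a.tail, hai⟩
    exact ih (k := 0) (ht.hop (.hop ((hS.isHeightTree i).tail_ne a hai) (hS.routing_eq ha hs) hact
      ((hS.isHeightTree i).subset_arcs hai)) ha hs) ha' (fun n e hn => by rwa [zero_add])
      fun _ => rfl
  | @switch n a i hai haF _ ih =>
    have hact := fun h => (hS.mem_activeAt hai).1 h haF
    have := ih (k := k + 1) ht ha (fun n e hn => by
      have := hsel (n + 1) e (.switch hai rfl hact hn)
      rwa [add_assoc, add_comm 1]) fun hd => ((hS.isHeightTree i).tail_ne a hai hd).elim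
    rwa [show m + k + (n + 1) = m + (k + 1) + n by omega]

theorem deliversWith (hS : S.IsPacking G d h) {v : α} {n : ℕ}
    (hr : S.Reaches d F n v (S.first v)) : S.DeliversWith G d F v n := by
  have := hS.exists_trajectory (k := 0) hr (.start (G := G)) rfl (fun n e hn => by rwa [zero_add])
    fun _ => rfl
  simpa using this

/-- A packet following the tree `i` reaches `d` or hits a failed arc. -/
theorem reaches_or_hit (hS : S.IsPacking G d h) (F : Set β) (i : ι) (v : α) (hv : v ∈ V(G)) :
    S.Reaches d F 0 v i ∨ ∃ a ∈ S.tree i, a.edge ∈ F ∧ h i a.tail ≤ h i v ∧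
      ∀ n, S.Reaches d F n a.tail (S.reroute a.tail i) → S.Reaches d F (n + 1) v i := by
  induction hn : h i v using Nat.strong_induction_on generalizing v with
  | _ n ih =>
  subst hn
  by_cases hvd : v = d
  · exact Or.inl (hvd ▸ .root i)
  obtain ⟨a, ha, rfl⟩ := (hS.isHeightTree i).exists_out v hv hvd
  by_cases haF : a.edge ∈ F
  · exact Or.inr ⟨a, ha, haF, le_rfl, fun n hr => .switch ha haF hr⟩
  have hlt := (hS.isHeightTree i).lt a ha
  rcases ih _ hlt a.head ((hS.isHeightTree i).head_mem ha) rfl with hr | ⟨b, hb, hbF, hle, hr⟩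
  · exact Or.inl (.forward ha haF hr)
  · exact Or.inr ⟨b, hb, hbF, hle.trans hlt.le, fun n h => .forward ha haF (hr n h)⟩

theorem exists_hit (hS : S.IsPacking G d h) {i : ι} {v : α} (hv : v ∈ V(G)) {N : ℕ}
    (hN : ∀ n ≤ N, ¬S.Reaches d F n v i) : ∃ a ∈ S.tree i, a.edge ∈ F ∧ h i a.tail ≤ h i v ∧
      a.tail ∈ V(G) ∧ ∀ n, n + 1 ≤ N → ¬S.Reaches d F n a.tail (S.reroute a.tail i) := by
  obtain ⟨a, ha, haF, hle, hr⟩ := (hS.reaches_or_hit F i v hv).resolve_left (hN 0 N.zero_le)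
  exact ⟨a, ha, haF, hle, ((hS.isHeightTree i).subset_arcs ha).left_mem,
    fun n hn h => hN _ hn (hr n h)⟩

end IsPacking

end TreeScheme

theorem eq_of_card_le_three {F : Finset β} (hF : F.card ≤ 3) {a b c e : β} (ha : a ∈ F)
    (hb : b ∈ F) (hc : c ∈ F) (he : e ∈ F) (hab : a ≠ b) (hac : a ≠ c) (hbc : b ≠ c) (heb : e ≠ b)
    (hec : e ≠ c) : e = a := by
  classical
  by_contra hea
  have h1 : ({a, b, c, e} : Finset β).card = 4 := by
    rw [Finset.card_insert_of_notMem (by simp [hab, hac, Ne.symm hea]),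
      Finset.card_insert_of_notMem (by simp [hbc, heb.symm]),
      Finset.card_insert_of_notMem (by simpa using hec.symm), Finset.card_singleton]
  have h2 : ({a, b, c, e} : Finset β) ⊆ F := by
    simp [Finset.insert_subset_iff, ha, hb, hc, he]
  have := Finset.card_le_card h2
  omega

/-- In a circular routing along four trees with edge-disjoint mates, a packet does not hit seven
arcs whose edges belong to a set of three edges. -/
theorem false_of_seven_hits {F : Finset β} (hF : F.card ≤ 3) (e : Fin 7 → β) (he : ∀ k, e k ∈ F)
    (h1 : ∀ k : Fin 6, e k.castSucc ≠ e k.succ) (h02 : e 0 ≠ e 2) (h13 : e 1 ≠ e 3)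
    (h35 : e 3 ≠ e 5) (h46 : e 4 ≠ e 6) (h06 : e 0 ≠ e 6) : False := by
  -- Hits 0, 1, 2 exhaust the three edges, so hit 3 repeats hit 0. In the same way hit 6 repeats hit
  -- 3.
  have h3 := eq_of_card_le_three hF (he 0) (he 1) (he 2) (he 3) (h1 0) h02 (h1 1) h13.symm
    (h1 2).symm
  have h6 := eq_of_card_le_three hF (he 3) (he 4) (he 5) (he 6) (h1 3) h35 (h1 4) h46.symm
    (h1 5).symm
  exact h06 (h3.symm.trans h6.symm)

end

/-! ### Resilience of the two routing schemes. -/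

section

variable {α β ι : Type*} {G : Graph α β} {d : α}

namespace TreeScheme

/-- A packet not delivered within `N` switches leaves a record of `N + 1` hits. The height bound
says that each hit is found on the way down from the previous one. -/
theorem IsPacking.exists_hits {S : TreeScheme α β ι} {h : ι → α → ℕ} {F : Set β}
    (hS : S.IsPacking G d h) {N : ℕ} {i : ι} {v : α} (hv : v ∈ V(G))
    (hN : ∀ n ≤ N, ¬S.Reaches d F n v i) :
    ∃ (a : ℕ → Arc α β) (t : ℕ → ι), t 0 = i ∧ h i (a 0).tail ≤ h i v ∧
      (∀ k ≤ N, a k ∈ S.tree (t k) ∧ (a k).edge ∈ F) ∧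
      ∀ k < N, t (k + 1) = S.reroute (a k).tail (t k) ∧
        h (t (k + 1)) (a (k + 1)).tail ≤ h (t (k + 1)) (a k).tail := by
  induction N generalizing i v with
  | zero =>
    obtain ⟨a, ha, haF, hle, -⟩ := hS.exists_hit hv hN
    exact ⟨fun _ => a, fun _ => i, rfl, hle, fun _ _ => ⟨ha, haF⟩,
      fun k hk => (k.not_lt_zero hk).elim⟩
  | succ N ih =>
    obtain ⟨a, ha, haF, hle, haV, hr⟩ := hS.exists_hit hv hN
    obtain ⟨b, t, ht, hle', hmem, hnext⟩ := ih haV fun n hn => hr n (by omega)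
    refine ⟨fun k => k.casesOn a b, fun k => k.casesOn i t, rfl, hle, ?_, ?_⟩
    · rintro (_ | k) hk
      · exact ⟨ha, haF⟩
      · exact hmem k (by omega)
    · rintro (_ | k) hk
      · refine ⟨ht, ?_⟩
        change h (t 0) (b 0).tail ≤ h (t 0) a.tail
        rwa [ht]
      · exact hnext k (by omega)

theorem isPacking_circular {k : ℕ} [NeZero k] {T : Fin (k + 1) → Set (Arc α β)}
    {h : Fin (k + 1) → α → ℕ} (hT : ∀ i, IsHeightTree G d (T i) (h i))
    (hdisj : ∀ i j, i ≠ j → Disjoint (T i) (T j)) (start : α → Fin k) :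
    (circular (fun i => T i.castSucc) start).IsPacking G d (fun i => h i.castSucc) :=
  ⟨fun _ => hT _, fun _ _ hij => hdisj _ _ ((Fin.castSucc_injective k).ne hij)⟩

theorem isPacking_lastThenCircular {k : ℕ} [NeZero k] {T : Fin (k + 1) → Set (Arc α β)}
    {h : Fin (k + 1) → α → ℕ} (hT : ∀ i, IsHeightTree G d (T i) (h i))
    (hdisj : ∀ i j, i ≠ j → Disjoint (T i) (T j)) (entry : α → Fin k) :
    (lastThenCircular T entry).IsPacking G d h :=
  ⟨hT, hdisj⟩

theorem lastThenCircular_reroute_last {k : ℕ} [NeZero k] (T : Fin (k + 1) → Set (Arc α β))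
    (entry : α → Fin k) (v : α) :
    (lastThenCircular T entry).reroute v (Fin.last k) = (entry v).castSucc := by
  simp [lastThenCircular]

theorem lastThenCircular_reroute_castSucc {k : ℕ} [NeZero k] (T : Fin (k + 1) → Set (Arc α β))
    (entry : α → Fin k) (v : α) (j : Fin k) :
    (lastThenCircular T entry).reroute v j.castSucc = (j + 1).castSucc := by
  simp [lastThenCircular]

/-- The last tree has one arc out of each vertex at most, and by arc-disjointness its reverse lies
in at most one circular tree. Where there is no such tree, any entry will do. -/
theorem exists_entry {k : ℕ} [NeZero k] {T : Fin (k + 1) → Set (Arc α β)}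
    {h : Fin (k + 1) → α → ℕ} (hT : ∀ i, IsHeightTree G d (T i) (h i))
    (hdisj : ∀ i j, i ≠ j → Disjoint (T i) (T j)) :
    ∃ entry : α → Fin k, ∀ a ∈ T (Fin.last k), ∀ j : Fin k,
      ⟨a.edge, a.head, a.tail⟩ ∈ T j.castSucc → entry a.tail = j := by
  have hex : ∀ v, ∃ s : Fin k, ∀ a ∈ T (Fin.last k), a.tail = v → ∀ j : Fin k,
      ⟨a.edge, a.head, a.tail⟩ ∈ T j.castSucc → s = j := by
    intro v
    by_cases hv : ∃ a ∈ T (Fin.last k), a.tail = v ∧ ∃ j : Fin k,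
        ⟨a.edge, a.head, a.tail⟩ ∈ T j.castSucc
    · obtain ⟨a, ha, hav, s, hs⟩ := hv
      refine ⟨s, fun b hb hbv j hj => ?_⟩
      obtain rfl := (hT _).out_unique a ha b hb (hav.trans hbv.symm)
      by_contra hne
      exact Set.disjoint_left.1 (hdisj _ _ ((Fin.castSucc_injective k).ne hne)) hs hj
    · exact ⟨0, fun a ha hav j hj => (hv ⟨a, ha, hav, j, hj⟩).elim⟩
  choose entry hentry using hex
  exact ⟨entry, fun a ha j hj => hentry _ a ha rfl j hj⟩

variable {T : Fin 5 → Set (Arc α β)} {h : Fin 5 → α → ℕ}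

theorem mate_castSucc (j : Fin 4) : mate j.castSucc = (j + 2).castSucc ∧
    mate j.castSucc ≠ j.castSucc := by
  revert j
  decide

/-- Trees two places apart are mates. Six is two modulo four, so this applies to the first and the
seventh hit as well. -/
theorem circular_reaches (hT : ∀ i, IsHeightTree G d (T i) (h i))
    (hdisj : ∀ i j, i ≠ j → Disjoint (T i) (T j))
    (hmate : ∀ i, mate i ≠ i → ∀ a ∈ T i, ∀ b ∈ T (mate i), a.edge ≠ b.edge)
    (start : α → Fin 4) {F : Finset β} (hF : F.card ≤ 3) {v : α} (hv : v ∈ V(G)) (i : Fin 4) :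
    ∃ n, (circular (fun i : Fin 4 => T i.castSucc) start).Reaches d (F : Set β) n v i := by
  by_contra! hcon
  have hS := isPacking_circular hT hdisj start
  obtain ⟨a, t, -, -, hmem, hnext⟩ := hS.exists_hits (N := 6) hv fun n _ => hcon n
  have ht : ∀ k < 6, t (k + 1) = t k + 1 := fun k hk => (hnext k hk).1
  have h2 : ∀ k l, k ≤ 6 → l ≤ 6 → t l = t k + 2 → (a k).edge ≠ (a l).edge := by
    intro k l hk hl htl
    obtain ⟨h1, h2⟩ := mate_castSucc (t k)
    refine hmate _ h2 _ (hmem k hk).1 _ ?_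
    rw [h1, ← htl]
    exact (hmem l hl).1
  have h3 : ∀ k, k + 2 ≤ 6 → t (k + 2) = t k + 2 := fun k hk => by
    rw [ht (k + 1) (by omega), ht k (by omega), add_assoc]
    rfl
  refine false_of_seven_hits hF (fun k => (a k).edge) (fun k => (hmem k (by omega)).2)
    (fun k => ?_) (h2 0 2 (by omega) (by omega) (h3 0 (by omega)))
    (h2 1 3 (by omega) (by omega) (h3 1 (by omega)))
    (h2 3 5 (by omega) (by omega) (h3 3 (by omega)))
    (h2 4 6 (by omega) (by omega) (h3 4 (by omega)))
    (h2 0 6 (by omega) (by omega) ?_)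
  · refine hS.edge_ne_of_le ?_ (hmem k (by omega)).1 (hmem (k + 1) (by omega)).1
      (hnext k (by omega)).2
    rw [ht k (by omega)]
    generalize t k = x
    revert x
    decide
  · rw [h3 4 (by omega), h3 2 (by omega), h3 0 (by omega)]
    generalize t 0 = x
    revert x
    decide

theorem lastThenCircular_reaches (hT : ∀ i, IsHeightTree G d (T i) (h i))
    (hdisj : ∀ i j, i ≠ j → Disjoint (T i) (T j))
    (hmate : ∀ i, mate i ≠ i → ∀ a ∈ T i, ∀ b ∈ T (mate i), a.edge ≠ b.edge)
    {entry : α → Fin 4} (hentry : ∀ a ∈ T (Fin.last 4), ∀ j : Fin 4,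
      ⟨a.edge, a.head, a.tail⟩ ∈ T j.castSucc → entry a.tail = j)
    {F : Finset β} (hF : F.card ≤ 4) {v : α} (hv : v ∈ V(G)) :
    ∃ n ≤ 2 * F.card, (lastThenCircular T entry).Reaches d (F : Set β) n v (Fin.last 4) := by
  classical
  by_contra! hcon
  have hS := isPacking_lastThenCircular hT hdisj entry
  obtain ⟨a, t, ht0, -, hmem, hnext⟩ := hS.exists_hits (N := 2 * F.card) hv hcon
  generalize hN : 2 * F.card = N at hmem hnext
  have hmemF : ∀ k ≤ N, (a k).edge ∈ F := fun k hk => (hmem k hk).2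
  have ht : ∀ k < N, t (k + 1) = (entry (a 0).tail + k • (1 : Fin 4)).castSucc := by
    intro k
    induction k with
    | zero =>
      intro hk
      rw [(hnext 0 hk).1, ht0, zero_smul, add_zero]
      exact lastThenCircular_reroute_last T entry _
    | succ k ih =>
      intro hk
      rw [(hnext _ hk).1, ih (by omega), succ_nsmul, ← add_assoc]
      exact lastThenCircular_reroute_castSucc T entry _ _
  have hconsec : ∀ k < N, (a k).edge ≠ (a (k + 1)).edge := by
    intro k hk
    refine hS.edge_ne_of_le ?_ (hmem k (by omega)).1 (hmem (k + 1) (by omega)).1 (hnext k hk).2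
    cases k with
    | zero =>
      rw [ht0, ht 0 hk]
      exact (Fin.castSucc_lt_last _).ne'
    | succ k =>
      rw [ht k (by omega), ht _ hk, succ_nsmul, ← add_assoc]
      generalize entry (a 0).tail + k • (1 : Fin 4) = x
      revert x
      decide
  have hmates : ∀ k l, k < N → l < N → l • (1 : Fin 4) = k • 1 + 2 →
      (a (k + 1)).edge ≠ (a (l + 1)).edge := by
    intro k l hk hl hkl
    obtain ⟨h1, h2⟩ := mate_castSucc (entry (a 0).tail + k • (1 : Fin 4))
    refine hmate _ h2 _ (ht k hk ▸ (hmem (k + 1) hk).1) _ ?_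
    rw [h1, add_assoc, ← hkl, ← ht l hl]
    exact (hmem (l + 1) hl).1
  have hrev : ∀ k < N, (a 0).edge = (a (k + 1)).edge →
      (a 0).tail = (a (k + 1)).head ∧ (a 0).head = (a (k + 1)).tail := by
    intro k hk
    refine hS.reverse_of_edge_eq ?_ (hmem 0 (by omega)).1 (hmem (k + 1) hk).1
    rw [ht0, ht k hk]
    exact (Fin.castSucc_lt_last _).ne'
  -- The first failed edge can recur only through the reverse of its arc, which by the choice of
  -- `entry` belongs to the starting circular tree, in use at hits 1, 5, 9 and so on.
  have hfirst : ∀ k < N, k • (1 : Fin 4) ≠ 0 → (a 0).edge ≠ (a (k + 1)).edge := by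
    intro k hk hk0 heq
    obtain ⟨h1, h2⟩ := hrev k hk heq
    have h0 := (hmem 0 (by omega)).1
    rw [ht0] at h0
    have h3 := hentry (a 0) h0 (entry (a 0).tail + k • (1 : Fin 4)) (by
      have h4 : (⟨(a 0).edge, (a 0).head, (a 0).tail⟩ : Arc α β) = a (k + 1) := by
        rw [heq, h1, h2]
      rw [h4, ← ht k hk]
      exact (hmem (k + 1) hk).1)
    exact hk0 (by simpa using h3.symm)
  -- There are `2 * F.card + 1` hits, so every new distinct failed edge guarantees further hits.
  -- This bootstraps to four failed edges and hits 0 to 8.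
  have hcard1 : 0 < F.card := Finset.card_pos.2 ⟨_, hmemF 0 (by omega)⟩
  have h01 := hconsec 0 (by omega)
  have hcard2 : 1 < F.card := Finset.one_lt_card.2
    ⟨_, hmemF 0 (by omega), _, hmemF 1 (by omega), h01⟩
  have h02 := hfirst 1 (by omega) (by decide)
  have h03 := hfirst 2 (by omega) (by decide)
  have h04 := hfirst 3 (by omega) (by decide)
  have h12 := hconsec 1 (by omega)
  have h23 := hconsec 2 (by omega)
  have h13 := hmates 0 2 (by omega) (by omega) (by decide)
  have hmemF' : ∀ k < N, (a 0).edge ≠ (a (k + 1)).edge → (a (k + 1)).edge ∈ F.erase (a 0).edge :=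
    fun k hk hne => Finset.mem_erase.2 ⟨hne.symm, hmemF _ hk⟩
  have hm1 := hmemF' 0 (by omega) h01
  have hm2 := hmemF' 1 (by omega) h02
  have hm3 := hmemF' 2 (by omega) h03
  have hm4 := hmemF' 3 (by omega) h04
  have hcard : (F.erase (a 0).edge).card = F.card - 1 :=
    Finset.card_erase_of_mem (hmemF 0 (by omega))
  have hcard3 : 2 < (F.erase (a 0).edge).card :=
    Finset.two_lt_card.2 ⟨_, hm1, _, hm2, _, hm3, h12, h13, h23⟩
  have hle3 : (F.erase (a 0).edge).card ≤ 3 := by omega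
  have h24 := hmates 1 3 (by omega) (by omega) (by decide)
  have h34 := hconsec 3 (by omega)
  have h41 := eq_of_card_le_three hle3 hm1 hm2 hm3 hm4 h12 h13 h23 h24.symm h34.symm
  -- Hit 4 is the reverse of hit 1, so the packet restarts on tree `t 5 = t 1` from the head of arc
  -- 1, below the tail of arc 0. If arc 5 were the reverse of arc 0, it would end at that higher
  -- vertex.
  have h05 : (a 0).edge ≠ (a 5).edge := by
    intro h05
    obtain ⟨h1, h2⟩ := hrev 4 (by omega) h05
    have h3 : (a 4).tail = (a 1).head := (hS.reverse_of_edge_eq (by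
      rw [ht 3 (by omega), ht 0 (by omega)]
      generalize entry (a 0).tail = x
      revert x
      decide) (hmem 4 (by omega)).1 (hmem 1 (by omega)).1 h41).1
    have ht5 : t 5 = t 1 := by
      rw [ht 4 (by omega), ht 0 (by omega)]
      generalize entry (a 0).tail = x
      revert x
      decide
    have h4 := (hS.isHeightTree _).lt _ (hmem 5 (by omega)).1
    have h5 := (hnext 4 (by omega)).2
    have h6 := (hS.isHeightTree _).lt _ (hmem 1 (by omega)).1
    have h7 := (hnext 0 (by omega)).2
    simp only [zero_add, Nat.reduceAdd] at h1 h5 h7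
    rw [ht5] at h4 h5
    rw [← h1] at h4
    rw [h3] at h5
    omega
  -- Hits 1 to 7 avoid the first failed edge and thus live on the three others.
  refine false_of_seven_hits hle3 (fun k => (a (k + 1)).edge) (fun k => ?_)
    (fun k => hconsec (k + 1) (by omega)) h13 h24 (hmates 3 5 (by omega) (by omega) (by decide))
    (hmates 4 6 (by omega) (by omega) (by decide)) (hmates 0 6 (by omega) (by omega) (by decide))
  refine hmemF' k (by omega) ?_
  by_cases hk : k = 0 ∨ k = 4
  · rcases hk with rfl | rfl
    exacts [h01, h05]
  · refine hfirst k (by omega) ?_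
    revert k
    decide

end TreeScheme

end

end StaticRouting

theorem theorem4 {α β : Type*} (G : Graph α β) (hV : V(G).Finite) (hE : E(G).Finite)
    (hG : StaticRouting.IsEdgeConnected G 5) (d : α) (hd : d ∈ V(G)) :
    ∃ (T : Fin 5 → Set (StaticRouting.Arc α β)) (entry : α → Fin 4),
      (∀ i, StaticRouting.IsSpanningArborescence G d (T i)) ∧
      (∀ i j, i ≠ j → Disjoint (T i) (T j)) ∧
      (∀ start : α → Fin 4, StaticRouting.IsResilient G d
        (StaticRouting.TreeScheme.circular (fun i : Fin 4 => T i.castSucc) start).routing 3) ∧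
      StaticRouting.IsResilient G d
        (StaticRouting.TreeScheme.lastThenCircular T entry).routing 4 ∧
      ∀ F ⊆ E(G), F.ncard ≤ 4 → ∀ v ∈ V(G), ∃ n ≤ 2 * F.ncard,
        (StaticRouting.TreeScheme.lastThenCircular T entry).DeliversWith G d F v n := by
  open StaticRouting TreeScheme in
  obtain ⟨T, h, hT, hdisj, hmate⟩ := hG.exists_trees hV hE hd
  obtain ⟨entry, hentry⟩ := exists_entry (k := 4) hT hdisj
  have hlast : ∀ F ⊆ E(G), F.ncard ≤ 4 → ∀ v ∈ V(G), ∃ n ≤ 2 * F.ncard,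
      (lastThenCircular T entry).DeliversWith G d F v n := by
    intro F hF hcard v hv
    lift F to Finset β using hE.subset hF
    rw [Set.ncard_coe_finset] at hcard ⊢
    obtain ⟨n, hn, hr⟩ := lastThenCircular_reaches hT hdisj hmate hentry hcard hv
    exact ⟨n, hn, (isPacking_lastThenCircular hT hdisj entry).deliversWith hr⟩
  refine ⟨T, entry, fun i => (hT i).isSpanningArborescence hd, hdisj, ?_, ?_, hlast⟩
  · intro start F hF hcard v hv _
    lift F to Finset β using hE.subset hF
    rw [Set.encard_coe_eq_coe_finsetCard] at hcard
    obtain ⟨n, hr⟩ := circular_reaches hT hdisj hmate start (F := F) (by exact_mod_cast hcard) hv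
      (start v)
    exact ((isPacking_circular hT hdisj start).deliversWith hr).delivers
  · intro F hF hcard v hv _
    obtain ⟨n, -, hn⟩ := hlast F hF ((Set.ncard_le_encard F).trans hcard |> Nat.cast_le.1) v hv
    exact hn.delivers
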